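/- **Setting.** Let $\Sigma$ be an infinite set of actions and $M$ an infinite set of lock variables, both named by binary strings. For a set $X$, an indexed trace over $X$ is a finite word over $X\times\mathbb N$; the letter $\langle x:i\rangle$ means that thread $i$ performs $x$. A *synchronization alphabet* is a set $S$ disjoint from $\Sigma$ with a predicate $\mathsf{sync}$ on indexed traces over $\Sigma\cup S$ that is invariant under permutations of thread indices. - *Locks:* $S_{lk}=\{\mathrm{acq}(m),\mathrm{rel}(m)\mid m\in M\}$; $\mathsf{sync}_{lk}(\tau)$ holds iff for each $m$ the projection of $\tau$ to the operations on $m$ is a sequence of pairs $\langle \mathrm{acq}(m):i\rangle\langle\mathrm{rel}(m):i\rangle$ (with $i$ depending on the pair), possibly followed by one last $\langle\mathrm{acq}(m):i\rangle$. - *Sync-points:* $S_\bullet=\{\bullet\}$; $\mathsf{sync}_\bullet(\tau)$ holds iff $\mathsf{sync}_{\bullet,T}(\tau)$ holds for some finite $T\subseteq\mathbb N$, where $\mathsf{sync}_{\bullet,\emptyset}(\varepsilon)$ holds and, inductively, $\mathsf{sync}_{\bullet,T}(\tau_1\tau_2)$ holds whenever $\tau_1$ is a concatenation of letters from $\Sigma\times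 T$ and of words $\langle\bullet:t_1\rangle\cdots\langle\bullet:t_k\rangle$ that enumerate $T$ without repetition, and $\mathsf{sync}_{\bullet,T'}(\tau_2)$ holds for some $T'\subsetneq T$. - *Both:* over $\Sigma\cup S_{lk}\cup\{\bullet\}$, a trace is admitted iff its projection to $\Sigma\cup S_{lk}$ satisfies $\mathsf{sync}_{lk}$ and its projection to $\Sigma\cup\{\bullet\}$ satisfies $\mathsf{sync}_\bullet$. A *control flow graph* $G$ has finitely many locations (named by binary strings), finitely many edges labeled in $\Sigma\cup S$, an initial location $\ell_{init}$ and an exit location $\ell_{exit}\neq\ell_{init}$; every location is reachable from $\ell_{init}$, $\ell_{exit}$ is reachable from every location, and each $a\in\Sigma$ labels at most one edge. $\mathrm{Tr}(G)$ is the set of labels of paths from $\ell_{init}$ to $\ell_{exit}$. A program $P$ consists of a synchronization alphabet and such a graph $G$ (its thread template). Its set $L(P)$ of interleavings consists of the projections to $\Sigma\times\mathbb N$ of all indexed traces $\hat\tau$ with $\mathsf{sync}(\hat\tau)$ in which the local trace $\hat\tau|_i$ of each thread $i$ is in $\mathrm{Tr}(G)\cup\{\varepsilon\}$. A *program with locks*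 is a program over the lock alphabet. *Coverability problem of programs with locks.* Given a program with locks $P$ and a finite multiset $C=[\ell_1,\dots,\ell_n]$ of its locations, decide whether $C$ is *coverable*: there are an indexed trace $\hat\tau$ over $S_{lk}$ and the actions occurring in $G$, with $\mathsf{sync}_{lk}(\hat\tau)$, and distinct threads $t_1,\dots,t_n$ such that $\hat\tau|_{t_k}$ labels a path from $\ell_{init}$ to $\ell_k$ for each $k$. *Sync-point soundness problem of programs with locks.* A *sync-point instrumentation* of a program with locks $P$ with template $G$ is a control flow graph $G'$ over $\Sigma\cup S_{lk}\cup\{\bullet\}$ such that $\mathrm{Tr}(G)$ is the projection of $\mathrm{Tr}(G')$ to $\Sigma\cup S_{lk}$, and any two traces in $\mathrm{Tr}(G')$ with the same projection to $\Sigma$ are equal. Let $P_{+G'}$ be the program with template $G'$ over the combined alphabet. For a relation $I$ on the actions of $\Sigma$ that occur in $G$, let $\sqsubseteq_I$ be the smallest reflexive-transitive relation with $\rho\langle a:i\rangle\langle b:j\rangle\sigma\sqsubseteq_I\rho\langle b:j\rangle\langle a:i\rangle\sigma$ for $(a,b)\in I$, $i\ne j$. Then $G'$ is *sound* with respect to $I$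 if $L(P_{+G'})\subseteq L(P)$ and every $\tau\in L(P)$ satisfies $\tau\sqsubseteq_I\tau'$ for some $\tau'\in L(P_{+G'})$. Given $P$, a sync-point instrumentation $G'$ of $P$ and $I$, decide whether $G'$ is sound with respect to $I$. **Theorem.** Coverability of programs with locks is polynomial-time reducible to (the complement of) sync-point soundness of programs with locks. That is, there is a function, computable in polynomial time by a multi-stack Turing machine (under an explicit injective encoding of the instances over a finite alphabet), that maps each instance $(P,C)$ of the coverability problem to an instance $(\hat P,G',I)$ of the sync-point soundness problem such that $G'$ is sound with respect to $I$ if and only if $C$ is not coverable in $P$. Moreover, for every relation $I'$ on the actions that occur in $\hat P$, $G'$ is sound with respect to $I'$ if and only if $C$ is not coverable in $P$. -/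

import Mathlib

namespace LockPrograms

/-! ### Traces

An indexed trace over `X` is a word over `X × ℕ`; the letter `(a, i)` is the action `a` performed by
thread `i`.  Over a set `A` of (ordinary) actions and a set `S` of synchronization actions, the
letters are taken from the disjoint union `A ⊕ S`. -/

/-- Indexed traces over `X`. -/
abbrev Trace (X : Type) : Type := List (X × ℕ)

/-- The trace of thread `i` in an indexed trace. -/
def localTrace {X : Type} (τ : Trace X) (i : ℕ) : List X :=
  (τ.filter fun x => decide (x.2 = i)).map Prod.fst

/-- Projection of an indexed trace along a partial map of letters; letters outside the domain of
the map are dropped. -/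
def proj {X Y : Type} (p : X → Option Y) (τ : Trace X) : Trace Y :=
  τ.filterMap fun x => (p x.1).map fun y => (y, x.2)

/-- Projection to the ordinary actions. -/
def keepAct {A S : Type} : A ⊕ S → Option A
  | Sum.inl a => some a
  | Sum.inr _ => none

/-- Projection from `A ∪ S₁ ∪ S₂` to `A ∪ S₁`. -/
def keepFst {A S₁ S₂ : Type} : A ⊕ (S₁ ⊕ S₂) → Option (A ⊕ S₁)
  | Sum.inl a => some (Sum.inl a)
  | Sum.inr (Sum.inl s) => some (Sum.inr s)
  | Sum.inr (Sum.inr _) => none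

/-- Projection from `A ∪ S₁ ∪ S₂` to `A ∪ S₂`. -/
def keepSnd {A S₁ S₂ : Type} : A ⊕ (S₁ ⊕ S₂) → Option (A ⊕ S₂)
  | Sum.inl a => some (Sum.inl a)
  | Sum.inr (Sum.inl _) => none
  | Sum.inr (Sum.inr s) => some (Sum.inr s)

/-- Renaming the threads of an indexed trace. -/
def permute {X : Type} (π : Equiv.Perm ℕ) (τ : Trace X) : Trace X :=
  τ.map fun x => (x.1, π x.2)

/-! ### Synchronization alphabets -/

/-- A synchronization alphabet with synchronization actions `S`: a predicate on indexed traces over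
`A ∪ S` which is preserved by all permutations of thread indices. -/
structure SyncAlphabet (A S : Type) where
  Sync : Trace (A ⊕ S) → Prop
  perm_inv : ∀ (π : Equiv.Perm ℕ) (τ : Trace (A ⊕ S)), Sync τ → Sync (permute π τ)

theorem proj_permute {X Y : Type} (p : X → Option Y) (π : Equiv.Perm ℕ) (τ : Trace X) :
    proj p (permute π τ) = permute π (proj p τ) := by
  induction τ with
  | nil => rfl
  | cons x τ ih =>
    obtain ⟨x, i⟩ := x
    have ih' := ih
    simp only [proj, permute] at ih'
    cases h : p x <;> simp [proj, permute, h, ih']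

/-- The joint synchronization alphabet of two synchronization alphabets. -/
def SyncAlphabet.oplus {A S₁ S₂ : Type} (X : SyncAlphabet A S₁) (Y : SyncAlphabet A S₂) :
    SyncAlphabet A (S₁ ⊕ S₂) where
  Sync τ := X.Sync (proj keepFst τ) ∧ Y.Sync (proj keepSnd τ)
  perm_inv π τ h := by
    rw [proj_permute, proj_permute]
    exact ⟨X.perm_inv π _ h.1, Y.perm_inv π _ h.2⟩

/-- Lock operations over the set `M` of lock variables. -/
inductive LockOp (M : Type)
  | acq (m : M)
  | rel (m : M)

/-- The lock on which an operation acts. -/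
def LockOp.lock {M : Type} : LockOp M → M
  | LockOp.acq m => m
  | LockOp.rel m => m

/-- Does this letter act on the lock `m`? -/
def actsOn {A M : Type} [DecidableEq M] (m : M) : A ⊕ LockOp M → Bool
  | Sum.inl _ => false
  | Sum.inr o => decide (o.lock = m)

/-- The projection of the trace to the operations on `m`. -/
def lockTrace {A M : Type} [DecidableEq M] (m : M) (τ : Trace (A ⊕ LockOp M)) :
    Trace (A ⊕ LockOp M) :=
  τ.filter fun x => actsOn m x.1

/-- The lock discipline: for each lock `m`, the operations on `m` form a sequence of pairs
`acq m, rel m`, each performed by a single thread, possibly followed by one last `acq m`. -/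
def LockSync {A M : Type} [DecidableEq M] (τ : Trace (A ⊕ LockOp M)) : Prop :=
  ∀ m : M, ∃ (is : List ℕ) (rest : Trace (A ⊕ LockOp M)),
    lockTrace m τ =
      is.flatMap (fun i => [(Sum.inr (LockOp.acq m), i), (Sum.inr (LockOp.rel m), i)]) ++ rest ∧
    (rest = [] ∨ ∃ i : ℕ, rest = [(Sum.inr (LockOp.acq m), i)])

/-- The lock synchronization alphabet. -/
def locks (A M : Type) [DecidableEq M] : SyncAlphabet A (LockOp M) where
  Sync := LockSync
  perm_inv π τ h m := by
    obtain ⟨is, rest, h1, h2⟩ := h m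
    have hcomm : lockTrace m (permute π τ) = permute π (lockTrace m τ) := by
      simp only [lockTrace, permute, List.filter_map]
      rfl
    refine ⟨is.map π, permute π rest, ?_, ?_⟩
    · rw [hcomm, h1]
      simp [permute, List.map_flatMap, List.flatMap_map]
    · rcases h2 with rfl | ⟨i, rfl⟩
      · exact Or.inl rfl
      · exact Or.inr ⟨π i, rfl⟩

/-- While exactly the threads in `T` are running: the words in `((A × T)* + •_T)*`, where `•` is the
sync-point symbol `Sum.inr ()`, and `•_T` denotes a word in which each thread of `T` performs `•`
exactly once (in any order) and which has no other letters. -/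
inductive Phase {A : Type} (T : Finset ℕ) : Trace (A ⊕ Unit) → Prop
  | nil : Phase T []
  | act (a : A) (i : ℕ) (τ : Trace (A ⊕ Unit)) : i ∈ T → Phase T τ →
      Phase T ((Sum.inl a, i) :: τ)
  | barrier (l : List ℕ) (τ : Trace (A ⊕ Unit)) : l.Nodup → l.toFinset = T → Phase T τ →
      Phase T (l.map (fun i => (Sum.inr (), i)) ++ τ)

/-- The sync-point discipline when the set of running threads is initially `T`.  Some threads may
terminate and then perform no further letters; the others continue.  The recursion ends when no
thread is running. -/
inductive SyncFrom {A : Type} : Finset ℕ → Trace (A ⊕ Unit) → Prop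
  | done : SyncFrom ∅ []
  | step (T T' : Finset ℕ) (τ₁ τ₂ : Trace (A ⊕ Unit)) : Phase T τ₁ → T' ⊂ T → SyncFrom T' τ₂ →
      SyncFrom T (τ₁ ++ τ₂)

theorem Phase.permute {A : Type} (π : Equiv.Perm ℕ) {T : Finset ℕ} {τ : Trace (A ⊕ Unit)}
    (h : Phase T τ) : Phase (T.map π.toEmbedding) (permute π τ) := by
  induction h with
  | nil => exact Phase.nil
  | act a i τ hi _ ih => exact Phase.act a (π i) _ (by simpa using hi) ih
  | barrier l τ hl hT _ ih =>
    have := Phase.barrier (l.map π) _ (hl.map π.injective)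
      (by ext x; simp [← hT, ← Equiv.eq_symm_apply]) ih
    simpa [LockPrograms.permute, Function.comp_def] using this

theorem SyncFrom.permute {A : Type} (π : Equiv.Perm ℕ) {T : Finset ℕ} {τ : Trace (A ⊕ Unit)}
    (h : SyncFrom T τ) : SyncFrom (T.map π.toEmbedding) (permute π τ) := by
  induction h with
  | done => exact SyncFrom.done
  | step T T' τ₁ τ₂ h₁ h₂ _ ih =>
    have := SyncFrom.step _ _ _ _ (h₁.permute π) (Finset.map_ssubset_map.2 h₂) ih
    simpa [LockPrograms.permute] using this

/-- The synchronization alphabet of sync-points, with the unique symbol `•`. -/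
def syncPoints (A : Type) : SyncAlphabet A Unit where
  Sync τ := ∃ T : Finset ℕ, SyncFrom T τ
  perm_inv π _ h := h.elim fun _ hT => ⟨_, hT.permute π⟩

/-! ### Control flow graphs and parameterized programs -/

/-- `PathIn locs edges ℓ w ℓ'`: there is a path from `ℓ` to `ℓ'` labeled by `w`. -/
inductive PathIn {L Λ : Type} (locs : List L) (edges : List (L × Λ × L)) : L → List Λ → L → Prop
  | nil (ℓ : L) : ℓ ∈ locs → PathIn locs edges ℓ [] ℓ
  | cons (ℓ : L) (a : Λ) (ℓ' : L) (w : List Λ) (ℓ'' : L) : (ℓ, a, ℓ') ∈ edges →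
      PathIn locs edges ℓ' w ℓ'' → PathIn locs edges ℓ (a :: w) ℓ''

/-- A control flow graph with locations taken from `L` and edges labeled in `A ∪ S`.  The finite
sets of locations and of edges are given as lists; order and repetitions are irrelevant.  Every
location is reachable from the initial location, the exit location is reachable from every location,
and each ordinary action labels at most one edge. -/
structure CFG (L A S : Type) where
  locs : List L
  edges : List (L × (A ⊕ S) × L)
  init : L
  exit : L
  init_mem : init ∈ locs
  exit_mem : exit ∈ locs
  init_ne_exit : init ≠ exit
  edges_mem : ∀ e ∈ edges, e.1 ∈ locs ∧ e.2.2 ∈ locs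
  reachable : ∀ ℓ ∈ locs, ∃ w, PathIn locs edges init w ℓ
  coreachable : ∀ ℓ ∈ locs, ∃ w, PathIn locs edges ℓ w exit
  unique_edge : ∀ e ∈ edges, ∀ e' ∈ edges, ∀ a : A,
    e.2.1 = Sum.inl a → e'.2.1 = Sum.inl a → e = e'

namespace CFG

variable {L A S : Type}

/-- There is a path from `ℓ` to `ℓ'` labeled by `w`. -/
def Path (G : CFG L A S) (ℓ : L) (w : List (A ⊕ S)) (ℓ' : L) : Prop :=
  PathIn G.locs G.edges ℓ w ℓ'

/-- The actions (ordinary and synchronization) that occur in `G`. -/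
def alphabet (G : CFG L A S) : Set (A ⊕ S) := {x | ∃ e ∈ G.edges, e.2.1 = x}

/-- The ordinary actions that occur in `G`. -/
def actions (G : CFG L A S) : Set A := {a | Sum.inl a ∈ G.alphabet}

/-- The traces of `G`: labels of paths from the initial to the exit location. -/
def traces (G : CFG L A S) : Set (List (A ⊕ S)) := {w | G.Path G.init w G.exit}

end CFG

/-- A parameterized program: a synchronization alphabet and a thread template. -/
structure Program (L A S : Type) where
  sync : SyncAlphabet A S
  template : CFG L A S

namespace Program

variable {L L' A S : Type}

/-- The interleavings of a program. -/
def interleavings (P : Program L A S) : Set (Trace A) :=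
  {τ | ∃ τ' : Trace (A ⊕ S), τ = proj keepAct τ' ∧ P.sync.Sync τ' ∧
    ∀ i : ℕ, localTrace τ' i ∈ P.template.traces ∪ {[]}}

/-- The configuration `C` (a multiset of locations, given by an enumeration) is coverable in `P`. -/
def Coverable (P : Program L A S) (C : List L) : Prop :=
  ∃ τ : Trace (A ⊕ S),
    (∀ x ∈ τ, x.1 ∈ P.template.alphabet ∪ Set.range Sum.inr) ∧
    P.sync.Sync τ ∧
    ∃ t : Fin C.length → ℕ, Function.Injective t ∧
      ∀ k, P.template.Path P.template.init (localTrace τ (t k)) (C.get k)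

end Program

/-! ### Reductions -/

/-- Swapping two adjacent actions `a`, `b` of different threads, where `(a, b) ∈ I`. -/
inductive Swap {A : Type} (I : Set (A × A)) : Trace A → Trace A → Prop
  | mk (ρ σ : Trace A) (a b : A) (i j : ℕ) : (a, b) ∈ I → i ≠ j →
      Swap I (ρ ++ (a, i) :: (b, j) :: σ) (ρ ++ (b, j) :: (a, i) :: σ)

/-- The covering preorder: the reflexive-transitive closure of swapping. -/
def CoveredBy {A : Type} (I : Set (A × A)) : Trace A → Trace A → Prop :=
  Relation.ReflTransGen (Swap I)

/-- `L₁` is a Mazurkiewicz reduction of `L₂`. -/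
def IsMazurkiewiczReduction {A : Type} (I : Set (A × A)) (L₁ L₂ : Set (Trace A)) : Prop :=
  L₁ ⊆ L₂ ∧ ∀ τ ∈ L₂, ∃ τ' ∈ L₁, CoveredBy I τ τ'

/-- `G'` is a sync-point instrumentation of (a program with thread template) `G`. -/
def IsSyncPointInstrumentation {L L' A S : Type} (G : CFG L A S) (G' : CFG L' A (S ⊕ Unit)) :
    Prop :=
  G.traces = (fun w => w.filterMap keepFst) '' G'.traces ∧
  ∀ w₁ ∈ G'.traces, ∀ w₂ ∈ G'.traces,
    w₁.filterMap keepAct = w₂.filterMap keepAct → w₁ = w₂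

/-- The program induced by a sync-point instrumentation. -/
def Program.withSyncPoints {L L' A S : Type} (P : Program L A S) (G' : CFG L' A (S ⊕ Unit)) :
    Program L' A (S ⊕ Unit) :=
  ⟨P.sync.oplus (syncPoints A), G'⟩

/-- The sync-point instrumentation `G'` of `P` is sound with respect to `I`. -/
def SoundInstrumentation {L L' A S : Type} (P : Program L A S) (G' : CFG L' A (S ⊕ Unit))
    (I : Set (A × A)) : Prop :=
  IsMazurkiewiczReduction I (P.withSyncPoints G').interleavings P.interleavings

/-! ### The two decision problems

Locations, actions and locks are named by binary strings. -/

/-- Names are binary strings. -/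
abbrev Name : Type := List Bool

/-- The program with locks that has thread template `G`. -/
def lockProgram (G : CFG Name Name (LockOp Name)) : Program Name Name (LockOp Name) :=
  ⟨locks Name Name, G⟩

/-- An instance of the coverability problem of programs with locks. -/
structure CoverInstance where
  G : CFG Name Name (LockOp Name)
  C : List Name
  C_mem : ∀ ℓ ∈ C, ℓ ∈ G.locs

/-- The instance is a yes-instance of coverability. -/
def CoverInstance.IsCoverable (x : CoverInstance) : Prop := (lockProgram x.G).Coverable x.C

/-- An instance of the sync-point soundness problem of programs with locks: a thread template, a
sync-point instrumentation and a (finite) commutativity relation. -/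
structure SoundnessInstance where
  G : CFG Name Name (LockOp Name)
  G' : CFG Name Name (LockOp Name ⊕ Unit)
  isInstrumentation : IsSyncPointInstrumentation G G'
  I : List (Name × Name)
  I_sub : ∀ p ∈ I, p.1 ∈ G.actions ∧ p.2 ∈ G.actions

/-- The instance is a yes-instance of sync-point soundness. -/
def SoundnessInstance.IsSound (y : SoundnessInstance) : Prop :=
  SoundInstrumentation (lockProgram y.G) y.G' {p | p ∈ y.I}

/-! ### Encodings of instances as words over a finite alphabet -/

open Computability (Γ')

/-- A name is written out and terminated by a comma. -/
def encName (w : Name) : List Γ' := w.map Γ'.bit ++ [Γ'.comma]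

/-- Every list item is preceded by `bra`, and the list is terminated by `ket`. -/
def encList {X : Type} (e : X → List Γ') (l : List X) : List Γ' :=
  l.flatMap (fun x => Γ'.bra :: e x) ++ [Γ'.ket]

/-- Labels of programs with locks: two bits for the kind, followed by the name. -/
def encLabel : Name ⊕ LockOp Name → List Γ'
  | Sum.inl a => Γ'.bit false :: Γ'.bit false :: encName a
  | Sum.inr (LockOp.acq m) => Γ'.bit false :: Γ'.bit true :: encName m
  | Sum.inr (LockOp.rel m) => Γ'.bit true :: Γ'.bit false :: encName m

/-- Labels of programs with locks and sync-points. -/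
def encLabel' : Name ⊕ (LockOp Name ⊕ Unit) → List Γ'
  | Sum.inl a => encLabel (Sum.inl a)
  | Sum.inr (Sum.inl o) => encLabel (Sum.inr o)
  | Sum.inr (Sum.inr ()) => [Γ'.bit true, Γ'.bit true]

/-- Edges: source, label, target. -/
def encEdge {X : Type} (e : X → List Γ') (x : Name × X × Name) : List Γ' :=
  encName x.1 ++ (e x.2.1 ++ encName x.2.2)

/-- Pairs of names. -/
def encPair (x : Name × Name) : List Γ' := encName x.1 ++ encName x.2

/-- Control flow graphs: initial location, exit location, locations, edges. -/
def encCFG {S : Type} (e : Name ⊕ S → List Γ') (G : CFG Name Name S) : List Γ' :=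
  encName G.init ++ (encName G.exit ++ (encList encName G.locs ++ encList (encEdge e) G.edges))

/-- The encoding of instances of coverability. -/
def CoverInstance.encode (x : CoverInstance) : List Γ' :=
  encCFG encLabel x.G ++ encList encName x.C

/-- The encoding of instances of sync-point soundness. -/
def SoundnessInstance.encode (y : SoundnessInstance) : List Γ' :=
  encCFG encLabel y.G ++ (encCFG encLabel' y.G' ++ encList encPair y.I)

/-! The encodings are injective, since all their parts are self-delimiting. -/

/-- A self-delimiting code. -/
def SelfDelim {X : Type} (e : X → List Γ') : Prop :=
  ∀ x y u v, e x ++ u = e y ++ v → x = y ∧ u = v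

theorem selfDelim_encName : SelfDelim encName := by
  intro x
  induction x with
  | nil =>
    intro y u v h
    cases y <;> simp_all [encName]
  | cons b x ih =>
    intro y u v h
    cases y with
    | nil => simp [encName] at h
    | cons c y =>
      simp only [encName, List.map_cons, List.cons_append, List.cons.injEq, Γ'.bit.injEq] at h
      obtain ⟨rfl, rfl⟩ := ih y u v (by simpa [encName] using h.2)
      simp [h.1]

theorem selfDelim_encList {X : Type} {e : X → List Γ'} (he : SelfDelim e) :
    SelfDelim (encList e) := by
  intro x
  induction x with
  | nil =>
    intro y u v h
    cases y <;> simp_all [encList]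
  | cons b x ih =>
    intro y u v h
    cases y with
    | nil => simp [encList] at h
    | cons c y =>
      simp only [encList, List.flatMap_cons, List.cons_append, List.append_assoc,
        List.cons.injEq, true_and] at h
      obtain ⟨rfl, h⟩ := he _ _ _ _ h
      obtain ⟨rfl, rfl⟩ := ih y u v (by simpa [encList] using h)
      simp

theorem selfDelim_encLabel : SelfDelim encLabel := by
  rintro (a | a | a) (b | b | b) u v h <;> simp [encLabel] at h <;>
    obtain ⟨rfl, rfl⟩ := selfDelim_encName _ _ _ _ h <;> simp

theorem selfDelim_encLabel' : SelfDelim encLabel' := by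
  rintro (a | (a | a) | ⟨⟩) (b | (b | b) | ⟨⟩) u v h <;> simp [encLabel', encLabel] at h <;>
    first
    | (subst h; simp)
    | (obtain ⟨rfl, rfl⟩ := selfDelim_encName _ _ _ _ h; simp)

theorem selfDelim_encEdge {X : Type} {e : X → List Γ'} (he : SelfDelim e) :
    SelfDelim (encEdge e) := by
  rintro ⟨a, x, b⟩ ⟨a', x', b'⟩ u v h
  simp only [encEdge, List.append_assoc] at h
  obtain ⟨rfl, h1⟩ := selfDelim_encName _ _ _ _ h
  obtain ⟨rfl, h2⟩ := he _ _ _ _ h1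
  obtain ⟨rfl, h3⟩ := selfDelim_encName _ _ _ _ h2
  exact ⟨rfl, h3⟩

theorem selfDelim_encPair : SelfDelim encPair := by
  rintro ⟨a, b⟩ ⟨a', b'⟩ u v h
  simp only [encPair, List.append_assoc] at h
  obtain ⟨rfl, h1⟩ := selfDelim_encName _ _ _ _ h
  obtain ⟨rfl, h2⟩ := selfDelim_encName _ _ _ _ h1
  exact ⟨rfl, h2⟩

theorem selfDelim_encCFG {S : Type} {e : Name ⊕ S → List Γ'} (he : SelfDelim e) :
    SelfDelim (encCFG e) := by
  rintro ⟨l, d, i, x⟩ ⟨l', d', i', x'⟩ u v h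
  simp only [encCFG, List.append_assoc] at h
  obtain ⟨rfl, h1⟩ := selfDelim_encName _ _ _ _ h
  obtain ⟨rfl, h2⟩ := selfDelim_encName _ _ _ _ h1
  obtain ⟨rfl, h3⟩ := selfDelim_encList selfDelim_encName _ _ _ _ h2
  obtain ⟨rfl, h4⟩ := selfDelim_encList (selfDelim_encEdge he) _ _ _ _ h3
  exact ⟨rfl, h4⟩

theorem CoverInstance.encode_injective : Function.Injective CoverInstance.encode := by
  rintro ⟨G, C⟩ ⟨G', C'⟩ h
  simp only [CoverInstance.encode] at h
  obtain ⟨rfl, h1⟩ := selfDelim_encCFG selfDelim_encLabel _ _ _ _ h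
  obtain ⟨rfl, -⟩ := selfDelim_encList selfDelim_encName _ _ [] [] (by simpa using h1)
  rfl

theorem SoundnessInstance.encode_injective : Function.Injective SoundnessInstance.encode := by
  rintro ⟨G, H, _, I⟩ ⟨G', H', _, I'⟩ h
  simp only [SoundnessInstance.encode] at h
  obtain ⟨rfl, h1⟩ := selfDelim_encCFG selfDelim_encLabel _ _ _ _ h
  obtain ⟨rfl, h2⟩ := selfDelim_encCFG selfDelim_encLabel' _ _ _ _ h1
  obtain ⟨rfl, -⟩ := selfDelim_encList selfDelim_encPair _ _ [] [] (by simpa using h2)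
  rfl

end LockPrograms

/-! Let `n` be the number of locations in `C`. The reduction adds `n + 2` gadgets arranged in a
ring. Gadget `k` starts at the `k`-th location of `C`, and the last two start at a new initial
location. A thread that enters gadget `k` performs an action naming `k`, acquires a lock `onceLock
k` that is never released, acquires `ringLock k`, then briefly acquires the ring lock of the next
gadget, and finally releases `ringLock k`. The instrumentation inserts two sync-points between the
two ring acquisitions. Two additional gadgets make the ring have at least two elements even if `C`
is empty.

If `C` is coverable, threads can be brought to the locations of `C` and the gadgets then executed
one after another, which gives an interleaving in which all gadgets are entered
(`exists_all_called`). Swaps preserve the local traces, and the ordinary actions of a thread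
determine its instrumented trace, so an interleaving of the instrumented program that covers this
one must pass through all gadgets with their sync-points. Consider the first thread that acquires
the next ring lock. It has passed two sync-points, so its neighbour has passed at least one, hence
holds the requested lock, and has not released it: a deadlock (`false_of_all_called`).

If `C` is not coverable, then in each interleaving some gadget is not entered: otherwise deleting
the new letters would exhibit a covering (`coverable_of_callers`). Because of the locks `onceLock
k`, each gadget is entered by at most one thread. Keep all ordinary actions and the operations on
the given locks in their order, and postpone the gadget operations to the end: all callers acquire
their locks, pass both sync-points, and then leave the gadgets one by one, starting next to the gap
in the ring (`exists_finish`). The projection to ordinary actions is unchanged, so the interleaving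
itself belongs to the instrumented program (`mem_interleavings_of_not_caller`). No swap is used, and
the argument of the first case works for all relations; hence the commutativity relation plays no
role.

An instrumented trace has to be determined by its ordinary actions. Therefore each edge of the given
graph is split by an action that encodes the edge.

For the running time, a small language of while-programs over stacks is compiled to multi-stack
machines with a compositional cost bound. Numbers are written in unary, and the program reads the
input once and writes the four location and edge lists of the output in parallel; the cost is
quadratic. -/

open Turing

/-! ### While-programs over stacks and their execution by multi-stack machines. -/

namespace StackProgram

/-- While-programs over stacks indexed by `K` with letters from `Γ`, with one register which holds
the result of the last `pop`. -/
inductive Prog (K Γ : Type) : Type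
  | skip : Prog K Γ
  | push : K → (Option Γ → Γ) → Prog K Γ
  | pop : K → Prog K Γ
  | seq : Prog K Γ → Prog K Γ → Prog K Γ
  | loop : (Option Γ → Bool) → Prog K Γ → Prog K Γ

namespace Prog

variable {K Γ : Type}

/-- The labels of a program: one for each loop. -/
def Lab : Prog K Γ → Type
  | skip => Empty
  | push _ _ => Empty
  | pop _ => Empty
  | seq p q => p.Lab ⊕ q.Lab
  | loop _ p => Option p.Lab

/-- There are finitely many labels. -/
@[reducible]
def labFintype : (p : Prog K Γ) → Fintype p.Lab
  | skip => inferInstanceAs (Fintype Empty)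
  | push _ _ => inferInstanceAs (Fintype Empty)
  | pop _ => inferInstanceAs (Fintype Empty)
  | seq p q =>
    letI := p.labFintype
    letI := q.labFintype
    inferInstanceAs (Fintype (p.Lab ⊕ q.Lab))
  | loop _ p =>
    letI := p.labFintype
    inferInstanceAs (Fintype (Option p.Lab))

/-- Statements of machines that execute programs. -/
abbrev MStmt (K Γ Λ : Type) : Type := TM2.Stmt (fun _ : K => Γ) Λ (Option Γ)

/-- The statement that executes a program and continues with `next`. -/
def entry {Λ : Type} : (p : Prog K Γ) → (p.Lab → Λ) → MStmt K Γ Λ → MStmt K Γ Λ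
  | skip, _, next => next
  | push k f, _, next => TM2.Stmt.push k f next
  | pop k, _, next => TM2.Stmt.pop k (fun _ x => x) next
  | seq p q, emb, next => p.entry (fun l => emb (Sum.inl l)) (q.entry (fun l => emb (Sum.inr l)) next)
  | loop _ _, emb, _ => TM2.Stmt.goto fun _ => emb none

/-- The statement at a label of a program. -/
def code {Λ : Type} : (p : Prog K Γ) → (p.Lab → Λ) → MStmt K Γ Λ → p.Lab → MStmt K Γ Λ
  | skip, _, next, _ => next
  | push _ _, _, next, _ => next
  | pop _, _, next, _ => next
  | seq p q, emb, next, Sum.inl l =>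
    p.code (fun l => emb (Sum.inl l)) (q.entry (fun l => emb (Sum.inr l)) next) l
  | seq _ q, emb, next, Sum.inr l => q.code (fun l => emb (Sum.inr l)) next l
  | loop c p, emb, next, none =>
    TM2.Stmt.branch c (p.entry (fun l => emb (some l)) (TM2.Stmt.goto fun _ => emb none)) next
  | loop _ p, emb, _, some l =>
    p.code (fun l => emb (some l)) (TM2.Stmt.goto fun _ => emb none) l

end Prog

open Prog

variable {K Γ : Type} [DecidableEq K]

/-- The configuration `b` is reached from `a` in exactly `n` steps. -/
def StepsTo {Λ : Type} (M : Λ → MStmt K Γ Λ) (n : ℕ)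
    (a b : TM2.Cfg (fun _ : K => Γ) Λ (Option Γ)) : Prop :=
  (flip bind (TM2.step M))^[n] (some a) = some b

theorem StepsTo.trans {Λ : Type} {M : Λ → MStmt K Γ Λ} {m n : ℕ}
    {a b c : TM2.Cfg (fun _ : K => Γ) Λ (Option Γ)} (h₁ : StepsTo M m a b)
    (h₂ : StepsTo M n b c) : StepsTo M (m + n) a c := by
  rw [StepsTo, add_comm, Function.iterate_add_apply, h₁, h₂]

theorem StepsTo.refl {Λ : Type} (M : Λ → MStmt K Γ Λ)
    (a : TM2.Cfg (fun _ : K => Γ) Λ (Option Γ)) : StepsTo M 0 a a := rfl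

theorem StepsTo.label {Λ : Type} (M : Λ → MStmt K Γ Λ) (l : Λ) (r : Option Γ) (S : K → List Γ) :
    StepsTo M 1 ⟨some l, r, S⟩ (TM2.stepAux (M l) r S) := rfl

/-- Started with register `r` and stacks `S`, the program `p` ends with `r'` and `S'`, at a cost of
at most `t`. The cost bounds the number of machine steps and the growth of the stacks. -/
def Runs (p : Prog K Γ) (r : Option Γ) (S : K → List Γ) (r' : Option Γ) (S' : K → List Γ)
    (t : ℕ) : Prop :=
  (∀ k, (S' k).length ≤ (S k).length + t) ∧
  ∀ (Λ : Type) (M : Λ → MStmt K Γ Λ) (emb : p.Lab → Λ) (next : MStmt K Γ Λ),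
    (∀ l, M (emb l) = p.code emb next l) →
    ∃ n ≤ t, StepsTo M n (TM2.stepAux (p.entry emb next) r S) (TM2.stepAux next r' S')

theorem Runs.mono {p : Prog K Γ} {r r' : Option Γ} {S S' : K → List Γ} {t t' : ℕ}
    (h : Runs p r S r' S' t) (ht : t ≤ t') : Runs p r S r' S' t' := by
  refine ⟨fun k => (h.1 k).trans (by omega), fun Λ M emb next hM => ?_⟩
  obtain ⟨n, hn, hs⟩ := h.2 Λ M emb next hM
  exact ⟨n, hn.trans ht, hs⟩

theorem Runs.skip (r : Option Γ) (S : K → List Γ) : Runs Prog.skip r S r S 0 :=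
  ⟨fun _ => le_rfl, fun _ M _ _ _ => ⟨0, le_rfl, StepsTo.refl M _⟩⟩

/-- Straight-line statements are absorbed into the surrounding machine step, so no step is counted;
the cost 1 pays for the growth of the stack. Only loops, which compile to jumps, take steps. -/
theorem Runs.push (k : K) (f : Option Γ → Γ) (r : Option Γ) (S : K → List Γ) :
    Runs (Prog.push k f) r S r (Function.update S k (f r :: S k)) 1 := by
  refine ⟨fun j => ?_, fun _ M _ _ _ => ⟨0, Nat.zero_le _, StepsTo.refl M _⟩⟩
  by_cases h : j = k
  · subst h; simp
  · simp [h]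

theorem Runs.pop (k : K) (r : Option Γ) (S : K → List Γ) :
    Runs (Prog.pop k) r S (S k).head? (Function.update S k (S k).tail) 1 := by
  refine ⟨fun j => ?_, fun _ M _ _ _ => ⟨0, Nat.zero_le _, StepsTo.refl M _⟩⟩
  by_cases h : j = k
  · subst h; simp; omega
  · simp [h]

theorem Runs.seq {p q : Prog K Γ} {r r' r'' : Option Γ} {S S' S'' : K → List Γ} {t t' : ℕ}
    (hp : Runs p r S r' S' t) (hq : Runs q r' S' r'' S'' t') :
    Runs (Prog.seq p q) r S r'' S'' (t + t') := by
  refine ⟨fun k => ?_, fun Λ M emb next hM => ?_⟩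
  · have h1 := hp.1 k
    have h2 := hq.1 k
    omega
  · obtain ⟨n, hn, hs⟩ := hp.2 Λ M (fun l => emb (Sum.inl l))
      (q.entry (fun l => emb (Sum.inr l)) next) fun l => hM (Sum.inl l)
    obtain ⟨n', hn', hs'⟩ := hq.2 Λ M (fun l => emb (Sum.inr l)) next fun l => hM (Sum.inr l)
    exact ⟨n + n', by omega, hs.trans hs'⟩

theorem Runs.loop_stop {c : Option Γ → Bool} (p : Prog K Γ) {r : Option Γ} (S : K → List Γ)
    (hc : c r = false) : Runs (Prog.loop c p) r S r S 1 := by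
  refine ⟨fun k => by omega, fun Λ M emb next hM => ⟨1, le_rfl, ?_⟩⟩
  have := StepsTo.label M (emb none) r S
  rw [hM none] at this
  simpa [Prog.code, Prog.entry, hc] using this

theorem Runs.loop_step {c : Option Γ → Bool} {p : Prog K Γ} {r r' r'' : Option Γ}
    {S S' S'' : K → List Γ} {t t' : ℕ} (hc : c r = true) (hp : Runs p r S r' S' t)
    (hq : Runs (Prog.loop c p) r' S' r'' S'' t') :
    Runs (Prog.loop c p) r S r'' S'' (1 + t + t') := by
  refine ⟨fun k => ?_, fun Λ M emb next hM => ?_⟩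
  · have h1 := hp.1 k
    have h2 := hq.1 k
    omega
  · obtain ⟨n, hn, hs⟩ := hp.2 Λ M (fun l => emb (some l)) (TM2.Stmt.goto fun _ => emb none)
      fun l => hM (some l)
    obtain ⟨n', hn', hs'⟩ := hq.2 Λ M emb next hM
    refine ⟨1 + n + n', by omega, StepsTo.trans (StepsTo.trans ?_ hs) hs'⟩
    have := StepsTo.label M (emb none) r S
    rw [hM none] at this
    simpa [Prog.code, Prog.entry, hc] using this

/-! ### Emitting words -/

/-- Push a list of letters, which may depend on the register, on various stacks. -/
def emit : List (K × (Option Γ → Γ)) → Prog K Γ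
  | [] => Prog.skip
  | x :: l => Prog.seq (Prog.push x.1 x.2) (emit l)

/-- The word that `emit l` writes on the stack `k`. -/
def word (l : List (K × (Option Γ → Γ))) (r : Option Γ) (k : K) : List Γ :=
  (l.filter fun x => decide (x.1 = k)).map fun x => x.2 r

theorem Runs.emit (l : List (K × (Option Γ → Γ))) (r : Option Γ) (S : K → List Γ) :
    Runs (emit l) r S r (fun k => (word l r k).reverse ++ S k) l.length := by
  induction l generalizing S with
  | nil => exact Runs.skip r S
  | cons x l ih =>
    have := (Runs.push x.1 x.2 r S).seq (ih _)
    rw [add_comm] at this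
    rw [StackProgram.emit]
    convert this using 1
    · funext k
      by_cases h : x.1 = k
      · subst h; simp [word]
      · simp [word, h, Function.update_of_ne (Ne.symm h)]
    · rfl

/-- Consume the letters on the stack `k` up to and including the first one that satisfies `last`, and emit
letters for each of them except that one. -/
def consume (k : K) (last : Option Γ → Bool) (l : List (K × (Option Γ → Γ))) : Prog K Γ :=
  Prog.seq (Prog.pop k) (Prog.loop (fun r => !last r) (Prog.seq (emit l) (Prog.pop k)))

/-- The condition on `rest.head?` covers both a terminating letter and an exhausted stack, for which
the register is `none`. The hypothesis `hk` keeps the emitted letters away from the stack that is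
being read. -/
theorem Runs.consume (k : K) (last : Option Γ → Bool) (l : List (K × (Option Γ → Γ)))
    (hk : ∀ r, word l r k = []) (seg rest : List Γ) (hseg : ∀ s ∈ seg, last (some s) = false)
    (hrest : last rest.head? = true) (r : Option Γ) (S : K → List Γ) (hS : S k = seg ++ rest) :
    Runs (consume k last l) r S rest.head?
      (fun j => if j = k then rest.tail else (seg.flatMap fun s => word l (some s) j).reverse ++ S j)
      ((seg.length + 1) * (l.length + 2)) := by
  induction seg generalizing r S with
  | nil =>
    have h := (Runs.pop k r S).seq (Runs.loop_stop (c := fun r => !last r)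
      (Prog.seq (StackProgram.emit l) (Prog.pop k)) _ (by simpa [hS] using hrest))
    simp only [hS, List.nil_append] at h
    refine Runs.mono (t := 1 + 1) ?_ (by simp)
    rw [StackProgram.consume]
    convert h using 1
    funext j
    by_cases hj : j = k
    · subst hj; simp
    · simp [hj]
  | cons s seg ih =>
    have hs : last (some s) = false := hseg s (by simp)
    set S₁ := Function.update S k (S k).tail with hS₁
    set S₂ := fun j => (word l (some s) j).reverse ++ S₁ j with hS₂
    have h2 : S₂ k = seg ++ rest := by simp [hS₂, hS₁, hk, hS]
    have h := ih (fun s' hs' => hseg s' (by simp [hs'])) (some s) S₂ h2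
    refine ⟨fun j => ?_, fun Λ M emb next hM => ?_⟩
    · have := h.1 j
      have hw : (word l (some s) j).length ≤ l.length := by
        simp only [word, List.length_map]
        exact List.length_filter_le _ _
      have hS1 : (S₁ j).length ≤ (S j).length := by
        by_cases hj : j = k
        · subst hj; simp [hS₁]
        · simp [hS₁, hj]
      have hS2 : (S₂ j).length ≤ l.length + (S j).length := by
        simp only [hS₂, List.length_append, List.length_reverse]; omega
      by_cases hj : j = k
      · subst hj
        simp only [if_true, hS, List.length_append, List.length_tail]
        omega
      · simp only [hj, if_false, List.length_append, List.length_reverse, List.flatMap_cons,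
          List.length_cons, add_mul, one_mul] at this ⊢
        have : (S₁ j).length = (S j).length := by simp [hS₁, hj]
        simp only [hS₂, List.length_append, List.length_reverse] at *
        omega
    -- The loop body ends with a pop and a jump to the loop, which is literally the entry statement
    -- of `consume`. So after one pass the induction hypothesis for the whole program applies, not
    -- merely one for the loop.
    · obtain ⟨n, hn, hst⟩ := h.2 Λ M emb next hM
      obtain ⟨n', hn', hst'⟩ := (Runs.emit l (some s) S₁).2 Λ M
        (fun x => emb (Sum.inr (some (Sum.inl x))))
        (TM2.Stmt.pop k (fun _ x => x) (TM2.Stmt.goto fun _ => emb (Sum.inr none)))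
        (fun x => hM (Sum.inr (some (Sum.inl x))))
      refine ⟨1 + n' + n, ?_, StepsTo.trans (StepsTo.trans ?_ hst') ?_⟩
      · simp only [List.length_cons]
        have : (seg.length + 1 + 1) * (l.length + 2) =
          (seg.length + 1) * (l.length + 2) + (l.length + 2) := by ring
        omega
      · have := StepsTo.label M (emb (Sum.inr none)) (some s) S₁
        rw [hM (Sum.inr none)] at this
        simpa [StackProgram.consume, Prog.code, Prog.entry, hs, hS, hS₁] using this
      · convert hst using 2
        · rfl
        · funext j
          by_cases hj : j = k
          · simp [hj]
          · simp [hj, hS₂, hS₁]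

end StackProgram

/-! ### The construction: names, locations and edges. -/

open Turing

namespace LockPrograms

open Computability (Γ')

/-! ### Names of the constructed graphs -/

/-- A code of letters by three bits. -/
def bits : Γ' → List Bool
  | Γ'.blank => [false, false, false]
  | Γ'.bra => [false, false, true]
  | Γ'.ket => [false, true, false]
  | Γ'.comma => [false, true, true]
  | Γ'.bit b => [true, b, b]

/-- All letters have codes of the same length three, and the codes are distinct. -/
theorem flatMap_bits_injective : Function.Injective fun w : List Γ' => w.flatMap bits := by
  intro u
  induction u with
  | nil =>
    rintro (_ | ⟨b, v⟩) h
    · rfl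
    · cases b <;> simp [bits] at h
  | cons a u ih =>
    rintro (_ | ⟨b, v⟩) h
    · cases a <;> simp [bits] at h
    · have key : a = b ∧ u.flatMap bits = v.flatMap bits := by
        cases a <;> cases b <;> simp_all [bits]
      rw [key.1, ih key.2]

/-- An edge of a thread template. -/
abbrev LockEdge : Type := Name × (Name ⊕ LockOp Name) × Name

/-- The name of a location of the given graph. -/
def origName (ℓ : Name) : Name := true :: ℓ

/-- The name of the location and of the action that split an edge. -/
def edgeName (e : LockEdge) : Name := false :: true :: (encEdge encLabel e).flatMap bits

theorem edgeName_injective : Function.Injective edgeName := by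
  intro e e' h
  simp only [edgeName, List.cons.injEq, true_and] at h
  exact (selfDelim_encEdge selfDelim_encLabel e e' [] []
    (by simpa using flatMap_bits_injective h)).1

theorem edgeName_inj {e e' : LockEdge} : edgeName e = edgeName e' ↔ e = e' :=
  edgeName_injective.eq_iff

/-- The new initial location. -/
def startLoc : Name := [false]

/-- The action by which a thread starts to simulate the given graph. -/
def startName : Name := []

/-- The action by which a thread leaves the simulation at the exit location. -/
def stopName : Name := [false]

/-- The action by which a thread starts the `k`-th gadget. -/
def callName (k : ℕ) : Name := false :: false :: List.replicate k true

/-- The location of the `k`-th gadget where `r` operations remain; the new exit location is the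
common end of all gadgets. -/
def node (k : ℕ) : ℕ → Name
  | 0 => []
  | r + 1 => false :: false :: (List.replicate r true ++ false :: List.replicate k true)

/-- The lock that only one thread can ever hold, which guards the `k`-th gadget. -/
def onceLock (k : ℕ) : Name := false :: true :: List.replicate k true

/-- The `k`-th one of the locks arranged in a ring. -/
def ringLock (k : ℕ) : Name := false :: false :: List.replicate k true

/-- Renaming of the given locks. -/
def LockOp.tag : LockOp Name → LockOp Name
  | LockOp.acq m => LockOp.acq (true :: m)
  | LockOp.rel m => LockOp.rel (true :: m)

theorem replicate_append_inj {r r' : ℕ} {u v : List Bool}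
    (h : List.replicate r true ++ false :: u = List.replicate r' true ++ false :: v) :
    r = r' ∧ u = v := by
  induction r generalizing r' with
  | zero => cases r' <;> simp_all [List.replicate_succ]
  | succ r ih =>
    cases r' with
    | zero => simp [List.replicate_succ] at h
    | succ r' =>
      simp only [List.replicate_succ, List.cons_append, List.cons.injEq, true_and] at h
      simpa using ih h

theorem node_inj {k k' r r' : ℕ} (h : node k (r + 1) = node k' (r' + 1)) : k = k' ∧ r = r' := by
  simp only [node, List.cons.injEq, true_and] at h
  obtain ⟨h1, h2⟩ := replicate_append_inj h
  exact ⟨by simpa using congrArg List.length h2, h1⟩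

@[simp]
theorem callName_inj {k k' : ℕ} : callName k = callName k' ↔ k = k' := by
  simp [callName, List.replicate_inj]

@[simp]
theorem onceLock_inj {k k' : ℕ} : onceLock k = onceLock k' ↔ k = k' := by
  simp [onceLock, List.replicate_inj]

@[simp]
theorem ringLock_inj {k k' : ℕ} : ringLock k = ringLock k' ↔ k = k' := by
  simp [ringLock, List.replicate_inj]

/-! ### The constructed graphs -/

section Graph

variable {S : Type}

/-- The label of an edge of the given graph in the constructed graph. -/
def liftLabel (ι : LockOp Name → S) : Name ⊕ LockOp Name → Name ⊕ S
  | Sum.inl a => Sum.inl (true :: a)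
  | Sum.inr o => Sum.inr (ι o.tag)

/-- Splitting an edge by an action that determines it. -/
def splitEdge (ι : LockOp Name → S) (e : LockEdge) : List (Name × (Name ⊕ S) × Name) :=
  [(origName e.1, Sum.inl (edgeName e), edgeName e),
    (edgeName e, liftLabel ι e.2.1, origName e.2.2)]

/-- The edges of the `k`-th gadget after the first one. -/
def tailEdges (k : ℕ) : List S → List (Name × (Name ⊕ S) × Name)
  | [] => []
  | s :: t => (node k (t.length + 1), Sum.inr s, node k t.length) :: tailEdges k t

/-- The inner locations of the `k`-th gadget. -/
def tailLocs (k : ℕ) : List S → List Name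
  | [] => []
  | _ :: t => node k (t.length + 1) :: tailLocs k t

/-- The edges of the `k`-th gadget. -/
def gadgetEdges (src : Name) (k : ℕ) (t : List S) : List (Name × (Name ⊕ S) × Name) :=
  (src, Sum.inl (callName k), node k t.length) :: tailEdges k t

/-- The edges of all gadgets from the `k`-th on. -/
def callEdges (W : ℕ → ℕ → List S) : ℕ → List Name → List (Name × (Name ⊕ S) × Name)
  | k, [] => gadgetEdges startLoc k (W k (k + 1)) ++ gadgetEdges startLoc (k + 1) (W (k + 1) 0)
  | k, ℓ :: C => gadgetEdges (origName ℓ) k (W k (k + 1)) ++ callEdges W (k + 1) C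

/-- The inner locations of all gadgets from the `k`-th on. -/
def callLocs (W : ℕ → ℕ → List S) : ℕ → List Name → List Name
  | k, [] => tailLocs k (W k (k + 1)) ++ tailLocs (k + 1) (W (k + 1) 0)
  | k, _ :: C => tailLocs k (W k (k + 1)) ++ callLocs W (k + 1) C

/-- The locations of the constructed graph. -/
def hatLocs (x : CoverInstance) (W : ℕ → ℕ → List S) : List Name :=
  startLoc :: [] ::
    (x.G.locs.map origName ++ (x.G.edges.map edgeName ++ callLocs W 0 x.C))

/-- The edges of the constructed graph. -/
def hatEdges (x : CoverInstance) (ι : LockOp Name → S) (W : ℕ → ℕ → List S) :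
    List (Name × (Name ⊕ S) × Name) :=
  (startLoc, Sum.inl startName, origName x.G.init) ::
    (origName x.G.exit, Sum.inl stopName, []) ::
      (x.G.edges.flatMap (splitEdge ι) ++ callEdges W 0 x.C)

/-- The locations at which the gadgets start. -/
def sources (C : List Name) : List Name := C.map origName ++ [startLoc, startLoc]

/-- The successor in the ring of gadgets. -/
def ringNext (C : List Name) (k : ℕ) : ℕ := if k = C.length + 1 then 0 else k + 1

theorem mem_tailEdges {k : ℕ} {t : List S} {e : Name × (Name ⊕ S) × Name} :
    e ∈ tailEdges k t ↔ ∃ t₁ s t₂, t = t₁ ++ s :: t₂ ∧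
      e = (node k (t₂.length + 1), Sum.inr s, node k t₂.length) := by
  induction t with
  | nil => simp [tailEdges]
  | cons s t ih =>
    rw [tailEdges, List.mem_cons, ih]
    constructor
    · rintro (rfl | ⟨t₁, s', t₂, rfl, rfl⟩)
      · exact ⟨[], s, t, rfl, rfl⟩
      · exact ⟨s :: t₁, s', t₂, rfl, rfl⟩
    · rintro ⟨t₁, s', t₂, h, rfl⟩
      rcases List.cons_eq_append_iff.1 h with ⟨rfl, h⟩ | ⟨t', rfl, rfl⟩
      · cases h
        exact Or.inl rfl
      · exact Or.inr ⟨t', s', t₂, rfl, rfl⟩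

theorem mem_tailLocs {k : ℕ} {t : List S} {v : Name} :
    v ∈ tailLocs k t ↔ ∃ r < t.length, v = node k (r + 1) := by
  induction t with
  | nil => simp [tailLocs]
  | cons s t ih =>
    rw [tailLocs, List.mem_cons, ih]
    constructor
    · rintro (rfl | ⟨r, hr, rfl⟩)
      · exact ⟨t.length, by simp, rfl⟩
      · exact ⟨r, by simp; omega, rfl⟩
    · rintro ⟨r, hr, rfl⟩
      rcases Nat.lt_succ_iff_lt_or_eq.1 hr with h | rfl
      · exact Or.inr ⟨r, h, rfl⟩
      · exact Or.inl rfl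

/-- The operations of the `k`-th gadget. -/
def gadgetTail (C : List Name) (W : ℕ → ℕ → List S) (k : ℕ) : List S := W k (ringNext C k)

/-- One induction serves both `callEdges` and `callLocs`. As the recursion starts at an arbitrary
`k`, the gadget at position `j` has number `k + j`, and position `C.length + 1` is the one whose
neighbour wraps around to 0. -/
theorem mem_calls {Y : Type} (F : Name → ℕ → List S → List Y) (W : ℕ → ℕ → List S)
    (f : ℕ → List Name → List Y)
    (hnil : ∀ k, f k [] = F startLoc k (W k (k + 1)) ++ F startLoc (k + 1) (W (k + 1) 0))
    (hcons : ∀ k ℓ C, f k (ℓ :: C) = F (origName ℓ) k (W k (k + 1)) ++ f (k + 1) C)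
    (C : List Name) (k : ℕ) (y : Y) :
    y ∈ f k C ↔ ∃ j src, (sources C)[j]? = some src ∧
      y ∈ F src (k + j) (W (k + j) (if j = C.length + 1 then 0 else k + j + 1)) := by
  induction C generalizing k with
  | nil =>
    rw [hnil, List.mem_append]
    constructor
    · rintro (h | h)
      · exact ⟨0, startLoc, rfl, by simpa using h⟩
      · exact ⟨1, startLoc, rfl, by simpa using h⟩
    · rintro ⟨j, src, h, h'⟩
      match j, h, h' with
      | 0, h, h' =>
        simp only [sources, List.map_nil, List.nil_append, List.getElem?_cons_zero,
          Option.some.injEq] at h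
        subst h
        exact Or.inl (by simpa using h')
      | 1, h, h' =>
        simp only [sources, List.map_nil, List.nil_append, List.getElem?_cons_succ,
          List.getElem?_cons_zero, Option.some.injEq] at h
        subst h
        exact Or.inr (by simpa using h')
      | j + 2, h, _ => simp [sources] at h
  | cons ℓ C ih =>
    rw [hcons, List.mem_append, ih]
    constructor
    · rintro (h | ⟨j, src, hj, h⟩)
      · exact ⟨0, origName ℓ, rfl, by simpa using h⟩
      · refine ⟨j + 1, src, by simpa [sources] using hj, ?_⟩
        have : k + (j + 1) = k + 1 + j := by omega
        simpa [this] using h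
    · rintro ⟨j, src, hj, h⟩
      cases j with
      | zero =>
        simp only [sources, List.map_cons, List.cons_append, List.getElem?_cons_zero,
          Option.some.injEq] at hj
        subst hj
        exact Or.inl (by simpa using h)
      | succ j =>
        refine Or.inr ⟨j, src, by simpa [sources] using hj, ?_⟩
        have : k + (j + 1) = k + 1 + j := by omega
        simpa [this] using h

theorem mem_callEdges {W : ℕ → ℕ → List S} {C : List Name} {e : Name × (Name ⊕ S) × Name} :
    e ∈ callEdges W 0 C ↔ ∃ k src, (sources C)[k]? = some src ∧
      e ∈ gadgetEdges src k (gadgetTail C W k) := by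
  rw [mem_calls gadgetEdges W (callEdges W) (fun _ => rfl) (fun _ _ _ => rfl)]
  simp [gadgetTail, ringNext]

theorem mem_callLocs {W : ℕ → ℕ → List S} {C : List Name} {v : Name} :
    v ∈ callLocs W 0 C ↔ ∃ k src, (sources C)[k]? = some src ∧
      v ∈ tailLocs k (gadgetTail C W k) := by
  rw [mem_calls (fun _ => tailLocs) W (callLocs W) (fun _ => rfl) (fun _ _ _ => rfl)]
  simp [gadgetTail, ringNext]

/-- The edges of the constructed graph. -/
inductive HatEdge (x : CoverInstance) (ι : LockOp Name → S) (W : ℕ → ℕ → List S) :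
    Name × (Name ⊕ S) × Name → Prop
  | start : HatEdge x ι W (startLoc, Sum.inl startName, origName x.G.init)
  | halt : HatEdge x ι W (origName x.G.exit, Sum.inl stopName, [])
  | enter (e : LockEdge) : e ∈ x.G.edges →
      HatEdge x ι W (origName e.1, Sum.inl (edgeName e), edgeName e)
  | leave (e : LockEdge) : e ∈ x.G.edges →
      HatEdge x ι W (edgeName e, liftLabel ι e.2.1, origName e.2.2)
  | call (k : ℕ) (src : Name) : (sources x.C)[k]? = some src →
      HatEdge x ι W (src, Sum.inl (callName k), node k (gadgetTail x.C W k).length)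
  | tail (k : ℕ) (t₁ : List S) (s : S) (t₂ : List S) : k < x.C.length + 2 →
      gadgetTail x.C W k = t₁ ++ s :: t₂ →
      HatEdge x ι W (node k (t₂.length + 1), Sum.inr s, node k t₂.length)

theorem sources_lt {C : List Name} {k : ℕ} {src : Name} (h : (sources C)[k]? = some src) :
    k < C.length + 2 := by
  have := (List.getElem?_eq_some_iff.1 h).1
  simpa [sources] using this

theorem exists_source {C : List Name} {k : ℕ} (h : k < C.length + 2) :
    ∃ src, (sources C)[k]? = some src :=
  ⟨_, List.getElem?_eq_getElem (by simpa [sources] using h)⟩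

theorem source_cases {C : List Name} {k : ℕ} {src : Name} (h : (sources C)[k]? = some src) :
    (src = startLoc ∧ C.length ≤ k) ∨ ∃ ℓ, C[k]? = some ℓ ∧ src = origName ℓ := by
  by_cases hk : k < C.length
  · right
    rw [sources, List.getElem?_append_left (by simpa using hk)] at h
    simpa [eq_comm] using h
  · left
    rw [sources, List.getElem?_append_right (by simpa using hk)] at h
    have h2 := (List.getElem?_eq_some_iff.1 h)
    obtain ⟨h3, h4⟩ := h2
    refine ⟨?_, by omega⟩
    have : src ∈ [startLoc, startLoc] := h4 ▸ List.getElem_mem _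
    simpa using this

theorem mem_hatEdges {x : CoverInstance} {ι : LockOp Name → S} {W : ℕ → ℕ → List S}
    {e : Name × (Name ⊕ S) × Name} : e ∈ hatEdges x ι W ↔ HatEdge x ι W e := by
  simp only [hatEdges, List.mem_cons, List.mem_append, List.mem_flatMap, mem_callEdges,
    gadgetEdges, splitEdge, mem_tailEdges, List.not_mem_nil, or_false]
  constructor
  · rintro (rfl | rfl | ⟨e, he, rfl | rfl⟩ | ⟨k, src, hk, rfl | ⟨t₁, s, t₂, ht, rfl⟩⟩)
    · exact .start
    · exact .halt
    · exact .enter e he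
    · exact .leave e he
    · exact .call k src hk
    · exact .tail k t₁ s t₂ (sources_lt hk) ht
  · rintro (_ | _ | ⟨e, he⟩ | ⟨e, he⟩ | ⟨k, src, hk⟩ | ⟨k, t₁, s, t₂, hk, ht⟩)
    · exact Or.inl rfl
    · exact Or.inr (Or.inl rfl)
    · exact Or.inr (Or.inr (Or.inl ⟨e, he, Or.inl rfl⟩))
    · exact Or.inr (Or.inr (Or.inl ⟨e, he, Or.inr rfl⟩))
    · exact Or.inr (Or.inr (Or.inr ⟨k, src, hk, Or.inl rfl⟩))
    · obtain ⟨src, hsrc⟩ := exists_source hk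
      exact Or.inr (Or.inr (Or.inr ⟨k, src, hsrc, Or.inr ⟨t₁, s, t₂, ht, rfl⟩⟩))

theorem mem_hatLocs {x : CoverInstance} {W : ℕ → ℕ → List S} {v : Name} :
    v ∈ hatLocs x W ↔ v = startLoc ∨ (∃ ℓ ∈ x.G.locs, v = origName ℓ) ∨
      (∃ e ∈ x.G.edges, v = edgeName e) ∨
      v = [] ∨ ∃ k < x.C.length + 2, ∃ r ≤ (gadgetTail x.C W k).length, v = node k r := by
  simp only [hatLocs, List.mem_cons, List.mem_append, List.mem_map, mem_callLocs, mem_tailLocs]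
  constructor
  · rintro (rfl | rfl | ⟨ℓ, hℓ, rfl⟩ | ⟨e, he, rfl⟩ | ⟨k, src, hk, r, hr, rfl⟩)
    · exact Or.inl rfl
    · simp
    · exact Or.inr (Or.inl ⟨ℓ, hℓ, rfl⟩)
    · exact Or.inr (Or.inr (Or.inl ⟨e, he, rfl⟩))
    · exact Or.inr (Or.inr (Or.inr (Or.inr ⟨k, sources_lt hk, r + 1, hr, rfl⟩)))
  · rintro (rfl | ⟨ℓ, hℓ, rfl⟩ | ⟨e, he, rfl⟩ | rfl | ⟨k, hk, r, hr, rfl⟩)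
    · exact Or.inl rfl
    · exact Or.inr (Or.inr (Or.inl ⟨ℓ, hℓ, rfl⟩))
    · exact Or.inr (Or.inr (Or.inr (Or.inl ⟨e, he, rfl⟩)))
    · exact Or.inr (Or.inl rfl)
    · cases r with
      | zero => exact Or.inr (Or.inl rfl)
      | succ r =>
        obtain ⟨src, hsrc⟩ := exists_source hk
        exact Or.inr (Or.inr (Or.inr (Or.inr ⟨k, src, hsrc, r, hr, rfl⟩)))

end Graph

end LockPrograms

/-! ### Traces of the constructed graphs, and the constructed instance. -/

open Turing

namespace LockPrograms

open Computability (Γ')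

/-! ### Paths -/

section Paths

variable {L Λ : Type} {locs : List L} {edges : List (L × Λ × L)}

theorem PathIn.append {u v z : L} {w w' : List Λ} (h : PathIn locs edges u w v)
    (h' : PathIn locs edges v w' z) : PathIn locs edges u (w ++ w') z := by
  induction h with
  | nil _ _ => exact h'
  | cons u a v w z he _ ih => exact .cons u a v _ _ he (ih h')

theorem PathIn.single {u v : L} {a : Λ} (h : (u, a, v) ∈ edges) (hv : v ∈ locs) :
    PathIn locs edges u [a] v :=
  .cons u a v [] v h (.nil v hv)

/-- A path, given by its edges. -/
inductive EdgePath (locs : List L) (edges : List (L × Λ × L)) : L → List (L × Λ × L) → L → Prop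
  | nil (ℓ : L) : ℓ ∈ locs → EdgePath locs edges ℓ [] ℓ
  | cons (e : L × Λ × L) (es : List (L × Λ × L)) (ℓ : L) : e ∈ edges →
      EdgePath locs edges e.2.2 es ℓ → EdgePath locs edges e.1 (e :: es) ℓ

theorem pathIn_iff_exists_edgePath {u v : L} {w : List Λ} :
    PathIn locs edges u w v ↔
      ∃ es, EdgePath locs edges u es v ∧ es.map (fun e => e.2.1) = w := by
  constructor
  · intro h
    induction h with
    | nil ℓ h => exact ⟨[], .nil ℓ h, rfl⟩
    | cons u a v w z he _ ih =>
      obtain ⟨es, h1, h2⟩ := ih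
      exact ⟨(u, a, v) :: es, .cons (u, a, v) es z he h1, by simp [h2]⟩
  · rintro ⟨es, h, rfl⟩
    induction h with
    | nil ℓ h => exact .nil ℓ h
    | cons e es ℓ he _ ih => exact .cons e.1 e.2.1 e.2.2 _ ℓ he ih

end Paths

/-- Words of a graph are determined by their ordinary actions, if at each location there is only one
outgoing edge or all outgoing edges are labeled by ordinary actions. -/
theorem eq_of_filterMap_keepAct_eq {L A S : Type} (G : CFG L A S)
    (hdet : ∀ e ∈ G.edges, ∀ e' ∈ G.edges, e.1 = e'.1 →
      e = e' ∨ ∃ a a', e.2.1 = Sum.inl a ∧ e'.2.1 = Sum.inl a')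
    (hexit : ∀ e ∈ G.edges, e.1 ≠ G.exit) {u : L} {w w' : List (A ⊕ S)} (h : G.Path u w G.exit)
    (h' : G.Path u w' G.exit) (hw : w.filterMap keepAct = w'.filterMap keepAct) : w = w' := by
  obtain ⟨x, hx⟩ : ∃ x, x = G.exit := ⟨_, rfl⟩
  rw [CFG.Path, ← hx] at h h'
  induction h generalizing w' with
  | nil ℓ _ =>
    cases h' with
    | nil => rfl
    | cons _ a v w _ he => exact absurd hx (hexit _ he)
  | cons u a v w z he hp ih =>
    cases h' with
    | nil => exact absurd hx (hexit _ he)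
    | cons _ a' v' w' _ he' hp' =>
      have key : (u, a, v) = (u, a', v') := by
        rcases hdet _ he _ he' rfl with h | ⟨b, b', hb, hb'⟩
        · exact h
        · simp only at hb hb'
          subst hb hb'
          simp only [List.filterMap_cons, keepAct, List.cons.injEq] at hw
          obtain ⟨rfl, _⟩ := hw
          exact G.unique_edge _ he _ he' b rfl rfl
      simp only [Prod.mk.injEq, true_and] at key
      obtain ⟨rfl, rfl⟩ := key
      rw [ih (by
        rcases a with a | s
        · exact (List.cons.inj hw).2
        · exact hw) hp' hx]

/-! ### The constructed graphs -/

section Graph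

variable {S : Type}

theorem liftLabel_eq_inl {ι : LockOp Name → S} {l : Name ⊕ LockOp Name} {a : Name} :
    liftLabel ι l = Sum.inl a ↔ ∃ b, l = Sum.inl b ∧ a = true :: b := by
  rcases l with b | o <;> simp [liftLabel, eq_comm]

/-- The word that simulates a path of the given graph. -/
def simWord (ι : LockOp Name → S) (es : List LockEdge) : List (Name ⊕ S) :=
  es.flatMap fun e => [Sum.inl (edgeName e), liftLabel ι e.2.1]

/-- The first part of a run of the constructed graph. -/
def preWord (ι : LockOp Name → S) : Option (List LockEdge) → List (Name ⊕ S)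
  | none => []
  | some es => Sum.inl startName :: simWord ι es

/-- The second part of a run of the constructed graph. -/
def sufWord (C : List Name) (W : ℕ → ℕ → List S) : Option ℕ → List (Name ⊕ S)
  | none => [Sum.inl stopName]
  | some k => Sum.inl (callName k) :: (gadgetTail C W k).map Sum.inr

/-- The possible runs of the constructed graph: a path of the given graph is simulated up to the
exit location or up to the source of a gadget; the last two gadgets start at once. -/
inductive HatRun (x : CoverInstance) : Option (List LockEdge) → Option ℕ → Prop
  | halt (es : List LockEdge) : EdgePath x.G.locs x.G.edges x.G.init es x.G.exit →
      HatRun x (some es) none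
  | direct (k : ℕ) : x.C.length ≤ k → k < x.C.length + 2 → HatRun x none (some k)
  | call (es : List LockEdge) (k : ℕ) (ℓ : Name) : x.C[k]? = some ℓ →
      EdgePath x.G.locs x.G.edges x.G.init es ℓ → HatRun x (some es) (some k)

variable {x : CoverInstance} {ι : LockOp Name → S} {W : ℕ → ℕ → List S}

theorem hatPath_sim {u v : Name} {es : List LockEdge}
    (h : EdgePath x.G.locs x.G.edges u es v) :
    PathIn (hatLocs x W) (hatEdges x ι W) (origName u) (simWord ι es) (origName v) := by
  induction h with
  | nil ℓ h => exact .nil _ (mem_hatLocs.2 (Or.inr (Or.inl ⟨ℓ, h, rfl⟩)))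
  | cons e es ℓ he _ ih =>
    exact .cons _ _ (edgeName e) _ _ (mem_hatEdges.2 (.enter e he))
      (.cons _ _ _ _ _ (mem_hatEdges.2 (.leave e he)) ih)

/-- Stated for an arbitrary middle segment `t₂`, so that it yields the full passage through a gadget
as well as the initial segments needed for reachability and the final ones needed for
coreachability. -/
theorem hatPath_tail {k : ℕ} (hk : k < x.C.length + 2) (t₁ t₂ t₃ : List S)
    (ht : gadgetTail x.C W k = t₁ ++ t₂ ++ t₃) :
    PathIn (hatLocs x W) (hatEdges x ι W) (node k (t₂ ++ t₃).length) (t₂.map Sum.inr)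
      (node k t₃.length) := by
  induction t₂ generalizing t₁ with
  | nil =>
    refine .nil _ (mem_hatLocs.2 (Or.inr (Or.inr (Or.inr (Or.inr ⟨k, hk, _, ?_, rfl⟩)))))
    simp [ht]
  | cons s t₂ ih =>
    refine .cons _ _ (node k (t₂ ++ t₃).length) _ _
      (mem_hatEdges.2 (.tail k t₁ s (t₂ ++ t₃) hk (by simpa using ht))) (ih (t₁ ++ [s]) ?_)
    simpa using ht

theorem hatPath_start {w : List (Name ⊕ S)} {v : Name}
    (h : PathIn (hatLocs x W) (hatEdges x ι W) (origName x.G.init) w v) :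
    PathIn (hatLocs x W) (hatEdges x ι W) startLoc (Sum.inl startName :: w) v :=
  .cons _ _ _ _ _ (mem_hatEdges.2 .start) h

theorem exit_mem_hatLocs : [] ∈ hatLocs x W :=
  mem_hatLocs.2 (Or.inr (Or.inr (Or.inr (Or.inl rfl))))

theorem hatPath_stop :
    PathIn (hatLocs x W) (hatEdges x ι W) (origName x.G.exit) [Sum.inl stopName] [] :=
  .single (mem_hatEdges.2 .halt) exit_mem_hatLocs

theorem hatPath_call {k : ℕ} {src : Name} (h : (sources x.C)[k]? = some src) :
    PathIn (hatLocs x W) (hatEdges x ι W) src (sufWord x.C W (some k)) [] := by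
  refine .cons _ _ _ _ _ (mem_hatEdges.2 (.call k src h)) ?_
  simpa [node] using hatPath_tail (ι := ι) (sources_lt h) [] (gadgetTail x.C W k) [] (by simp)

theorem getElem?_sources_of_getElem? {C : List Name} {k : ℕ} {ℓ : Name} (h : C[k]? = some ℓ) :
    (sources C)[k]? = some (origName ℓ) := by
  have hk := (List.getElem?_eq_some_iff.1 h).1
  rw [sources, List.getElem?_append_left (by simpa using hk)]
  simp [h]

theorem getElem?_sources_of_le {C : List Name} {k : ℕ} (h : C.length ≤ k) (h' : k < C.length + 2) :
    (sources C)[k]? = some startLoc := by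
  obtain ⟨src, hsrc⟩ := exists_source h'
  rcases source_cases hsrc with ⟨rfl, _⟩ | ⟨ℓ, hℓ, _⟩
  · exact hsrc
  · have := (List.getElem?_eq_some_iff.1 hℓ).1
    omega

theorem HatRun.path {pre : Option (List LockEdge)} {suf : Option ℕ} (h : HatRun x pre suf) :
    PathIn (hatLocs x W) (hatEdges x ι W) startLoc (preWord ι pre ++ sufWord x.C W suf) [] := by
  cases h with
  | halt es h => exact hatPath_start ((hatPath_sim h).append hatPath_stop)
  | direct k h h' => exact hatPath_call (getElem?_sources_of_le h h')
  | call es k ℓ hℓ h =>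
    exact hatPath_start ((hatPath_sim h).append
      (hatPath_call (getElem?_sources_of_getElem? hℓ)))

theorem node_ne_cons_true (k r : ℕ) (b : Name) : node k r ≠ true :: b := by
  cases r <;> simp [node]

theorem node_ne_false_true (k r : ℕ) (b : Name) : node k r ≠ false :: true :: b := by
  cases r <;> simp [node]

theorem node_ne_startLoc (k r : ℕ) : node k r ≠ startLoc := by
  cases r <;> simp [node, startLoc]

theorem node_eq_nil {k r : ℕ} : node k r = [] ↔ r = 0 := by
  cases r <;> simp [node]

theorem source_ne_node {C : List Name} {j : ℕ} {src : Name} (h : (sources C)[j]? = some src)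
    (k r : ℕ) : src ≠ node k r := by
  rcases source_cases h with ⟨rfl, _⟩ | ⟨ℓ, _, rfl⟩
  · exact (node_ne_startLoc k r).symm
  · exact (node_ne_cons_true k r ℓ).symm

theorem source_ne_edgeName {C : List Name} {j : ℕ} {src : Name} (h : (sources C)[j]? = some src)
    (e : LockEdge) : src ≠ edgeName e := by
  rcases source_cases h with ⟨rfl, _⟩ | ⟨ℓ, _, rfl⟩
  · simp [startLoc, edgeName]
  · simp [origName, edgeName]

/-- The edges that leave an inner location of a gadget. -/
theorem HatEdge.of_node {e : Name × (Name ⊕ S) × Name} (h : HatEdge x ι W e) {k r : ℕ}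
    (hk : e.1 = node k r) : ∃ t₁ s t₂, k < x.C.length + 2 ∧ gadgetTail x.C W k = t₁ ++ s :: t₂ ∧
      r = t₂.length + 1 ∧ e.2 = (Sum.inr s, node k t₂.length) := by
  cases h with
  | start => exact absurd hk.symm (node_ne_startLoc _ _)
  | halt => exact absurd hk.symm (node_ne_cons_true _ _ _)
  | enter e he => exact absurd hk.symm (node_ne_cons_true _ _ _)
  | leave e he => exact absurd hk.symm (node_ne_false_true _ _ _)
  | call j src h => exact absurd hk (source_ne_node h _ _)
  | tail j t₁ s t₂ hj ht =>
    cases r with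
    | zero => simp [node] at hk
    | succ r =>
      obtain ⟨rfl, rfl⟩ := node_inj hk
      exact ⟨t₁, s, t₂, hj, ht, rfl, rfl⟩

/-- The edges that leave a location which splits an edge. -/
theorem HatEdge.of_edgeName {e : Name × (Name ⊕ S) × Name} (h : HatEdge x ι W e) {e₀ : LockEdge}
    (hk : e.1 = edgeName e₀) : e.2 = (liftLabel ι e₀.2.1, origName e₀.2.2) := by
  cases h with
  | start => simp [startLoc, edgeName] at hk
  | halt => simp [origName, edgeName] at hk
  | enter e he => simp [origName, edgeName] at hk
  | leave e he => rw [edgeName_inj.1 hk]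
  | call j src h => exact absurd hk (source_ne_edgeName h _)
  | tail j t₁ s t₂ hj ht => exact absurd hk (node_ne_false_true j (t₂.length + 1) _)

/-- The edges that leave a location of the given graph. -/
theorem HatEdge.of_origName {e : Name × (Name ⊕ S) × Name} (h : HatEdge x ι W e) {ℓ : Name}
    (hk : e.1 = origName ℓ) :
    (ℓ = x.G.exit ∧ e.2 = (Sum.inl stopName, [])) ∨
    (∃ e₀ ∈ x.G.edges, ℓ = e₀.1 ∧ e.2 = (Sum.inl (edgeName e₀), edgeName e₀)) ∨
    ∃ k, x.C[k]? = some ℓ ∧ k < x.C.length + 2 ∧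
      e.2 = (Sum.inl (callName k), node k (gadgetTail x.C W k).length) := by
  cases h with
  | start => simp [startLoc, origName] at hk
  | halt => exact Or.inl ⟨by simpa [origName, eq_comm] using hk, rfl⟩
  | enter e he => exact Or.inr (Or.inl ⟨e, he, by simpa [origName, eq_comm] using hk, rfl⟩)
  | leave e he => simp [origName, edgeName] at hk
  | call j src h =>
    rcases source_cases h with ⟨rfl, _⟩ | ⟨ℓ', hℓ', rfl⟩
    · simp [startLoc, origName] at hk
    · have : ℓ' = ℓ := by simpa [origName] using hk
      subst this
      exact Or.inr (Or.inr ⟨j, hℓ', sources_lt h, rfl⟩)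
  | tail j t₁ s t₂ hj ht => exact absurd hk (node_ne_cons_true j (t₂.length + 1) _)

/-- The edges that leave the initial location. -/
theorem HatEdge.of_startLoc {e : Name × (Name ⊕ S) × Name} (h : HatEdge x ι W e)
    (hk : e.1 = startLoc) :
    e.2 = (Sum.inl startName, origName x.G.init) ∨
    ∃ k, x.C.length ≤ k ∧ k < x.C.length + 2 ∧
      e.2 = (Sum.inl (callName k), node k (gadgetTail x.C W k).length) := by
  cases h with
  | start => exact Or.inl rfl
  | halt => simp [startLoc, origName] at hk
  | enter e he => simp [startLoc, origName] at hk
  | leave e he => simp [startLoc, edgeName] at hk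
  | call j src h =>
    rcases source_cases h with ⟨rfl, h'⟩ | ⟨ℓ', hℓ', rfl⟩
    · exact Or.inr ⟨j, h', sources_lt h, rfl⟩
    · simp [startLoc, origName] at hk
  | tail j t₁ s t₂ hj ht => exact absurd hk (node_ne_startLoc j (t₂.length + 1))

/-- The name of an inner location records the gadget and the number of remaining operations, so
there is only one outgoing edge and the rest of the word is forced. -/
theorem hatPath_node {v : Name} {w : List (Name ⊕ S)}
    (h : PathIn (hatLocs x W) (hatEdges x ι W) v w []) (k : ℕ) (t₁ t₂ : List S)
    (ht : gadgetTail x.C W k = t₁ ++ t₂) (hv : v = node k t₂.length) : w = t₂.map Sum.inr := by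
  obtain ⟨z, hz⟩ : ∃ z : Name, z = [] := ⟨_, rfl⟩
  rw [← hz] at h
  induction h generalizing t₁ t₂ with
  | nil ℓ _ =>
    rw [hz, eq_comm, node_eq_nil, List.length_eq_zero_iff] at hv
    simp [hv]
  | cons u a v w z he _ ih =>
    obtain ⟨t₁', s, t₂', _, ht', hlen, h2⟩ := (mem_hatEdges.1 he).of_node hv
    have : t₁ = t₁' ∧ t₂ = s :: t₂' :=
      List.append_inj' (ht.symm.trans ht') (by simpa using hlen)
    obtain ⟨rfl, rfl⟩ := this
    simp only [Prod.mk.injEq] at h2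
    obtain ⟨rfl, rfl⟩ := h2
    rw [ih (t₁ ++ [s]) t₂' (by simpa using ht) rfl hz]
    rfl

/-- While simulating, a path alternates between given locations and the midpoints of split edges, so
both claims are proved by one induction. From a midpoint, the second half of the edge is still to be
performed. -/
theorem hatPath_orig {v : Name} {w : List (Name ⊕ S)}
    (h : PathIn (hatLocs x W) (hatEdges x ι W) v w []) :
    (∀ ℓ, v = origName ℓ → ∃ es suf, w = simWord ι es ++ sufWord x.C W suf ∧
      ((suf = none ∧ EdgePath x.G.locs x.G.edges ℓ es x.G.exit) ∨
        ∃ k ℓ', suf = some k ∧ x.C[k]? = some ℓ' ∧ EdgePath x.G.locs x.G.edges ℓ es ℓ')) ∧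
    (∀ e₀, v = edgeName e₀ →
      ∃ es suf, w = liftLabel ι e₀.2.1 :: (simWord ι es ++ sufWord x.C W suf) ∧
      ((suf = none ∧ EdgePath x.G.locs x.G.edges e₀.2.2 es x.G.exit) ∨
        ∃ k ℓ', suf = some k ∧ x.C[k]? = some ℓ' ∧
          EdgePath x.G.locs x.G.edges e₀.2.2 es ℓ')) := by
  obtain ⟨z, hz⟩ : ∃ z : Name, z = [] := ⟨_, rfl⟩
  rw [← hz] at h
  induction h with
  | nil ℓ _ => subst hz; simp [origName, edgeName]
  | cons u a v w z he hp ih =>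
    subst hz
    obtain ⟨ih1, ih2⟩ := ih rfl
    constructor
    · intro ℓ hu
      rcases (mem_hatEdges.1 he).of_origName hu with
        ⟨rfl, h2⟩ | ⟨e₀, he₀, rfl, h2⟩ | ⟨k, hk, _, h2⟩ <;>
        simp only [Prod.mk.injEq] at h2 <;> obtain ⟨rfl, rfl⟩ := h2
      · cases hp with
        | nil _ _ =>
          exact ⟨[], none, rfl, Or.inl ⟨rfl, .nil _ x.G.exit_mem⟩⟩
        | cons _ _ _ _ _ he' _ =>
          -- The exit is `node 0 0`, and an edge leaves a node only if some operation remains.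
          obtain ⟨_, _, _, _, _, h, _⟩ := (mem_hatEdges.1 he').of_node (k := 0) (r := 0) rfl
          omega
      · obtain ⟨es, suf, rfl, h⟩ := ih2 e₀ rfl
        refine ⟨e₀ :: es, suf, rfl, ?_⟩
        rcases h with ⟨rfl, h⟩ | ⟨k, ℓ', rfl, hk, h⟩
        · exact Or.inl ⟨rfl, .cons e₀ es _ he₀ h⟩
        · exact Or.inr ⟨k, ℓ', rfl, hk, .cons e₀ es _ he₀ h⟩
      · rw [hatPath_node hp k [] _ rfl rfl]
        exact ⟨[], some k, rfl,
          Or.inr ⟨k, ℓ, rfl, hk, .nil _ (x.C_mem ℓ (List.mem_of_getElem? hk))⟩⟩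
    · intro e₀ hu
      have h2 := (mem_hatEdges.1 he).of_edgeName hu
      simp only [Prod.mk.injEq] at h2
      obtain ⟨rfl, rfl⟩ := h2
      obtain ⟨es, suf, rfl, h⟩ := ih1 _ rfl
      exact ⟨es, suf, rfl, h⟩

/-- The words of the constructed graph. -/
theorem hatPath_iff {w : List (Name ⊕ S)} :
    PathIn (hatLocs x W) (hatEdges x ι W) startLoc w [] ↔
      ∃ pre suf, HatRun x pre suf ∧ w = preWord ι pre ++ sufWord x.C W suf := by
  constructor
  · intro h
    cases h with
    | cons _ a v w _ he hp =>
      rcases (mem_hatEdges.1 he).of_startLoc rfl with h2 | ⟨k, hk, hk', h2⟩ <;>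
        simp only [Prod.mk.injEq] at h2 <;> obtain ⟨rfl, rfl⟩ := h2
      · obtain ⟨es, suf, rfl, ⟨rfl, h⟩ | ⟨k, ℓ', rfl, hk, h⟩⟩ := (hatPath_orig hp).1 _ rfl
        · exact ⟨some es, none, .halt es h, rfl⟩
        · exact ⟨some es, some k, .call es k ℓ' hk h, rfl⟩
      · rw [hatPath_node hp k [] _ rfl rfl]
        exact ⟨none, some k, .direct k hk hk', rfl⟩
  · rintro ⟨pre, suf, h, rfl⟩
    exact h.path

theorem hat_edges_mem (e : Name × (Name ⊕ S) × Name) (h : e ∈ hatEdges x ι W) :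
    e.1 ∈ hatLocs x W ∧ e.2.2 ∈ hatLocs x W := by
  have horig : ∀ ℓ ∈ x.G.locs, origName ℓ ∈ hatLocs x W := fun ℓ h =>
    mem_hatLocs.2 (Or.inr (Or.inl ⟨ℓ, h, rfl⟩))
  have hedge : ∀ e ∈ x.G.edges, edgeName e ∈ hatLocs x W := fun e h =>
    mem_hatLocs.2 (Or.inr (Or.inr (Or.inl ⟨e, h, rfl⟩)))
  have hstart : startLoc ∈ hatLocs x W := mem_hatLocs.2 (Or.inl rfl)
  have hnode : ∀ k < x.C.length + 2, ∀ r ≤ (gadgetTail x.C W k).length,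
      node k r ∈ hatLocs x W := fun k hk r hr =>
    mem_hatLocs.2 (Or.inr (Or.inr (Or.inr (Or.inr ⟨k, hk, r, hr, rfl⟩))))
  cases mem_hatEdges.1 h with
  | start => exact ⟨hstart, horig _ x.G.init_mem⟩
  | halt => exact ⟨horig _ x.G.exit_mem, exit_mem_hatLocs⟩
  | enter e he => exact ⟨horig _ (x.G.edges_mem e he).1, hedge e he⟩
  | leave e he => exact ⟨hedge e he, horig _ (x.G.edges_mem e he).2⟩
  | call k src hk =>
    refine ⟨?_, hnode k (sources_lt hk) _ le_rfl⟩
    rcases source_cases hk with ⟨rfl, _⟩ | ⟨ℓ, hℓ, rfl⟩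
    · exact hstart
    · exact horig _ (x.C_mem ℓ (List.mem_of_getElem? hℓ))
  | tail k t₁ s t₂ hk ht =>
    exact ⟨hnode k hk (t₂.length + 1) (by simp [ht]), hnode k hk t₂.length (by simp [ht]; omega)⟩

theorem hat_reachable_orig {ℓ : Name} (h : ℓ ∈ x.G.locs) :
    ∃ w, PathIn (hatLocs x W) (hatEdges x ι W) startLoc w (origName ℓ) := by
  obtain ⟨w, hw⟩ := x.G.reachable ℓ h
  obtain ⟨es, hes, -⟩ := pathIn_iff_exists_edgePath.1 hw
  exact ⟨_, hatPath_start (hatPath_sim hes)⟩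

theorem hat_coreachable_orig {ℓ : Name} (h : ℓ ∈ x.G.locs) :
    ∃ w, PathIn (hatLocs x W) (hatEdges x ι W) (origName ℓ) w [] := by
  obtain ⟨w, hw⟩ := x.G.coreachable ℓ h
  obtain ⟨es, hes, -⟩ := pathIn_iff_exists_edgePath.1 hw
  exact ⟨_, (hatPath_sim hes).append hatPath_stop⟩

theorem hat_reachable (v : Name) (h : v ∈ hatLocs x W) :
    ∃ w, PathIn (hatLocs x W) (hatEdges x ι W) startLoc w v := by
  have hv := h
  rcases mem_hatLocs.1 h with rfl | ⟨ℓ, hℓ, rfl⟩ | ⟨e, he, rfl⟩ | rfl | ⟨k, hk, r, hr, rfl⟩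
  · exact ⟨[], .nil _ hv⟩
  · exact hat_reachable_orig hℓ
  · obtain ⟨w, hw⟩ := hat_reachable_orig (ι := ι) (W := W) (x.G.edges_mem e he).1
    exact ⟨_, hw.append (.single (mem_hatEdges.2 (.enter e he)) hv)⟩
  · obtain ⟨w, hw⟩ := hat_reachable_orig (ι := ι) (W := W) x.G.exit_mem
    exact ⟨_, hw.append hatPath_stop⟩
  · obtain ⟨src, hsrc⟩ := exists_source hk
    -- The node with `r` remaining operations is reached by performing all but the last `r` of them.
    have hpath : ∃ w, PathIn (hatLocs x W) (hatEdges x ι W) src w (node k r) := by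
      have := hatPath_tail (W := W) (ι := ι) hk [] ((gadgetTail x.C W k).take
        ((gadgetTail x.C W k).length - r)) ((gadgetTail x.C W k).drop
        ((gadgetTail x.C W k).length - r)) (by simp)
      rw [List.take_append_drop, List.length_drop, Nat.sub_sub_self hr] at this
      exact ⟨_, .cons _ _ _ _ _ (mem_hatEdges.2 (.call k src hsrc)) this⟩
    obtain ⟨w', hw'⟩ := hpath
    rcases source_cases hsrc with ⟨rfl, _⟩ | ⟨ℓ, hℓ, rfl⟩
    · exact ⟨w', hw'⟩
    · obtain ⟨w, hw⟩ := hat_reachable_orig (ι := ι) (W := W)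
        (x.C_mem ℓ (List.mem_of_getElem? hℓ))
      exact ⟨_, hw.append hw'⟩

theorem hat_coreachable (v : Name) (h : v ∈ hatLocs x W) :
    ∃ w, PathIn (hatLocs x W) (hatEdges x ι W) v w [] := by
  have hv := h
  rcases mem_hatLocs.1 h with rfl | ⟨ℓ, hℓ, rfl⟩ | ⟨e, he, rfl⟩ | rfl | ⟨k, hk, r, hr, rfl⟩
  · obtain ⟨w, hw⟩ := hat_coreachable_orig (ι := ι) (W := W) x.G.init_mem
    exact ⟨_, hatPath_start hw⟩
  · exact hat_coreachable_orig hℓ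
  · obtain ⟨w, hw⟩ := hat_coreachable_orig (ι := ι) (W := W) (x.G.edges_mem e he).2
    exact ⟨_, .cons _ _ _ _ _ (mem_hatEdges.2 (.leave e he)) hw⟩
  · exact ⟨[], .nil _ hv⟩
  · have := hatPath_tail (W := W) (ι := ι) hk ((gadgetTail x.C W k).take
      ((gadgetTail x.C W k).length - r)) ((gadgetTail x.C W k).drop
      ((gadgetTail x.C W k).length - r)) [] (by simp)
    rw [List.append_nil, List.length_drop, Nat.sub_sub_self hr] at this
    exact ⟨_, this⟩

/-- Actions of different kinds differ in their first bits, and splitting actions determine their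
edge. Two cases remain after this: lifted actions, which inherit uniqueness from the given graph,
and the actions that start gadgets, where the index determines the source. -/
theorem hat_unique_edge (e : Name × (Name ⊕ S) × Name) (he : e ∈ hatEdges x ι W)
    (e' : Name × (Name ⊕ S) × Name) (he' : e' ∈ hatEdges x ι W) (a : Name)
    (h : e.2.1 = Sum.inl a) (h' : e'.2.1 = Sum.inl a) : e = e' := by
  rw [mem_hatEdges] at he he'
  cases he <;> cases he' <;> simp only [Sum.inl.injEq, liftLabel_eq_inl, reduceCtorEq] at h h' <;>
    first
    | rfl
    | (exfalso; subst h; simp [startName, stopName, callName, edgeName] at h'; done)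
    | (exfalso; subst h'; simp [startName, stopName, callName, edgeName] at h; done)
    | (subst h; rw [edgeName_inj.1 h'])
    | skip
  · rename_i e he e' he'
    obtain ⟨b, hb, rfl⟩ := h
    obtain ⟨b', hb', h⟩ := h'
    simp only [List.cons.injEq, true_and] at h
    subst h
    rw [x.G.unique_edge e he e' he' b hb hb']
  · rename_i k src hk k' src' hk'
    subst h
    rw [callName_inj] at h'
    subst h'
    rw [hk] at hk'
    simp only [Option.some.injEq] at hk'
    rw [hk']

/-- Branching is possible only at the new initial location and at given locations, where all
outgoing edges carry ordinary actions; this is the purpose of splitting. Midpoints and inner gadget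
locations have a single outgoing edge. -/
theorem hat_deterministic (e : Name × (Name ⊕ S) × Name) (he : e ∈ hatEdges x ι W)
    (e' : Name × (Name ⊕ S) × Name) (he' : e' ∈ hatEdges x ι W) (h : e.1 = e'.1) :
    e = e' ∨ ∃ a a', e.2.1 = Sum.inl a ∧ e'.2.1 = Sum.inl a' := by
  rw [mem_hatEdges] at he he'
  have hor : (∃ a, e.2.1 = Sum.inl a) ∨ (∃ e₀, e.1 = edgeName e₀) ∨ ∃ k r, e.1 = node k r := by
    cases he with
    | start => exact Or.inl ⟨_, rfl⟩
    | halt => exact Or.inl ⟨_, rfl⟩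
    | enter e he => exact Or.inl ⟨_, rfl⟩
    | leave e he => exact Or.inr (Or.inl ⟨_, rfl⟩)
    | call k src hk => exact Or.inl ⟨_, rfl⟩
    | tail k t₁ s t₂ hk ht => exact Or.inr (Or.inr ⟨k, t₂.length + 1, rfl⟩)
  have hor' : (∃ a, e'.2.1 = Sum.inl a) ∨ (∃ e₀, e'.1 = edgeName e₀) ∨ ∃ k r, e'.1 = node k r := by
    cases he' with
    | start => exact Or.inl ⟨_, rfl⟩
    | halt => exact Or.inl ⟨_, rfl⟩
    | enter e he => exact Or.inl ⟨_, rfl⟩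
    | leave e he => exact Or.inr (Or.inl ⟨_, rfl⟩)
    | call k src hk => exact Or.inl ⟨_, rfl⟩
    | tail k t₁ s t₂ hk ht => exact Or.inr (Or.inr ⟨k, t₂.length + 1, rfl⟩)
  have hedge : ∀ e₀, e.1 = edgeName e₀ → e = e' := fun e₀ h₀ =>
    Prod.ext h ((he.of_edgeName h₀).trans (he'.of_edgeName (h.symm.trans h₀)).symm)
  have hnode : ∀ k r, e.1 = node k r → e = e' := by
    intro k r h₀
    obtain ⟨t₁, s, t₂, _, ht, hr, h2⟩ := he.of_node h₀
    obtain ⟨t₁', s', t₂', _, ht', hr', h2'⟩ := he'.of_node (h.symm.trans h₀)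
    have : t₁ = t₁' ∧ s :: t₂ = s' :: t₂' :=
      List.append_inj' (ht.symm.trans ht') (by simp; omega)
    simp only [List.cons.injEq] at this
    obtain ⟨rfl, rfl, rfl⟩ := this
    exact Prod.ext h (h2.trans h2'.symm)
  rcases hor with ⟨a, ha⟩ | ⟨e₀, h₀⟩ | ⟨k, r, h₀⟩
  · rcases hor' with ⟨a', ha'⟩ | ⟨e₀, h₀⟩ | ⟨k, r, h₀⟩
    · exact Or.inr ⟨a, a', ha, ha'⟩
    · exact Or.inl (hedge e₀ (h.trans h₀))
    · exact Or.inl (hnode k r (h.trans h₀))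
  · exact Or.inl (hedge e₀ h₀)
  · exact Or.inl (hnode k r h₀)

/-- The constructed graph. -/
def hatCFG (x : CoverInstance) (ι : LockOp Name → S) (W : ℕ → ℕ → List S) : CFG Name Name S where
  locs := hatLocs x W
  edges := hatEdges x ι W
  init := startLoc
  exit := []
  init_mem := mem_hatLocs.2 (Or.inl rfl)
  exit_mem := exit_mem_hatLocs
  init_ne_exit := by simp [startLoc]
  edges_mem := hat_edges_mem
  reachable := hat_reachable
  coreachable := hat_coreachable
  unique_edge := hat_unique_edge

theorem mem_hatCFG_traces {w : List (Name ⊕ S)} : w ∈ (hatCFG x ι W).traces ↔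
    ∃ pre suf, HatRun x pre suf ∧ w = preWord ι pre ++ sufWord x.C W suf :=
  hatPath_iff

theorem hatCFG_traces_eq {w w' : List (Name ⊕ S)} (h : w ∈ (hatCFG x ι W).traces)
    (h' : w' ∈ (hatCFG x ι W).traces) (hw : w.filterMap keepAct = w'.filterMap keepAct) :
    w = w' :=
  eq_of_filterMap_keepAct_eq (hatCFG x ι W) hat_deterministic
    (fun e he h => by
      obtain ⟨_, _, _, _, _, h, _⟩ := (mem_hatEdges.1 he).of_node (k := 0) (r := 0) h
      omega) h h' hw

end Graph

/-! ### The constructed instance -/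

/-- The operations of a gadget without sync-points. -/
def lockTail (k j : ℕ) : List (LockOp Name) :=
  [.acq (onceLock k), .acq (ringLock k), .acq (ringLock j), .rel (ringLock j), .rel (ringLock k)]

/-- The operations of a gadget with sync-points. -/
def syncTail (k j : ℕ) : List (LockOp Name ⊕ Unit) :=
  [.inl (.acq (onceLock k)), .inl (.acq (ringLock k)), .inr (), .inr (), .inl (.acq (ringLock j)),
    .inl (.rel (ringLock j)), .inl (.rel (ringLock k))]

/-- The thread template of the constructed instance. -/
def hatGraph (x : CoverInstance) : CFG Name Name (LockOp Name) := hatCFG x id lockTail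

/-- The sync-point instrumentation of the constructed instance. -/
def hatGraph' (x : CoverInstance) : CFG Name Name (LockOp Name ⊕ Unit) :=
  hatCFG x Sum.inl syncTail

theorem preWord_keepFst (pre : Option (List LockEdge)) :
    (preWord (Sum.inl : LockOp Name → LockOp Name ⊕ Unit) pre).filterMap keepFst =
      preWord id pre := by
  cases pre with
  | none => rfl
  | some es =>
    simp only [preWord, List.filterMap_cons, keepFst, List.cons.injEq, true_and]
    induction es with
    | nil => rfl
    | cons e es ih =>
      obtain ⟨u, a | o, v⟩ := e <;> simpa [simWord, liftLabel, keepFst] using ih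

theorem sufWord_keepFst (C : List Name) (suf : Option ℕ) :
    (sufWord C syncTail suf).filterMap keepFst = sufWord C lockTail suf := by
  cases suf <;> rfl

/-- Both graphs have the same runs `HatRun`, and erasing the sync-points turns `syncTail` into
`lockTail`. Uniqueness is determinism of the graph relative to its ordinary actions. -/
theorem isSyncPointInstrumentation_hat (x : CoverInstance) :
    IsSyncPointInstrumentation (hatGraph x) (hatGraph' x) := by
  refine ⟨?_, fun w₁ h₁ w₂ h₂ h => hatCFG_traces_eq h₁ h₂ h⟩
  ext w
  simp only [Set.mem_image, hatGraph, hatGraph', mem_hatCFG_traces]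
  constructor
  · rintro ⟨pre, suf, h, rfl⟩
    exact ⟨_, ⟨pre, suf, h, rfl⟩, by
      rw [List.filterMap_append, preWord_keepFst, sufWord_keepFst]⟩
  · rintro ⟨_, ⟨pre, suf, h, rfl⟩, rfl⟩
    exact ⟨pre, suf, h, by rw [List.filterMap_append, preWord_keepFst, sufWord_keepFst]⟩

/-- The reduction. -/
def hatInstance (x : CoverInstance) : SoundnessInstance where
  G := hatGraph x
  G' := hatGraph' x
  isInstrumentation := isSyncPointInstrumentation_hat x
  I := []
  I_sub := by simp

end LockPrograms

/-! ### Indexed traces, and the two disciplines as invariants of prefixes. -/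

open Turing

namespace LockPrograms

/-! ### Local traces -/

section LocalTraces

variable {X Y : Type}

@[simp]
theorem localTrace_nil (i : ℕ) : localTrace ([] : Trace X) i = [] := rfl

@[simp]
theorem localTrace_append (τ σ : Trace X) (i : ℕ) :
    localTrace (τ ++ σ) i = localTrace τ i ++ localTrace σ i := by
  simp [localTrace]

theorem localTrace_cons (a : X) (j : ℕ) (τ : Trace X) (i : ℕ) :
    localTrace ((a, j) :: τ) i = if j = i then a :: localTrace τ i else localTrace τ i := by
  by_cases h : j = i <;> simp [localTrace, h]

theorem mem_localTrace {a : X} {τ : Trace X} {i : ℕ} : a ∈ localTrace τ i ↔ (a, i) ∈ τ := by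
  simp [localTrace]

@[simp]
theorem proj_append (p : X → Option Y) (τ σ : Trace X) :
    proj p (τ ++ σ) = proj p τ ++ proj p σ := by
  simp [proj]

theorem proj_cons (p : X → Option Y) (a : X) (i : ℕ) (τ : Trace X) :
    proj p ((a, i) :: τ) = ((p a).map fun y => (y, i)).toList ++ proj p τ := by
  cases h : p a <;> simp [proj, h]

theorem localTrace_proj (p : X → Option Y) (τ : Trace X) (i : ℕ) :
    localTrace (proj p τ) i = (localTrace τ i).filterMap p := by
  induction τ with
  | nil => rfl
  | cons x τ ih =>
    obtain ⟨a, j⟩ := x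
    rw [proj_cons, localTrace_append, ih, localTrace_cons]
    cases h : p a <;> by_cases hj : j = i <;> simp [h, hj, localTrace_cons]

theorem proj_eq_nil {p : X → Option Y} {τ : Trace X} (h : ∀ x ∈ τ, p x.1 = none) :
    proj p τ = [] := by
  rw [proj, List.filterMap_eq_nil_iff]
  intro x hx
  simp [h x hx]

theorem proj_proj {Z : Type} (p : X → Option Y) (q : Y → Option Z) (τ : Trace X) :
    proj q (proj p τ) = proj (fun a => (p a).bind q) τ := by
  induction τ with
  | nil => rfl
  | cons x τ ih =>
    rw [proj_cons, proj_append, ih, proj_cons]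
    cases h : p x.1 with
    | none => simp [proj]
    | some b => cases hb : q b <;> simp [proj, hb]

/-- The indexed trace in which only thread `i` runs. -/
def single (i : ℕ) (w : List X) : Trace X := w.map fun a => (a, i)

theorem localTrace_single (i : ℕ) (w : List X) (j : ℕ) :
    localTrace (single i w) j = if i = j then w else [] := by
  induction w with
  | nil => simp [single]
  | cons a w ih =>
    have := localTrace_cons a i (single i w) j
    rw [ih] at this
    by_cases h : i = j <;> simpa [single, h] using this

theorem proj_single (p : X → Option Y) (i : ℕ) (w : List X) :
    proj p (single i w) = single i (w.filterMap p) := by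
  induction w with
  | nil => rfl
  | cons a w ih =>
    have := proj_cons p a i (single i w)
    rw [ih] at this
    cases h : p a <;> simpa [single, h] using this

theorem localTrace_isPrefix {ρ τ : Trace X} (h : ρ <+: τ) (i : ℕ) :
    localTrace ρ i <+: localTrace τ i := by
  obtain ⟨σ, rfl⟩ := h
  rw [localTrace_append]
  exact List.prefix_append _ _

theorem proj_isPrefix {ρ τ : Trace X} (h : ρ <+: τ) (p : X → Option Y) :
    proj p ρ <+: proj p τ := by
  obtain ⟨σ, rfl⟩ := h
  rw [proj_append]
  exact List.prefix_append _ _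

/-- Every finite family of words is the family of local traces of an indexed trace. -/
theorem exists_trace (F : Finset ℕ) (w : ℕ → List X) (hF : ∀ i ∉ F, w i = []) :
    ∃ τ : Trace X, ∀ i, localTrace τ i = w i := by
  induction F using Finset.induction_on generalizing w with
  | empty => exact ⟨[], fun i => (hF i (by simp)).symm⟩
  | insert a F ha ih =>
    obtain ⟨τ, hτ⟩ := ih (Function.update w a []) fun i hi => by
      by_cases h : i = a
      · simp [h]
      · rw [Function.update_of_ne h]
        exact hF i (by simp [h, hi])
    refine ⟨single a (w a) ++ τ, fun i => ?_⟩
    rw [localTrace_append, localTrace_single, hτ]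
    by_cases h : a = i
    · subst h; simp
    · simp [h, Function.update_of_ne (Ne.symm h)]

/-- An indexed trace can be lifted along a projection if its local traces can. -/
theorem exists_lift (p : X → Option Y) (F : Finset ℕ) (τ : Trace Y) (w : ℕ → List X)
    (hF : ∀ i ∉ F, w i = []) (h : ∀ i, (w i).filterMap p = localTrace τ i) :
    ∃ τ' : Trace X, proj p τ' = τ ∧ ∀ i, localTrace τ' i = w i := by
  induction τ generalizing w with
  | nil =>
    obtain ⟨τ, hτ⟩ := exists_trace F w hF
    refine ⟨τ, proj_eq_nil fun x hx => ?_, hτ⟩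
    have h1 := mem_localTrace.2 (show (x.1, x.2) ∈ τ from hx)
    rw [hτ] at h1
    have h2 := h x.2
    rw [localTrace_nil, List.filterMap_eq_nil_iff] at h2
    exact h2 _ h1
  | cons y τ ih =>
    obtain ⟨b, i⟩ := y
    have hi := h i
    rw [localTrace_cons, if_pos rfl, List.filterMap_eq_cons_iff] at hi
    obtain ⟨u, a, v, hw, hu, ha, hv⟩ := hi
    obtain ⟨τ', h1, h2⟩ := ih (Function.update w i v)
      (fun j hj => by
        by_cases hji : j = i
        · subst hji
          have := hF j hj
          rw [hw] at this
          simp at this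
        · rw [Function.update_of_ne hji]
          exact hF j hj)
      (fun j => by
        by_cases hji : j = i
        · subst hji; simpa using hv
        · rw [Function.update_of_ne hji, h j, localTrace_cons, if_neg (Ne.symm hji)])
    -- The letters of thread `i` that `p` drops are scheduled immediately before the letter that
    -- maps to `b`; dropped letters at the very end are supplied by the base case.
    refine ⟨single i (u ++ [a]) ++ τ', ?_, fun j => ?_⟩
    · rw [proj_append, h1, proj_single, List.filterMap_append, List.filterMap_eq_nil_iff.2 hu]
      simp [ha, single]
    · rw [localTrace_append, localTrace_single, h2]
      by_cases hji : i = j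
      · subst hji; simp [hw]
      · simp [hji, Function.update_of_ne (Ne.symm hji)]

/-- A swap involves two different threads, whatever `I` is. This invariant is all that is used about
coverings, which makes the commutativity relation irrelevant. -/
theorem CoveredBy.localTrace_eq {I : Set (X × X)} {τ τ' : Trace X} (h : CoveredBy I τ τ') (i : ℕ) :
    localTrace τ i = localTrace τ' i := by
  induction h with
  | refl => rfl
  | tail _ h ih =>
    rw [ih]
    obtain ⟨ρ, σ, a, b, j, k, _, hjk⟩ := h
    simp only [localTrace_append, localTrace_cons]
    by_cases h1 : j = i
    · subst h1; simp [Ne.symm hjk]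
    · simp [h1]

end LocalTraces

/-! ### The lock discipline as an automaton for each lock -/

section Locks

variable {A M : Type} [DecidableEq M]

/-- The thread that holds the lock `m` after a trace. -/
def holder (m : M) : Option ℕ → Trace (A ⊕ LockOp M) → Option ℕ
  | h, [] => h
  | h, (Sum.inl _, _) :: τ => holder m h τ
  | h, (Sum.inr (LockOp.acq m'), i) :: τ => holder m (if m' = m then some i else h) τ
  | h, (Sum.inr (LockOp.rel m'), _) :: τ => holder m (if m' = m then none else h) τ

/-- All operations of a trace on the lock `m` are possible. -/
def LockOk (m : M) : Option ℕ → Trace (A ⊕ LockOp M) → Prop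
  | _, [] => True
  | h, (Sum.inl _, _) :: τ => LockOk m h τ
  | h, (Sum.inr (LockOp.acq m'), i) :: τ =>
    if m' = m then h = none ∧ LockOk m (some i) τ else LockOk m h τ
  | h, (Sum.inr (LockOp.rel m'), i) :: τ =>
    if m' = m then h = some i ∧ LockOk m none τ else LockOk m h τ

theorem lockOk_append (m : M) (h : Option ℕ) (τ σ : Trace (A ⊕ LockOp M)) :
    LockOk m h (τ ++ σ) ↔ LockOk m h τ ∧ LockOk m (holder m h τ) σ := by
  induction τ generalizing h with
  | nil => simp [LockOk, holder]
  | cons x τ ih =>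
    obtain ⟨a | m' | m', i⟩ := x
    · simp [LockOk, holder, ih]
    · by_cases hm : m' = m <;> simp [LockOk, holder, ih, hm, and_assoc]
    · by_cases hm : m' = m <;> simp [LockOk, holder, ih, hm, and_assoc]

theorem holder_append (m : M) (h : Option ℕ) (τ σ : Trace (A ⊕ LockOp M)) :
    holder m h (τ ++ σ) = holder m (holder m h τ) σ := by
  induction τ generalizing h with
  | nil => rfl
  | cons x τ ih => obtain ⟨a | m' | m', i⟩ := x <;> simp [holder, ih]

theorem lockOk_of_untouched {m : M} {τ : Trace (A ⊕ LockOp M)}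
    (hτ : ∀ x ∈ τ, actsOn m x.1 = false) (h : Option ℕ) : LockOk m h τ ∧ holder m h τ = h := by
  induction τ with
  | nil => simp [LockOk, holder]
  | cons x τ ih =>
    have ih := ih fun y hy => hτ y (by simp [hy])
    have hx := hτ x (by simp)
    obtain ⟨a | m' | m', i⟩ := x
    · simpa [LockOk, holder] using ih
    · have : m' ≠ m := of_decide_eq_false hx
      simpa [LockOk, holder, this] using ih
    · have : m' ≠ m := of_decide_eq_false hx
      simpa [LockOk, holder, this] using ih

/-- The shape of traces over the operations on `m`. -/
def LockShape (m : M) (τ : Trace (A ⊕ LockOp M)) : Prop :=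
  ∃ (is : List ℕ) (rest : Trace (A ⊕ LockOp M)),
    τ = is.flatMap (fun i => [(Sum.inr (LockOp.acq m), i), (Sum.inr (LockOp.rel m), i)]) ++ rest ∧
    (rest = [] ∨ ∃ i : ℕ, rest = [(Sum.inr (LockOp.acq m), i)])

theorem LockShape.cons {m : M} {τ : Trace (A ⊕ LockOp M)} (h : LockShape m τ) (i : ℕ) :
    LockShape m ((Sum.inr (LockOp.acq m), i) :: (Sum.inr (LockOp.rel m), i) :: τ) := by
  obtain ⟨is, rest, rfl, h⟩ := h
  exact ⟨i :: is, rest, by simp, h⟩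

/-- Putting the pending acquisition in front when the lock is held lets one induction treat the free
and the held state together. -/
theorem lockShape_of_lockOk (m : M) (τ : Trace (A ⊕ LockOp M)) :
    (LockOk m none τ → LockShape m (lockTrace m τ)) ∧
    ∀ i, LockOk m (some i) τ →
      LockShape m ((Sum.inr (LockOp.acq m), i) :: lockTrace m τ) := by
  induction τ with
  | nil =>
    exact ⟨fun _ => ⟨[], [], rfl, Or.inl rfl⟩, fun i _ => ⟨[], _, rfl, Or.inr ⟨i, rfl⟩⟩⟩
  | cons x τ ih =>
    obtain ⟨a | m' | m', j⟩ := x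
    · simpa [lockTrace, actsOn, LockOk] using ih
    · by_cases hm : m' = m
      · subst hm
        simpa [lockTrace, actsOn, LockOp.lock, LockOk] using ih.2 j
      · simpa [lockTrace, actsOn, LockOp.lock, LockOk, hm] using ih
    · by_cases hm : m' = m
      · subst hm
        refine ⟨by simp [LockOk], fun i hi => ?_⟩
        simp only [LockOk, if_true, Option.some.injEq] at hi
        obtain ⟨rfl, hi⟩ := hi
        simpa [lockTrace, actsOn, LockOp.lock] using (ih.1 hi).cons i
      · simpa [lockTrace, actsOn, LockOp.lock, LockOk, hm] using ih

theorem lockOk_of_lockShape {m : M} {τ : Trace (A ⊕ LockOp M)} (h : LockShape m τ) :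
    LockOk m none τ := by
  obtain ⟨is, rest, rfl, h⟩ := h
  induction is with
  | nil => rcases h with rfl | ⟨i, rfl⟩ <;> simp [LockOk]
  | cons i is ih => simpa [LockOk] using ih

theorem lockOk_lockTrace (m : M) (h : Option ℕ) (τ : Trace (A ⊕ LockOp M)) :
    LockOk m h (lockTrace m τ) ↔ LockOk m h τ := by
  induction τ generalizing h with
  | nil => rfl
  | cons x τ ih =>
    obtain ⟨a | m' | m', j⟩ := x
    · simpa [lockTrace, actsOn, LockOk] using ih h
    · by_cases hm : m' = m
      · subst hm
        simpa [lockTrace, actsOn, LockOp.lock, LockOk] using fun _ => ih _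
      · simpa [lockTrace, actsOn, LockOp.lock, LockOk, hm] using ih h
    · by_cases hm : m' = m
      · subst hm
        simpa [lockTrace, actsOn, LockOp.lock, LockOk] using fun _ => ih _
      · simpa [lockTrace, actsOn, LockOp.lock, LockOk, hm] using ih h

/-- The automaton form splits along concatenations by `lockOk_append`, in contrast to the
decomposition into blocks. -/
theorem lockSync_iff {τ : Trace (A ⊕ LockOp M)} : LockSync τ ↔ ∀ m, LockOk m none τ :=
  forall_congr' fun m => ⟨fun h => (lockOk_lockTrace m none τ).1 (lockOk_of_lockShape h),
    (lockShape_of_lockOk m τ).1⟩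

/-- Projections that rename locks. -/
theorem lockOk_proj {A' M' : Type} [DecidableEq M'] (p : A ⊕ LockOp M → Option (A' ⊕ LockOp M'))
    (m : M) (m' : M') (hacq : p (Sum.inr (LockOp.acq m)) = some (Sum.inr (LockOp.acq m')))
    (hrel : p (Sum.inr (LockOp.rel m)) = some (Sum.inr (LockOp.rel m')))
    (hp : ∀ a b, actsOn m a = false → p a = some b → actsOn m' b = false) (h : Option ℕ)
    (τ : Trace (A ⊕ LockOp M)) : LockOk m' h (proj p τ) ↔ LockOk m h τ := by
  induction τ generalizing h with
  | nil => rfl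
  | cons x τ ih =>
    obtain ⟨a, i⟩ := x
    rw [proj_cons]
    by_cases ha : actsOn m a = false
    · have h1 : LockOk m h ((a, i) :: τ) ↔ LockOk m h τ := by
        have := lockOk_append m h [(a, i)] τ
        have h2 := lockOk_of_untouched (τ := [(a, i)]) (by simpa using ha) h
        rw [h2.2] at this
        simpa [h2.1] using this
      rw [h1, lockOk_append, ← ih]
      have h2 := lockOk_of_untouched (m := m')
        (τ := ((p a).map fun y => (y, i)).toList) (fun x hx => by
          simp only [Option.mem_toList, Option.map_eq_some_iff] at hx
          obtain ⟨b, hb, rfl⟩ := hx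
          exact hp a b ha hb) h
      rw [h2.2]
      exact and_iff_right h2.1
    · obtain a | m'' | m'' := a
      · simp [actsOn] at ha
      · have hm : m'' = m := of_decide_eq_true (Bool.eq_true_of_not_eq_false ha)
        subst hm
        simp [hacq, LockOk, ih]
      · have hm : m'' = m := of_decide_eq_true (Bool.eq_true_of_not_eq_false ha)
        subst hm
        simp [hrel, LockOk, ih]

/-- Threads can be removed. -/
theorem lockOk_filter_threads (m : M) (q : ℕ → Bool) (h : Option ℕ) (τ : Trace (A ⊕ LockOp M))
    (hτ : LockOk m h τ) : LockOk m (h.filter q) (τ.filter fun x => q x.2) := by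
  induction τ generalizing h with
  | nil => trivial
  | cons x τ ih =>
    obtain ⟨a | m' | m', i⟩ := x
    · cases hi : q i <;> simpa [LockOk, hi] using ih h hτ
    · by_cases hm : m' = m
      · subst hm
        simp only [LockOk, if_true] at hτ
        obtain ⟨rfl, hτ⟩ := hτ
        have := ih _ hτ
        cases hi : q i <;> simpa [LockOk, hi, Option.filter] using this
      · simp only [LockOk, hm, if_false] at hτ
        cases hi : q i <;> simpa [LockOk, hi, hm] using ih h hτ
    · by_cases hm : m' = m
      · subst hm
        simp only [LockOk, if_true] at hτ
        obtain ⟨rfl, hτ⟩ := hτ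
        have := ih _ hτ
        cases hi : q i <;> simpa [LockOk, hi, Option.filter] using this
      · simp only [LockOk, hm, if_false] at hτ
        cases hi : q i <;> simpa [LockOk, hi, hm] using ih h hτ

/-- The letter acquires `m`. -/
def isAcq (m : M) : A ⊕ LockOp M → Bool
  | Sum.inr (LockOp.acq m') => decide (m' = m)
  | _ => false

/-- The letter releases `m`. -/
def isRel (m : M) : A ⊕ LockOp M → Bool
  | Sum.inr (LockOp.rel m') => decide (m' = m)
  | _ => false

/-- The number of locks held by `i`, if `h` is the holder of a lock. -/
def held (i : ℕ) (h : Option ℕ) : ℕ := if h = some i then 1 else 0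

/-- A conservation law: each acquisition by `i` makes `i` the holder of a free lock, and each
release by `i` ends this. -/
theorem LockOk.count {m : M} {h : Option ℕ} {τ : Trace (A ⊕ LockOp M)} (hτ : LockOk m h τ)
    (i : ℕ) : (localTrace τ i).countP (isAcq m) + held i h =
      (localTrace τ i).countP (isRel m) + held i (holder m h τ) := by
  induction τ generalizing h with
  | nil => simp [holder]
  | cons x τ ih =>
    obtain ⟨a | m' | m', j⟩ := x
    · have := ih (h := h) hτ
      by_cases hj : j = i <;> simpa [localTrace_cons, hj, isAcq, isRel, holder] using this
    · by_cases hm : m' = m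
      · subst hm
        simp only [LockOk, if_true] at hτ
        obtain ⟨rfl, hτ⟩ := hτ
        have := ih hτ
        by_cases hj : j = i
        · simp [localTrace_cons, hj, isAcq, isRel, holder, held] at this ⊢
          omega
        · simpa [localTrace_cons, hj, isAcq, isRel, holder, held] using this
      · simp only [LockOk, hm, if_false] at hτ
        have := ih hτ
        by_cases hj : j = i <;> simpa [localTrace_cons, hj, isAcq, isRel, holder, hm] using this
    · by_cases hm : m' = m
      · subst hm
        simp only [LockOk, if_true] at hτ
        obtain ⟨rfl, hτ⟩ := hτ
        have := ih hτ
        by_cases hj : j = i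
        · simp [localTrace_cons, hj, isAcq, isRel, holder, held] at this ⊢
          omega
        · simpa [localTrace_cons, hj, isAcq, isRel, holder, held] using this
      · simp only [LockOk, hm, if_false] at hτ
        have := ih hτ
        by_cases hj : j = i <;> simpa [localTrace_cons, hj, isAcq, isRel, holder, hm] using this

/-- Since `m` can be acquired next, nobody holds it, so every thread has released it as often as
acquired it. -/
theorem LockSync.count_eq {m : M} {τ : Trace (A ⊕ LockOp M)} {j : ℕ}
    (h : LockSync (τ ++ [(Sum.inr (LockOp.acq m), j)])) (i : ℕ) :
    (localTrace τ i).countP (isAcq m) = (localTrace τ i).countP (isRel m) := by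
  have h1 := (lockOk_append m none _ _).1 (lockSync_iff.1 h m)
  have h2 : holder m none τ = none := by simpa [LockOk] using h1.2
  simpa [h2, held] using h1.1.count i

theorem LockSync.of_isPrefix {ρ τ : Trace (A ⊕ LockOp M)} (h : LockSync τ) (hρ : ρ <+: τ) :
    LockSync ρ := by
  obtain ⟨σ, rfl⟩ := hρ
  rw [lockSync_iff] at h ⊢
  exact fun m => ((lockOk_append m none ρ σ).1 (h m)).1

/-- A lock that is never released is acquired by at most one thread. -/
theorem LockSync.eq_of_not_rel {m : M} {τ : Trace (A ⊕ LockOp M)} (h : LockSync τ)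
    (hrel : ∀ i, Sum.inr (LockOp.rel m) ∉ localTrace τ i) {i j : ℕ}
    (hi : Sum.inr (LockOp.acq m) ∈ localTrace τ i) (hj : Sum.inr (LockOp.acq m) ∈ localTrace τ j) :
    i = j := by
  have key : ∀ i, Sum.inr (LockOp.acq m) ∈ localTrace τ i → holder m none τ = some i := by
    intro i hi
    have h1 := (lockSync_iff.1 h m).count i
    have h2 : 0 < (localTrace τ i).countP (isAcq m) :=
      List.countP_pos_iff.2 ⟨_, hi, by simp [isAcq]⟩
    have h3 : (localTrace τ i).countP (isRel m) = 0 := by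
      rw [List.countP_eq_zero]
      rintro (a | m' | m') ha <;> simp only [isRel, decide_eq_true_eq,
        not_false_eq_true, Bool.false_eq_true]
      rintro rfl
      exact hrel i ha
    by_contra h4
    simp only [held, reduceCtorEq, if_false, h3, h4] at h1
    omega
  simpa [key i hi] using key j hj

end Locks

/-! ### The sync-point discipline -/

section SyncPoints

variable {A : Type}

/-- The letter is a sync-point. -/
def isPoint : A ⊕ Unit → Bool
  | Sum.inl _ => false
  | Sum.inr _ => true

/-- The number of sync-points of a thread. -/
def points (τ : Trace (A ⊕ Unit)) (i : ℕ) : ℕ := (localTrace τ i).countP isPoint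

@[simp]
theorem points_append (τ σ : Trace (A ⊕ Unit)) (i : ℕ) :
    points (τ ++ σ) i = points τ i + points σ i := by
  simp [points]

theorem points_barrier (l : List ℕ) (i : ℕ) :
    points (l.map fun i => ((Sum.inr () : A ⊕ Unit), i)) i = l.count i := by
  induction l with
  | nil => rfl
  | cons j l ih =>
    by_cases h : j = i
    · subst h
      simp only [points] at ih
      rw [List.count_cons_self, ← ih, points, List.map_cons, localTrace_cons, if_pos rfl,
        List.countP_cons_of_pos rfl]
    · simp only [points] at ih
      rw [List.count_cons_of_ne h, ← ih, points, List.map_cons, localTrace_cons, if_neg h]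

theorem isPrefix_append_cases {X : Type} {ρ σ τ : List X} (h : ρ <+: σ ++ τ) :
    ρ <+: σ ∨ ∃ ρ', ρ = σ ++ ρ' ∧ ρ' <+: τ := by
  obtain ⟨υ, hυ⟩ := h
  rcases List.append_eq_append_iff.1 hυ with ⟨z, rfl, _⟩ | ⟨z, rfl, rfl⟩
  · exact Or.inl (List.prefix_append _ _)
  · exact Or.inr ⟨z, rfl, List.prefix_append _ _⟩

/-- A complete barrier contributes one sync-point to each thread of `T`; only a prefix that ends
inside a barrier can separate two threads, and then by at most one. -/
theorem Phase.points {T : Finset ℕ} {τ : Trace (A ⊕ Unit)} (h : Phase T τ) :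
    (∀ i ∉ T, localTrace τ i = []) ∧
    ∀ i ∈ T, ∀ j ∈ T, points τ i = points τ j ∧
      ∀ ρ, ρ <+: τ → LockPrograms.points ρ j ≤ LockPrograms.points ρ i + 1 := by
  induction h with
  | nil => simp [LockPrograms.points]
  | act a k τ hk _ ih =>
    have hp : ∀ ρ i, LockPrograms.points ((Sum.inl a, k) :: ρ : Trace (A ⊕ Unit)) i =
        LockPrograms.points ρ i := fun ρ i => by
      by_cases h : k = i <;> simp [LockPrograms.points, localTrace_cons, h, isPoint]
    refine ⟨fun i hi => ?_, fun i hi j hj => ⟨?_, fun ρ hρ => ?_⟩⟩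
    · rw [localTrace_cons, if_neg (by rintro rfl; exact hi hk), ih.1 i hi]
    · rw [hp, hp, (ih.2 i hi j hj).1]
    · rcases ρ with _ | ⟨x, ρ⟩
      · simp [LockPrograms.points]
      · obtain ⟨rfl, hρ'⟩ := List.cons_prefix_cons.1 hρ
        rw [hp, hp]
        exact (ih.2 i hi j hj).2 ρ hρ'
  | barrier l τ hl hT _ ih =>
    have hone : ∀ i ∈ T, l.count i = 1 := fun i hi =>
      List.count_eq_one_of_mem hl (by rw [← hT] at hi; simpa using hi)
    refine ⟨fun i hi => ?_, fun i hi j hj => ⟨?_, fun ρ hρ => ?_⟩⟩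
    · rw [localTrace_append, ih.1 i hi, List.append_nil, List.eq_nil_iff_forall_not_mem]
      intro a ha
      rw [mem_localTrace, List.mem_map] at ha
      obtain ⟨k, hk, h⟩ := ha
      simp only [Prod.mk.injEq] at h
      exact hi (by rw [← hT]; simpa [h.2] using hk)
    · simp only [points_append, points_barrier, hone i hi, hone j hj, (ih.2 i hi j hj).1]
    · rcases isPrefix_append_cases hρ with h | ⟨ρ', rfl, h⟩
      · obtain ⟨σ, hσ⟩ := h
        have := congrArg (fun τ => LockPrograms.points τ j) hσ
        simp only [points_append, points_barrier, hone j hj] at this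
        omega
      · have := (ih.2 i hi j hj).2 ρ' h
        simp only [points_append, points_barrier, hone i hi, hone j hj]
        omega

theorem SyncFrom.localTrace_eq_nil {T : Finset ℕ} {τ : Trace (A ⊕ Unit)} (h : SyncFrom T τ)
    (i : ℕ) (hi : i ∉ T) : localTrace τ i = [] := by
  induction h with
  | done => rfl
  | step T T' τ₁ τ₂ h₁ h₂ _ ih =>
    rw [localTrace_append, h₁.points.1 i hi, ih fun h => hi (h₂.1 h)]
    rfl

/-- No thread is more than one sync-point ahead of a thread that still has sync-points to pass. -/
theorem SyncFrom.points_le {T : Finset ℕ} {τ : Trace (A ⊕ Unit)} (h : SyncFrom T τ) (i j : ℕ)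
    (ρ : Trace (A ⊕ Unit)) (hρ : ρ <+: τ) : points ρ j ≤ points ρ i + 1 ∨ points ρ i = points τ i := by
  have hsync := h
  induction h generalizing ρ with
  | done => simp [List.prefix_nil.1 hρ]
  | step T T' τ₁ τ₂ h₁ h₂ h₃ ih =>
    by_cases hi : i ∈ T
    swap
    · right
      have h4 := hsync.localTrace_eq_nil i hi
      have h5 := localTrace_isPrefix hρ i
      rw [h4, List.prefix_nil] at h5
      simp only [points, h4, h5]
    by_cases hj : j ∈ T
    swap
    · left
      have h4 := hsync.localTrace_eq_nil j hj
      have h5 := localTrace_isPrefix hρ j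
      rw [h4, List.prefix_nil] at h5
      simp [points, h5]
    rcases isPrefix_append_cases hρ with h | ⟨ρ', rfl, h⟩
    · exact Or.inl ((h₁.points.2 i hi j hj).2 ρ h)
    -- The completed phase contributes equally to `i` and `j`, so the claim for the remaining trace
    -- carries over.
    · have h4 := (h₁.points.2 i hi j hj).1
      simp only [points_append]
      rcases ih ρ' h h₃ with h5 | h5
      · left; omega
      · right; omega

theorem phase_of_acts {T : Finset ℕ} {τ : Trace (A ⊕ Unit)}
    (h : ∀ x ∈ τ, (∃ a, x.1 = Sum.inl a) ∧ x.2 ∈ T) : Phase T τ := by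
  induction τ with
  | nil => exact .nil
  | cons x τ ih =>
    obtain ⟨⟨a, ha⟩, hx⟩ := h x (by simp)
    obtain ⟨y, i⟩ := x
    simp only at ha
    subst ha
    exact .act a i τ hx (ih fun y hy => h y (by simp [hy]))

end SyncPoints

end LockPrograms

/-! ### A coverable configuration makes the instrumentation unsound. -/

open Turing

namespace LockPrograms

/-! ### Words of the constructed graphs -/

theorem ringNext_lt {C : List Name} {k : ℕ} (h : k < C.length + 2) :
    ringNext C k < C.length + 2 := by
  unfold ringNext
  split_ifs <;> omega

theorem ringNext_ne (C : List Name) (k : ℕ) : ringNext C k ≠ k := by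
  unfold ringNext
  split_ifs <;> omega

/-- The projection to the labels of the given graph. -/
def backLabel : Name ⊕ LockOp Name → Option (Name ⊕ LockOp Name)
  | Sum.inl (true :: a) => some (Sum.inl a)
  | Sum.inr (LockOp.acq (true :: m)) => some (Sum.inr (LockOp.acq m))
  | Sum.inr (LockOp.rel (true :: m)) => some (Sum.inr (LockOp.rel m))
  | _ => none

/-- The projection that drops the operations on new locks. -/
def keepOrig : Name ⊕ LockOp Name → Option (Name ⊕ (LockOp Name ⊕ Unit))
  | Sum.inl a => some (Sum.inl a)
  | Sum.inr (LockOp.acq (true :: m)) => some (Sum.inr (Sum.inl (LockOp.acq (true :: m))))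
  | Sum.inr (LockOp.rel (true :: m)) => some (Sum.inr (Sum.inl (LockOp.rel (true :: m))))
  | _ => none

theorem preWord_filterMap {S Y : Type} (ι : LockOp Name → S) (p : Name ⊕ S → Option Y)
    (es : List LockEdge) (h : p (Sum.inl startName) = none)
    (h' : ∀ e, p (Sum.inl (edgeName e)) = none) :
    (preWord ι (some es)).filterMap p = es.filterMap fun e => p (liftLabel ι e.2.1) := by
  simp only [preWord, List.filterMap_cons, h]
  induction es with
  | nil => rfl
  | cons e es ih =>
    simp only [simWord, List.flatMap_cons, List.cons_append, List.nil_append,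
      List.filterMap_cons, h'] at ih ⊢
    rw [ih]

theorem preWord_back (es : List LockEdge) :
    (preWord id (some es)).filterMap backLabel = es.map fun e => e.2.1 := by
  rw [preWord_filterMap id backLabel es rfl fun _ => rfl, ← List.filterMap_eq_map]
  congr 1
  funext ⟨u, l, v⟩
  rcases l with a | m | m <;> rfl

theorem sufWord_back (C : List Name) (suf : Option ℕ) :
    (sufWord C lockTail suf).filterMap backLabel = [] := by
  cases suf <;> rfl

theorem preWord_keepOrig (pre : Option (List LockEdge)) :
    (preWord id pre).filterMap keepOrig = preWord Sum.inl pre := by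
  cases pre with
  | none => rfl
  | some es =>
    simp only [preWord, List.filterMap_cons, keepOrig, List.cons.injEq, true_and]
    induction es with
    | nil => rfl
    | cons e es ih =>
      obtain ⟨u, a | m | m, v⟩ := e <;>
        simpa [simWord, liftLabel, keepOrig, LockOp.tag] using ih

/-- The simulation uses tagged locks only, hence it never touches the locks of the gadgets, whose
names begin with `false`. -/
theorem mem_preWord {S : Type} {ι : LockOp Name → S} {pre : Option (List LockEdge)}
    {a : Name ⊕ S} (h : a ∈ preWord ι pre) :
    (∃ b, a = Sum.inl b) ∨ ∃ o : LockOp Name, a = Sum.inr (ι o.tag) := by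
  cases pre with
  | none => simp [preWord] at h
  | some es =>
    simp only [preWord, simWord, List.mem_cons, List.mem_flatMap, List.not_mem_nil, or_false] at h
    rcases h with rfl | ⟨⟨u, l, v⟩, _, rfl | rfl⟩
    · exact Or.inl ⟨_, rfl⟩
    · exact Or.inl ⟨_, rfl⟩
    · rcases l with b | o
      · exact Or.inl ⟨_, rfl⟩
      · exact Or.inr ⟨o, rfl⟩

theorem LockOp.lock_tag (o : LockOp Name) : o.tag.lock = true :: o.lock := by
  cases o <;> rfl

theorem isAcq_tag (o : LockOp Name) (m : Name) :
    isAcq (A := Name) (false :: m) (Sum.inr o.tag) = false := by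
  cases o <;> simp [LockOp.tag, isAcq]

theorem isRel_tag (o : LockOp Name) (m : Name) :
    isRel (A := Name) (false :: m) (Sum.inr o.tag) = false := by
  cases o <;> simp [LockOp.tag, isRel]

theorem countP_isAcq_preWord (pre : Option (List LockEdge)) (m : Name) :
    (preWord id pre).countP (isAcq (false :: m)) = 0 := by
  rw [List.countP_eq_zero]
  intro a ha
  rcases mem_preWord ha with ⟨b, rfl⟩ | ⟨o, rfl⟩
  · simp [isAcq]
  · simp [isAcq_tag]

theorem countP_isRel_preWord (pre : Option (List LockEdge)) (m : Name) :
    (preWord id pre).countP (isRel (false :: m)) = 0 := by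
  rw [List.countP_eq_zero]
  intro a ha
  rcases mem_preWord ha with ⟨b, rfl⟩ | ⟨o, rfl⟩
  · simp [isRel]
  · simp [isRel_tag]

theorem countP_isPoint_preWord (pre : Option (List LockEdge)) :
    ((preWord (Sum.inl : LockOp Name → LockOp Name ⊕ Unit) pre).filterMap keepSnd).countP
      isPoint = 0 := by
  rw [List.countP_eq_zero]
  intro a ha
  obtain ⟨c, hc, h⟩ := List.mem_filterMap.1 ha
  rcases mem_preWord hc with ⟨b, rfl⟩ | ⟨o, rfl⟩ <;> simp only [keepSnd] at h
  · cases h; simp [isPoint]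
  · cases h

/-! ### Coverable configurations -/

/-- If all gadgets are entered, then the lock discipline and the sync-point discipline are
incompatible: when the first thread passes the second sync-point, all the locks in the ring are
held. -/
theorem false_of_all_called {x : CoverInstance} {τ : Trace (Name ⊕ (LockOp Name ⊕ Unit))}
    (hlock : LockSync (proj keepFst τ)) (hsync : ∃ T, SyncFrom T (proj keepSnd τ)) (θ : ℕ → ℕ)
    (pre : ℕ → Option (List LockEdge))
    (h : ∀ k < x.C.length + 2,
      localTrace τ (θ k) = preWord Sum.inl (pre k) ++ sufWord x.C syncTail (some k)) : False := by
  obtain ⟨T, hsync⟩ := hsync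
  -- No caller gets beyond its second sync-point: the five letters are the call, two acquisitions
  -- and two sync-points.
  have key : ∀ ρ, ρ <+: τ → ∀ k < x.C.length + 2, (localTrace ρ (θ k)).length ≤
      (preWord (Sum.inl : LockOp Name → LockOp Name ⊕ Unit) (pre k)).length + 5 := by
    intro ρ
    induction ρ using List.reverseRecOn with
    | nil => simp
    | append_singleton ρ y ih =>
      intro hρ k hk
      obtain ⟨a, i⟩ := y
      have hρ' : ρ <+: τ := (List.prefix_append _ _).trans hρ
      have ih := ih hρ'
      have ihk := ih k hk
      rw [localTrace_append, localTrace_cons]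
      by_cases hi : i = θ k
      swap
      · simpa [hi] using ihk
      -- Otherwise the last letter is the first sixth gadget letter of any caller, the acquisition
      -- of the next ring lock.
      by_contra hlen
      simp only [hi, if_true, localTrace_nil, List.length_append, List.length_cons,
        List.length_nil] at hlen
      have hpre := localTrace_isPrefix hρ (θ k)
      rw [localTrace_append, localTrace_cons, if_pos hi, localTrace_nil, h k hk,
        List.prefix_iff_eq_take] at hpre
      have hlen' : (localTrace ρ (θ k) ++ [a]).length =
          (preWord (Sum.inl : LockOp Name → LockOp Name ⊕ Unit) (pre k)).length + 6 := by
        simp; omega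
      rw [hlen', List.take_length_add_append] at hpre
      have hsuf : (sufWord x.C syncTail (some k)).take 6 =
        [Sum.inl (callName k), Sum.inr (Sum.inl (.acq (onceLock k))),
          Sum.inr (Sum.inl (.acq (ringLock k))), Sum.inr (Sum.inr ()), Sum.inr (Sum.inr ())] ++
          [Sum.inr (Sum.inl (.acq (ringLock (ringNext x.C k))))] := rfl
      rw [hsuf, ← List.append_assoc] at hpre
      obtain ⟨hρk, ha⟩ := List.append_inj' hpre rfl
      simp only [List.cons.injEq, and_true] at ha
      subst ha hi
      have hk' := ringNext_lt hk
      set k' := ringNext x.C k with hk'_def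
      have hpts : points (proj keepSnd ρ) (θ k) = 2 := by
        rw [points, localTrace_proj, hρk, List.filterMap_append, List.countP_append,
          countP_isPoint_preWord]
        rfl
      have htot : points (proj keepSnd τ) (θ k') = 2 := by
        rw [points, localTrace_proj, h k' hk', List.filterMap_append, List.countP_append,
          countP_isPoint_preWord]
        rfl
      -- Thread `θ k` has passed two sync-points. So its neighbour either lags behind by at most one
      -- or has passed all of its own, which are two. A single sync-point in the gadget would not
      -- suffice here.
      have hge : 1 ≤ points (proj keepSnd ρ) (θ k') := by
        have := hsync.points_le (θ k') (θ k) _ (proj_isPrefix hρ' keepSnd)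
        omega
      have ihk' := ih k' hk'
      have hpre' := localTrace_isPrefix hρ' (θ k')
      rw [h k' hk', List.prefix_iff_eq_take] at hpre'
      set L := localTrace ρ (θ k') with hL
      -- The neighbour has passed a sync-point, so it has acquired its ring lock; by the induction
      -- hypothesis it has not gone past the second sync-point, so it has not released the lock.
      have hcount : ∃ r, L = preWord Sum.inl (pre k') ++
          [Sum.inl (callName k'), Sum.inr (Sum.inl (.acq (onceLock k'))),
          Sum.inr (Sum.inl (.acq (ringLock k')))] ++ List.replicate r (Sum.inr (Sum.inr ())) := by
        by_cases h4 : (preWord (Sum.inl : LockOp Name → LockOp Name ⊕ Unit) (pre k')).length + 3 <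
          L.length
        · obtain h5 | h5 : L.length = (preWord (Sum.inl : LockOp Name → LockOp Name ⊕ Unit)
              (pre k')).length + 4 ∨ L.length = (preWord (Sum.inl : LockOp Name →
              LockOp Name ⊕ Unit) (pre k')).length + 5 := by omega
          · rw [h5, List.take_length_add_append] at hpre'
            exact ⟨1, by rw [hpre', List.append_assoc]; rfl⟩
          · rw [h5, List.take_length_add_append] at hpre'
            exact ⟨2, by rw [hpre', List.append_assoc]; rfl⟩
        · exfalso
          have h6 : L <+: preWord Sum.inl (pre k') ++ (sufWord x.C syncTail (some k')).take 3 := by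
            rw [← List.take_length_add_append, hpre']
            exact List.take_prefix_take_left (by omega)
          have h7 : points (proj keepSnd ρ) (θ k') = 0 := by
            rw [points, localTrace_proj, ← hL]
            refine Nat.le_zero.1 (((h6.filterMap keepSnd).sublist.countP_le).trans ?_)
            rw [List.filterMap_append, List.countP_append, countP_isPoint_preWord]
            exact le_rfl
          omega
      obtain ⟨r, hr⟩ := hcount
      have hlock' := hlock.of_isPrefix (proj_isPrefix hρ keepFst)
      rw [proj_append] at hlock'
      -- The acquisition by `θ k` requires the neighbour's acquisitions and releases of `ringLock
      -- k'` to balance, but there is one acquisition and no release.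
      have hc := LockSync.count_eq (m := ringLock k') (j := θ k) hlock' (θ k')
      have hrep : ∀ r, (List.replicate r (Sum.inr (Sum.inr ()) : Name ⊕ (LockOp Name ⊕ Unit))).filterMap
          keepFst = [] := by
        intro r
        rw [List.filterMap_eq_nil_iff]
        intro b hb
        rw [List.eq_of_mem_replicate hb]
        rfl
      rw [localTrace_proj, ← hL, hr, List.filterMap_append, List.filterMap_append, hrep,
        preWord_keepFst, List.append_nil, List.countP_append, List.countP_append, ringLock,
        countP_isAcq_preWord, countP_isRel_preWord] at hc
      simp [keepFst, isAcq, isRel, onceLock] at hc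
  -- In the complete trace, the caller of gadget 0 performs all eight letters of the gadget, more
  -- than five.
  have := key τ List.prefix_rfl 0 (by omega)
  rw [h 0 (by omega)] at this
  simp [sufWord, gadgetTail, syncTail] at this

/-- A gadget executed without interruption returns both ring locks, which are different by
`ringNext_ne`; it retains only `onceLock k`. -/
theorem lockOk_gadget {C : List Name} (k i : ℕ) (m : Name) :
    LockOk m none (single i (sufWord C lockTail (some k))) ∧
    (m ≠ onceLock k → holder m none (single i (sufWord C lockTail (some k))) = none) := by
  have hne := (ringNext_ne C k).symm
  by_cases h1 : onceLock k = m
  · subst h1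
    simp [single, sufWord, gadgetTail, lockTail, LockOk, onceLock, ringLock]
  by_cases h2 : ringLock k = m
  · subst h2
    simp [single, sufWord, gadgetTail, lockTail, LockOk, holder, hne.symm, onceLock, ringLock]
  by_cases h3 : ringLock (ringNext C k) = m
  · simp [single, sufWord, gadgetTail, lockTail, LockOk, holder, h1, h2, h3]
  · simp [single, sufWord, gadgetTail, lockTail, LockOk, holder, h1, h2, h3]

/-- Executed one after another, different gadgets do not disturb each other: the only lock that
stays held belongs to the gadget just executed, and no other gadget uses it. -/
theorem lockOk_gadgets {C : List Name} (θ : ℕ → ℕ) (ks : List ℕ) (hks : ks.Nodup) (m : Name) :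
    LockOk m none (ks.flatMap fun k => single (θ k) (sufWord C lockTail (some k))) := by
  induction ks with
  | nil => trivial
  | cons k ks ih =>
    rw [List.nodup_cons] at hks
    rw [List.flatMap_cons, lockOk_append]
    refine ⟨(lockOk_gadget k (θ k) m).1, ?_⟩
    by_cases hm : m = onceLock k
    · subst hm
      refine (lockOk_of_untouched ?_ _).1
      rintro ⟨a, i⟩ ha
      obtain ⟨j, hj, ha⟩ := List.mem_flatMap.1 ha
      have hjk : j ≠ k := by rintro rfl; exact hks.1 hj
      simp only [single, List.mem_map, Prod.mk.injEq] at ha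
      obtain ⟨b, hb, rfl, -⟩ := ha
      simp only [sufWord, gadgetTail, lockTail, List.map_cons, List.map_nil, List.mem_cons,
        List.not_mem_nil, or_false] at hb
      have h1 : onceLock j ≠ onceLock k := by simpa using hjk
      rcases hb with rfl | rfl | rfl | rfl | rfl | rfl <;>
        first
        | rfl
        | exact decide_eq_false h1
    · rw [(lockOk_gadget k (θ k) m).2 hm]
      exact ih hks.2

theorem localTrace_gadgets {θ : ℕ → ℕ} {ks : List ℕ} (hks : ks.Nodup)
    (hθ : ∀ k ∈ ks, ∀ k' ∈ ks, θ k = θ k' → k = k') (w : ℕ → List (Name ⊕ LockOp Name)) :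
    (∀ k ∈ ks, localTrace (ks.flatMap fun k => single (θ k) (w k)) (θ k) = w k) ∧
    ∀ i, (∀ k ∈ ks, θ k ≠ i) → localTrace (ks.flatMap fun k => single (θ k) (w k)) i = [] := by
  have h2 : ∀ (ks : List ℕ) (i : ℕ), (∀ k ∈ ks, θ k ≠ i) →
      localTrace (ks.flatMap fun k => single (θ k) (w k)) i = [] := by
    intro ks i h
    induction ks with
    | nil => rfl
    | cons k ks ih =>
      rw [List.flatMap_cons, localTrace_append, localTrace_single, if_neg (h k (by simp)),
        ih fun j hj => h j (by simp [hj])]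
      rfl
  refine ⟨fun k hk => ?_, h2 ks⟩
  obtain ⟨k₁, k₂, rfl⟩ := List.append_of_mem hk
  rw [List.nodup_append, List.nodup_cons] at hks
  rw [List.flatMap_append, localTrace_append, List.flatMap_cons, localTrace_append,
    localTrace_single, if_pos rfl, h2 k₁, h2 k₂]
  · simp
  · intro j hj hjk
    have := hθ j (by simp [hj]) k (by simp) hjk
    subst this
    exact hks.2.1.1 hj
  · intro j hj hjk
    have := hθ j (by simp [hj]) k (by simp) hjk
    subst this
    exact hks.2.2 j hj j (by simp) rfl

theorem lockOk_backLabel {m : Name} {τ : Trace (Name ⊕ LockOp Name)} :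
    LockOk m none (proj backLabel τ) ↔ LockOk (true :: m) none τ := by
  refine lockOk_proj backLabel (true :: m) m rfl rfl ?_ none τ
  rintro (a | m' | m') b ha hb
  · rcases a with _ | ⟨_ | _, a⟩ <;> simp [backLabel] at hb
    subst hb
    rfl
  all_goals
    rcases m' with _ | ⟨_ | _, m'⟩ <;> simp [backLabel] at hb
    subst hb
    have : ¬ (true :: m' = true :: m) := of_decide_eq_false ha
    exact decide_eq_false fun h => this (congrArg (true :: ·) h)

/-- Covering a configuration gives an interleaving of the constructed program in which all gadgets
are entered. -/
theorem exists_all_called {x : CoverInstance} (hx : x.IsCoverable) :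
    ∃ (τ : Trace (Name ⊕ LockOp Name)) (θ : ℕ → ℕ) (pre : ℕ → Option (List LockEdge)),
      LockSync τ ∧ (∀ i, localTrace τ i ∈ (hatGraph x).traces ∪ {[]}) ∧
      ∀ k < x.C.length + 2, HatRun x (pre k) (some k) ∧
        localTrace τ (θ k) = preWord id (pre k) ++ sufWord x.C lockTail (some k) := by
  obtain ⟨τ, -, hsync, t, ht, hpath⟩ := hx
  choose es hes hmap using fun k => pathIn_iff_exists_edgePath.1 (hpath k)
  obtain ⟨N, hN⟩ : ∃ N, ∀ k, t k < N := by
    obtain ⟨N, hN⟩ := (Set.finite_range t).bddAbove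
    exact ⟨N + 1, fun k => Nat.lt_succ_of_le (hN ⟨k, rfl⟩)⟩
  -- The callers of the two additional gadgets are fresh threads beyond all covering threads.
  let θ : ℕ → ℕ := fun k => if h : k < x.C.length then t ⟨k, h⟩ else N + k
  let pre : ℕ → Option (List LockEdge) := fun k =>
    if h : k < x.C.length then some (es ⟨k, h⟩) else none
  have hθ : ∀ k k', θ k = θ k' → k = k' := by
    intro k k' h
    simp only [θ] at h
    split_ifs at h with h1 h2 h2
    · simpa using ht h
    · have := hN ⟨k, h1⟩; omega
    · have := hN ⟨k', h2⟩; omega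
    · omega
  have hrun : ∀ k < x.C.length + 2, HatRun x (pre k) (some k) := by
    intro k hk
    simp only [pre]
    split_ifs with h
    · exact .call _ k _ (List.getElem?_eq_getElem h) (hes ⟨k, h⟩)
    · exact .direct k (by omega) hk
  classical
  -- Only the covering threads are kept: nothing guarantees that the other local traces are labels
  -- of paths.
  let q : ℕ → Bool := fun i => decide (∃ k : Fin x.C.length, t k = i)
  let τ₀ := τ.filter fun y => q y.2
  let n := x.C.length + 2
  let w : ℕ → List (Name ⊕ LockOp Name) := fun i =>
    if h : ∃ k, k < n ∧ θ k = i then preWord id (pre h.choose) else []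
  have hwθ : ∀ k < n, w (θ k) = preWord id (pre k) := by
    intro k hk
    have h : ∃ k', k' < n ∧ θ k' = θ k := ⟨k, hk, rfl⟩
    have h2 : h.choose = k := hθ _ _ h.choose_spec.2
    simp only [w, dif_pos h, h2]
  have hwnil : ∀ i, (∀ k < n, θ k ≠ i) → w i = [] := by
    intro i hi
    simp only [w]
    rw [dif_neg]
    rintro ⟨k, hk, h⟩
    exact hi k hk h
  have hlocal : ∀ i, localTrace τ₀ i = if q i then localTrace τ i else [] := by
    intro i
    simp only [τ₀, localTrace, List.filter_filter]
    by_cases hq : q i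
    · rw [if_pos hq]
      congr 2
      funext y
      by_cases hy : y.2 = i <;> simp [hy, hq]
    · rw [if_neg hq, List.map_eq_nil_iff, List.filter_eq_nil_iff]
      intro y _ hy
      simp only [Bool.and_eq_true, decide_eq_true_eq] at hy
      exact hq (hy.1 ▸ hy.2)
  obtain ⟨τ₁, hτ₁, hloc₁⟩ := exists_lift backLabel ((Finset.range n).image θ) τ₀ w
    (fun i hi => hwnil i fun k hk h => hi (Finset.mem_image.2 ⟨k, Finset.mem_range.2 hk, h⟩))
    (fun i => by
      rw [hlocal]
      by_cases hi : ∃ k, k < n ∧ θ k = i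
      · obtain ⟨k, hk, rfl⟩ := hi
        rw [hwθ k hk]
        by_cases hkC : k < x.C.length
        · have hq : q (t ⟨k, hkC⟩) = true := decide_eq_true ⟨_, rfl⟩
          simp only [pre, θ, hkC, dif_pos, preWord_back, hmap, hq, if_true]
        · have hq : q (N + k) = false := by
            refine decide_eq_false ?_
            rintro ⟨k', hk'⟩
            have := hN k'
            omega
          simp [pre, θ, hkC, preWord, hq]
      · have hq : q i = false := by
          refine decide_eq_false ?_
          rintro ⟨k, rfl⟩
          refine hi ⟨k, by omega, ?_⟩
          simp [θ]
        rw [hwnil i (by simpa using hi), hq]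
        rfl)
  let σ := (List.range n).flatMap fun k => single (θ k) (sufWord x.C lockTail (some k))
  obtain ⟨hσ, hσ'⟩ := localTrace_gadgets (θ := θ) (ks := List.range n)
    List.nodup_range (fun k _ k' _ h => hθ k k' h) fun k => sufWord x.C lockTail (some k)
  have hfin : ∀ k < n, localTrace (τ₁ ++ σ) (θ k) =
      preWord id (pre k) ++ sufWord x.C lockTail (some k) := fun k hk => by
    rw [localTrace_append, hloc₁, hwθ k hk, hσ k (List.mem_range.2 hk)]
  refine ⟨τ₁ ++ σ, θ, pre, ?_, fun i => ?_, fun k hk => ⟨hrun k hk, hfin k hk⟩⟩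
  · rw [lockSync_iff]
    intro m
    -- The first part uses given locks only and the second part new locks only, so each lock is
    -- affected by at most one of them.
    have hτ₁m : LockOk m none τ₁ ∧ (holder m none τ₁ = none ∨
        ∀ y ∈ σ, actsOn m y.1 = false) := by
      by_cases hm : ∃ m', m = true :: m'
      · obtain ⟨m', rfl⟩ := hm
        refine ⟨?_, Or.inr ?_⟩
        · rw [← lockOk_backLabel, hτ₁]
          exact lockOk_filter_threads m' q none τ (lockSync_iff.1 hsync m')
        · rintro ⟨a, i⟩ ha
          obtain ⟨j, hj, ha⟩ := List.mem_flatMap.1 ha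
          simp only [single, List.mem_map, Prod.mk.injEq] at ha
          obtain ⟨b, hb, rfl, -⟩ := ha
          simp only [sufWord, gadgetTail, lockTail, List.map_cons, List.map_nil, List.mem_cons,
            List.not_mem_nil, or_false] at hb
          rcases hb with rfl | rfl | rfl | rfl | rfl | rfl <;> rfl
      · have := lockOk_of_untouched (m := m) (τ := τ₁) (fun y hy => by
          have h1 := mem_localTrace.2 (show (y.1, y.2) ∈ τ₁ from hy)
          rw [hloc₁] at h1
          simp only [w] at h1
          split_ifs at h1 with h2
          · rcases mem_preWord h1 with ⟨b, hb⟩ | ⟨o, ho⟩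
            · rw [hb]; rfl
            · rw [ho]
              refine decide_eq_false ?_
              intro h3
              exact hm ⟨o.lock, by rw [← h3]; exact o.lock_tag⟩
          · simp at h1) none
        exact ⟨this.1, Or.inl this.2⟩
    refine (lockOk_append m none τ₁ σ).2 ⟨hτ₁m.1, ?_⟩
    rcases hτ₁m.2 with h | h
    · rw [h]
      exact lockOk_gadgets θ _ List.nodup_range m
    · exact (lockOk_of_untouched h _).1
  · by_cases hi : ∃ k, k < n ∧ θ k = i
    · obtain ⟨k, hk, rfl⟩ := hi
      rw [hfin k hk]
      exact Or.inl (mem_hatCFG_traces.2 ⟨_, _, hrun k hk, rfl⟩)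
    · right
      rw [localTrace_append, hloc₁, hwnil i (by simpa using hi),
        hσ' i fun k hk h => hi ⟨k, List.mem_range.1 hk, h⟩]
      rfl

/-- A covering interleaving has the same ordinary actions in each thread. These determine the
instrumented local traces, so all gadgets are entered with their sync-points, which is impossible.
-/
theorem not_sound_of_coverable {x : CoverInstance} (hx : x.IsCoverable) (I : Set (Name × Name)) :
    ¬ SoundInstrumentation (lockProgram (hatGraph x)) (hatGraph' x) I := by
  rintro ⟨-, hsound⟩
  obtain ⟨τ, θ, pre, hsync, htr, hall⟩ := exists_all_called hx
  obtain ⟨_, ⟨τ', rfl, ⟨hlock', hsync'⟩, htr'⟩, hcov⟩ :=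
    hsound (proj keepAct τ) ⟨τ, rfl, hsync, htr⟩
  refine false_of_all_called (x := x) hlock' hsync' θ pre fun k hk => ?_
  obtain ⟨hrun, hloc⟩ := hall k hk
  have h1 := hcov.localTrace_eq (θ k)
  rw [localTrace_proj, localTrace_proj, hloc] at h1
  have h3 : (preWord id (pre k) ++ sufWord x.C lockTail (some k)).filterMap keepAct =
      (preWord (Sum.inl : LockOp Name → LockOp Name ⊕ Unit) (pre k) ++
        sufWord x.C syncTail (some k)).filterMap keepAct := by
    rw [← preWord_keepFst, ← sufWord_keepFst, ← List.filterMap_append, List.filterMap_filterMap]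
    congr 1
    funext a
    rcases a with a | a | a <;> rfl
  rcases htr' (θ k) with h2 | h2
  · exact hatCFG_traces_eq (x := x) (ι := Sum.inl) (W := syncTail) h2
      (mem_hatCFG_traces.2 ⟨_, _, hrun, rfl⟩) (h1.symm.trans h3)
  · rw [Set.mem_singleton_iff.1 h2, List.filterMap_append] at h1
    simp [sufWord, keepAct] at h1

end LockPrograms

/-! ### An uncoverable configuration makes the instrumentation sound. -/

open Turing

namespace LockPrograms

/-! ### Uncoverable configurations -/

/-- Thread `i` enters the `k`-th gadget. -/
def Caller (x : CoverInstance) (τ : Trace (Name ⊕ LockOp Name)) (k i : ℕ) : Prop :=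
  ∃ pre, HatRun x pre (some k) ∧
    localTrace τ i = preWord id pre ++ sufWord x.C lockTail (some k)

theorem Caller.index_unique {x : CoverInstance} {τ : Trace (Name ⊕ LockOp Name)} {k k' i : ℕ}
    (h : Caller x τ k i) (h' : Caller x τ k' i) : k = k' := by
  obtain ⟨pre, -, h⟩ := h
  obtain ⟨pre', -, h'⟩ := h'
  have := (List.append_inj' (h.symm.trans h') rfl).2
  simp only [sufWord, List.cons.injEq, Sum.inl.injEq, callName_inj] at this
  exact this.1

theorem not_rel_onceLock {x : CoverInstance} {τ : Trace (Name ⊕ LockOp Name)}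
    (htr : ∀ i, localTrace τ i ∈ (hatGraph x).traces ∪ {[]}) (k i : ℕ) :
    Sum.inr (LockOp.rel (onceLock k)) ∉ localTrace τ i := by
  intro h
  rcases htr i with h2 | h2
  · obtain ⟨pre, suf, -, h3⟩ := mem_hatCFG_traces.1 h2
    rw [h3, List.mem_append] at h
    rcases h with h | h
    · rcases mem_preWord h with ⟨b, hb⟩ | ⟨o, ho⟩
      · cases hb
      · cases o <;> simp [LockOp.tag, onceLock] at ho
    · cases suf with
      | none => simp [sufWord] at h
      | some j => simp [sufWord, gadgetTail, lockTail, onceLock, ringLock] at h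
  · rw [Set.mem_singleton_iff.1 h2] at h
    simp at h

/-- Every caller acquires `onceLock k`, and no thread ever releases it. -/
theorem Caller.thread_unique {x : CoverInstance} {τ : Trace (Name ⊕ LockOp Name)}
    (hsync : LockSync τ) (htr : ∀ i, localTrace τ i ∈ (hatGraph x).traces ∪ {[]}) {k i i' : ℕ}
    (h : Caller x τ k i) (h' : Caller x τ k i') : i = i' := by
  have key : ∀ i, Caller x τ k i → Sum.inr (LockOp.acq (onceLock k)) ∈ localTrace τ i := by
    rintro i ⟨pre, -, h⟩
    rw [h]
    simp [sufWord, gadgetTail, lockTail]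
  exact hsync.eq_of_not_rel (not_rel_onceLock htr k) (key i h) (key i' h')

/-- If the gadgets of all locations of the configuration are entered, then the configuration is
coverable. -/
theorem coverable_of_callers {x : CoverInstance} {τ : Trace (Name ⊕ LockOp Name)}
    (hsync : LockSync τ) (htr : ∀ i, localTrace τ i ∈ (hatGraph x).traces ∪ {[]})
    (h : ∀ k < x.C.length, ∃ i, Caller x τ k i) : x.IsCoverable := by
  choose t ht using fun k : Fin x.C.length => h k.1 k.2
  refine ⟨proj backLabel τ, ?_, ?_, t, ?_, ?_⟩
  · rintro ⟨a, i⟩ ha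
    have h1 := mem_localTrace.2 ha
    rw [localTrace_proj] at h1
    rcases htr i with h2 | h2
    · obtain ⟨pre, suf, hrun, h3⟩ := mem_hatCFG_traces.1 h2
      rw [h3, List.filterMap_append, sufWord_back, List.append_nil] at h1
      have hes : ∀ es ℓ ℓ', EdgePath x.G.locs x.G.edges ℓ es ℓ' → ∀ e ∈ es, e ∈ x.G.edges := by
        intro es ℓ ℓ' hp
        induction hp with
        | nil => simp
        | cons e es ℓ he _ ih => simpa [he] using ih
      have key : ∀ es ℓ, EdgePath x.G.locs x.G.edges x.G.init es ℓ →
          a ∈ (preWord id (some es)).filterMap backLabel → a ∈ x.G.alphabet := by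
        intro es ℓ hp ha
        rw [preWord_back] at ha
        obtain ⟨e, he, rfl⟩ := List.mem_map.1 ha
        exact ⟨e, hes es _ _ hp e he, rfl⟩
      cases hrun with
      | halt es hp => exact Or.inl (key es _ hp h1)
      | direct k _ _ => simp [preWord] at h1
      | call es k ℓ _ hp => exact Or.inl (key es _ hp h1)
    · rw [Set.mem_singleton_iff.1 h2] at h1
      simp at h1
  · exact lockSync_iff.2 fun m => lockOk_backLabel.2 (lockSync_iff.1 hsync _)
  -- A thread enters only one gadget, so different positions of the configuration have different
  -- threads, even if they carry the same location.
  · intro k k' hkk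
    have h1 := ht k
    rw [hkk] at h1
    exact Fin.ext (h1.index_unique (ht k'))
  · intro k
    obtain ⟨pre, hrun, hloc⟩ := ht k
    rw [localTrace_proj, hloc, List.filterMap_append, sufWord_back, List.append_nil]
    cases hrun with
    | direct _ h1 _ => exact absurd k.2 (not_lt.2 h1)
    | call es _ ℓ hℓ hp =>
      rw [preWord_back]
      have : x.C.get k = ℓ := by
        rw [List.getElem?_eq_getElem k.2] at hℓ
        simpa using hℓ
      rw [this]
      exact pathIn_iff_exists_edgePath.2 ⟨es, hp, rfl⟩

/-- The gadgets can be entered one after another. -/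
theorem exists_acquire (Q : Finset ℕ) (θ : ℕ → ℕ) (hθ : Set.InjOn θ Q) :
    ∃ σ : Trace (Name ⊕ LockOp Name),
      (∀ k ∈ Q, localTrace σ (θ k) =
        [Sum.inr (.acq (onceLock k)), Sum.inr (.acq (ringLock k))]) ∧
      (∀ i, (∀ k ∈ Q, θ k ≠ i) → localTrace σ i = []) ∧
      (∀ y ∈ σ, ∃ k ∈ Q, y.1 = Sum.inr (.acq (onceLock k)) ∨
        y.1 = Sum.inr (.acq (ringLock k))) ∧
      (∀ m, LockOk m none σ) ∧
      ∀ k, holder (ringLock k) none σ = if k ∈ Q then some (θ k) else none := by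
  induction Q using Finset.induction_on with
  | empty => exact ⟨[], by simp, fun _ _ => rfl, by simp, fun _ => trivial, fun _ => rfl⟩
  | insert a Q ha ih =>
    obtain ⟨σ, h1, h2, h3, h4, h5⟩ := ih (hθ.mono (by simp))
    have hne : ∀ k ∈ Q, θ k ≠ θ a := fun k hk h => by
      have : k = a := hθ (by simp [hk]) (by simp) h
      exact ha (this ▸ hk)
    have hun : ∀ m, m = onceLock a ∨ m = ringLock a → ∀ y ∈ σ, actsOn m y.1 = false := by
      rintro m hm y hy
      obtain ⟨k, hk, hy⟩ := h3 y hy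
      have hka : k ≠ a := by rintro rfl; exact ha hk
      rcases hy with hy | hy <;> rw [hy] <;> refine decide_eq_false ?_ <;>
        rcases hm with rfl | rfl <;> simp only [LockOp.lock, onceLock_inj, ringLock_inj] <;>
        first
        | exact hka
        | simp [onceLock, ringLock]
    have hor : onceLock a ≠ ringLock a := by simp [onceLock, ringLock]
    have hblock : ∀ m, LockOk m none (single (θ a)
        [(Sum.inr (.acq (onceLock a)) : Name ⊕ LockOp Name), Sum.inr (.acq (ringLock a))]) ∧
        holder m none (single (θ a)
          [(Sum.inr (.acq (onceLock a)) : Name ⊕ LockOp Name), Sum.inr (.acq (ringLock a))]) =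
          if m = onceLock a ∨ m = ringLock a then some (θ a) else none := by
      intro m
      by_cases hm1 : onceLock a = m
      · subst hm1
        simp [single, LockOk, holder, hor.symm]
      by_cases hm2 : ringLock a = m
      · subst hm2
        simp [single, LockOk, holder, hm1]
      · simp [single, LockOk, holder, hm1, hm2, Ne.symm hm1, Ne.symm hm2]
    refine ⟨single (θ a) [Sum.inr (.acq (onceLock a)), Sum.inr (.acq (ringLock a))] ++ σ,
      fun k hk => ?_, fun i hi => ?_, fun y hy => ?_, fun m => ?_, fun k => ?_⟩
    · rw [localTrace_append, localTrace_single]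
      rcases Finset.mem_insert.1 hk with rfl | hk
      · rw [if_pos rfl, h2 _ hne, List.append_nil]
      · rw [if_neg (Ne.symm (hne k hk)), h1 k hk]
        rfl
    · rw [localTrace_append, localTrace_single, if_neg (hi a (by simp)),
        h2 i fun k hk => hi k (by simp [hk])]
      rfl
    · rcases List.mem_append.1 hy with hy | hy
      · refine ⟨a, by simp, ?_⟩
        simp only [single, List.map_cons, List.map_nil, List.mem_cons, List.not_mem_nil,
          or_false] at hy
        rcases hy with rfl | rfl
        · exact Or.inl rfl
        · exact Or.inr rfl
      · obtain ⟨k, hk, h⟩ := h3 y hy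
        exact ⟨k, by simp [hk], h⟩
    · rw [lockOk_append, (hblock m).2]
      refine ⟨(hblock m).1, ?_⟩
      split_ifs with hm
      · exact (lockOk_of_untouched (hun m hm) _).1
      · exact h4 m
    · rw [holder_append, (hblock _).2]
      by_cases hk : k = a
      · subst hk
        simp only [or_true, if_true, Finset.mem_insert, true_or]
        exact (lockOk_of_untouched (hun _ (Or.inr rfl)) _).2
      · have h6 : ¬ (ringLock k = onceLock a ∨ ringLock k = ringLock a) := by
          rintro (h | h)
          · simp [onceLock, ringLock] at h
          · exact hk (ringLock_inj.1 h)
        rw [if_neg h6, h5]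
        simp [hk]

/-- In a nonempty proper subset of a ring, some element is not followed by an element of the
subset. -/
theorem exists_ringNext_not_mem {C : List Name} {Q : Finset ℕ} (hQ : Q ⊂ Finset.range (C.length + 2))
    (hne : Q.Nonempty) : ∃ k ∈ Q, ringNext C k ∉ Q := by
  by_contra! h
  obtain ⟨k₀, hk₀⟩ := hne
  have hlt : k₀ < C.length + 2 := Finset.mem_range.1 (hQ.1 hk₀)
  -- A set closed under successors contains everything from `k₀` up to the last index, then 0 by
  -- wrapping around, and then the whole ring.
  have hup : ∀ k ∈ Q, ∀ d, k + d < C.length + 2 → k + d ∈ Q := by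
    intro k hk d
    induction d with
    | zero => intro _; exact hk
    | succ d ih =>
      intro hd
      have h1 := h _ (ih (by omega))
      rwa [ringNext, if_neg (by omega)] at h1
  have hlast : C.length + 1 ∈ Q := by
    have := hup k₀ hk₀ (C.length + 1 - k₀) (by omega)
    rwa [Nat.add_sub_cancel' (by omega)] at this
  have hzero : 0 ∈ Q := by
    have := h _ hlast
    rwa [ringNext, if_pos rfl] at this
  refine hQ.2 fun k hk => ?_
  have := hup 0 hzero k (by simpa using hk)
  rwa [zero_add] at this

/-- If a thread is missing in the ring, then the gadgets can be left one after another. -/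
theorem exists_finish (C : List Name) (θ : ℕ → ℕ) (Q : Finset ℕ)
    (hQ : Q ⊂ Finset.range (C.length + 2)) (hθ : Set.InjOn θ Q) :
    ∃ σ : Trace (Name ⊕ LockOp Name),
      (∀ k ∈ Q, localTrace σ (θ k) = [Sum.inr (.acq (ringLock (ringNext C k))),
        Sum.inr (.rel (ringLock (ringNext C k))), Sum.inr (.rel (ringLock k))]) ∧
      (∀ i, (∀ k ∈ Q, θ k ≠ i) → localTrace σ i = []) ∧
      (∀ y ∈ σ, ∃ k, y.1 = Sum.inr (.acq (ringLock k)) ∨ y.1 = Sum.inr (.rel (ringLock k))) ∧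
      ∀ h : Name → Option ℕ, (∀ k, h (ringLock k) = if k ∈ Q then some (θ k) else none) →
        ∀ m, LockOk m (h m) σ := by
  induction Q using Finset.strongInduction with
  | H Q ih =>
    rcases Q.eq_empty_or_nonempty with rfl | hne
    · exact ⟨[], by simp, fun _ _ => rfl, by simp, fun _ _ _ => trivial⟩
    -- The next ring lock of `a` is free because its gadget is not in `Q`. So `a` can finish and
    -- release its own ring lock, which leaves the same situation for `Q.erase a`.
    obtain ⟨a, ha, ha'⟩ := exists_ringNext_not_mem hQ hne
    set b := ringNext C a with hb
    have hba : b ≠ a := ringNext_ne C a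
    obtain ⟨σ, h1, h2, h3, h4⟩ := ih (Q.erase a) (Finset.erase_ssubset ha)
      ((Finset.erase_ssubset ha).trans hQ) (hθ.mono (by simp))
    have hne : ∀ k ∈ Q.erase a, θ k ≠ θ a := fun k hk h =>
      Finset.ne_of_mem_erase hk (hθ (Finset.mem_of_mem_erase hk) ha h)
    refine ⟨single (θ a) [Sum.inr (.acq (ringLock b)), Sum.inr (.rel (ringLock b)),
      Sum.inr (.rel (ringLock a))] ++ σ,
      fun k hk => ?_, fun i hi => ?_, fun y hy => ?_, fun h hh m => ?_⟩
    · rw [localTrace_append, localTrace_single]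
      by_cases hka : k = a
      · subst hka
        rw [if_pos rfl, h2 _ hne, List.append_nil]
      · have hk' : k ∈ Q.erase a := Finset.mem_erase.2 ⟨hka, hk⟩
        rw [if_neg (Ne.symm (hne k hk')), h1 k hk']
        rfl
    · rw [localTrace_append, localTrace_single, if_neg (hi a ha),
        h2 i fun k hk => hi k (Finset.mem_of_mem_erase hk)]
      rfl
    · rcases List.mem_append.1 hy with hy | hy
      · simp only [single, List.map_cons, List.map_nil, List.mem_cons, List.not_mem_nil,
          or_false] at hy
        rcases hy with rfl | rfl | rfl
        · exact ⟨b, Or.inl rfl⟩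
        · exact ⟨b, Or.inr rfl⟩
        · exact ⟨a, Or.inr rfl⟩
      · exact h3 y hy
    -- After the block of `a`, the state is `h` with `ringLock a` freed; the ring locks are then
    -- held exactly by the callers of `Q.erase a`.
    · have h5 := h4 (Function.update h (ringLock a) none) (fun k => by
        by_cases hka : k = a
        · subst hka; simp
        · rw [Function.update_of_ne (by simpa using hka), hh]
          simp [hka]) m
      have hha : h (ringLock a) = some (θ a) := by rw [hh, if_pos ha]
      have hhb : h (ringLock b) = none := by rw [hh, if_neg ha']
      have hab : ringLock b ≠ ringLock a := by simpa using hba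
      rw [lockOk_append]
      by_cases hm1 : m = ringLock b
      · subst hm1
        rw [Function.update_of_ne hab] at h5
        simp only [single, List.map_cons, List.map_nil, LockOk, holder, hhb, if_true,
          hab.symm, if_false, and_self, true_and] at h5 ⊢
        exact h5
      · by_cases hm2 : m = ringLock a
        · subst hm2
          rw [Function.update_self] at h5
          simp only [single, List.map_cons, List.map_nil, LockOk, holder, hha, if_true,
            hab, if_false, and_self, true_and] at h5 ⊢
          exact h5
        · rw [Function.update_of_ne hm2] at h5
          simp only [single, List.map_cons, List.map_nil, LockOk, holder, Ne.symm hm1,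
            Ne.symm hm2, if_false, true_and] at h5 ⊢
          exact h5

theorem localTrace_const {X : Type} (a : X) (l : List ℕ) (i : ℕ) :
    localTrace (l.map fun i => (a, i)) i = List.replicate (l.count i) a := by
  induction l with
  | nil => rfl
  | cons j l ih =>
    rw [List.map_cons, localTrace_cons, ih]
    by_cases h : j = i
    · subst h
      rw [if_pos rfl, List.count_cons_self, List.replicate_succ]
    · rw [if_neg h, List.count_cons_of_ne h]

/-- The embedding of labels into those with sync-points. -/
def embLabel : Name ⊕ LockOp Name → Name ⊕ (LockOp Name ⊕ Unit)
  | Sum.inl a => Sum.inl a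
  | Sum.inr o => Sum.inr (Sum.inl o)

theorem proj_keepFst_emb (σ : Trace (Name ⊕ LockOp Name)) :
    proj keepFst (proj (fun a => some (embLabel a)) σ) = σ := by
  rw [proj_proj]
  induction σ with
  | nil => rfl
  | cons y σ ih =>
    obtain ⟨a | o, i⟩ := y <;> rw [proj_cons, ih] <;> rfl

theorem lockOk_keepFst_keepOrig {τ : Trace (Name ⊕ LockOp Name)} (m : Name) :
    LockOk (true :: m) none (proj keepFst (proj keepOrig τ)) ↔ LockOk (true :: m) none τ := by
  rw [proj_proj]
  refine lockOk_proj (fun a => (keepOrig a).bind keepFst) (true :: m) (true :: m) rfl rfl ?_ none τ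
  rintro (a | m' | m') b ha hb
  · simp only [keepOrig, keepFst, Option.bind_some, Option.some.injEq] at hb
    rw [← hb]
    rfl
  all_goals
    rcases m' with _ | ⟨_ | _, m'⟩ <;> simp [keepOrig, keepFst] at hb
    rw [← hb]
    exact ha

/-- Words that perform operations on new locks only. -/
theorem actsOn_true_eq_false {σ : Trace (Name ⊕ LockOp Name)}
    (h : ∀ y ∈ σ, ∃ o m, y.1 = Sum.inr o ∧ o.lock = false :: m) (m : Name) :
    ∀ y ∈ σ, actsOn (true :: m) y.1 = false := by
  intro y hy
  obtain ⟨o, m', h1, h2⟩ := h y hy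
  rw [h1]
  exact decide_eq_false (by rw [h2]; simp)

theorem untouched_of_keepOrig (τ : Trace (Name ⊕ LockOp Name)) {m : Name}
    (hm : ¬ ∃ m', m = true :: m') :
    ∀ y ∈ proj keepFst (proj keepOrig τ), actsOn m y.1 = false := by
  rw [proj_proj]
  intro y hy
  rw [proj, List.mem_filterMap] at hy
  obtain ⟨⟨a, i⟩, -, h⟩ := hy
  rcases a with a | m' | m'
  · simp only [keepOrig, keepFst, Option.bind_some, Option.map_some, Option.some.injEq] at h
    rw [← h]
    rfl
  all_goals
    rcases m' with _ | ⟨_ | _, m'⟩ <;> simp [keepOrig, keepFst] at h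
    rw [← h]
    refine decide_eq_false ?_
    rintro rfl
    exact hm ⟨m', rfl⟩

theorem proj_emb_eq_nil {Y : Type} {p : Name ⊕ (LockOp Name ⊕ Unit) → Option Y}
    (hp : ∀ o, p (Sum.inr (Sum.inl o)) = none) {σ : Trace (Name ⊕ LockOp Name)}
    (h : ∀ y ∈ σ, ∃ o, y.1 = Sum.inr o) : proj p (proj (fun a => some (embLabel a)) σ) = [] := by
  rw [proj_proj]
  refine proj_eq_nil fun y hy => ?_
  obtain ⟨o, ho⟩ := h y hy
  rw [ho]
  exact hp o

theorem proj_const_none {X Y : Type} {p : X → Option Y} {a : X} (h : p a = none) (l : List ℕ) :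
    proj p (l.map fun i => (a, i)) = [] :=
  proj_eq_nil fun y hy => by
    obtain ⟨i, -, rfl⟩ := List.mem_map.1 hy
    exact h

theorem proj_const_some {X Y : Type} {p : X → Option Y} {a : X} {b : Y} (h : p a = some b)
    (l : List ℕ) : proj p (l.map fun i => (a, i)) = l.map fun i => (b, i) := by
  induction l with
  | nil => rfl
  | cons i l ih => rw [List.map_cons, proj_cons, ih, h]; rfl

/-- If one of the gadgets is not entered, then sync-points can be inserted. -/
theorem mem_interleavings_of_not_caller {x : CoverInstance} {τ : Trace (Name ⊕ LockOp Name)}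
    (hsync : LockSync τ) (htr : ∀ i, localTrace τ i ∈ (hatGraph x).traces ∪ {[]})
    (h : ∃ k < x.C.length + 2, ∀ i, ¬ Caller x τ k i) :
    proj keepAct τ ∈ ((lockProgram (hatGraph x)).withSyncPoints (hatGraph' x)).interleavings := by
  classical
  let Q : Finset ℕ := (Finset.range (x.C.length + 2)).filter fun k => ∃ i, Caller x τ k i
  have hQ : Q ⊂ Finset.range (x.C.length + 2) := by
    refine (Finset.ssubset_iff_of_subset (Finset.filter_subset _ _)).2 ?_
    obtain ⟨k, hk, hk'⟩ := h
    refine ⟨k, Finset.mem_range.2 hk, fun hkQ => ?_⟩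
    obtain ⟨i, hi⟩ := (Finset.mem_filter.1 hkQ).2
    exact hk' i hi
  let θ : ℕ → ℕ := fun k => if h : ∃ i, Caller x τ k i then h.choose else 0
  have hcall : ∀ k ∈ Q, Caller x τ k (θ k) := by
    intro k hk
    have h := (Finset.mem_filter.1 hk).2
    simp only [θ, dif_pos h]
    exact h.choose_spec
  have hθ : Set.InjOn θ Q := by
    intro k hk k' hk' hkk
    have h1 := hcall k hk
    rw [hkk] at h1
    exact h1.index_unique (hcall k' hk')
  obtain ⟨σ₁, a1, a2, a3, a4, a5⟩ := exists_acquire Q θ hθ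
  obtain ⟨σ₂, b1, b2, b3, b4⟩ := exists_finish x.C θ Q hQ hθ
  have a3' : ∀ y ∈ σ₁, ∃ o m, y.1 = Sum.inr o ∧ o.lock = false :: m := by
    intro y hy
    obtain ⟨k, -, h | h⟩ := a3 y hy
    · exact ⟨_, _, h, rfl⟩
    · exact ⟨_, _, h, rfl⟩
  have b3' : ∀ y ∈ σ₂, ∃ o m, y.1 = Sum.inr o ∧ o.lock = false :: m := by
    intro y hy
    obtain ⟨k, h | h⟩ := b3 y hy
    · exact ⟨_, _, h, rfl⟩
    · exact ⟨_, _, h, rfl⟩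
  have a3'' : ∀ y ∈ σ₁, ∃ o, y.1 = Sum.inr o := fun y hy => by
    obtain ⟨o, _, h, _⟩ := a3' y hy
    exact ⟨o, h⟩
  have b3'' : ∀ y ∈ σ₂, ∃ o, y.1 = Sum.inr o := fun y hy => by
    obtain ⟨o, _, h, _⟩ := b3' y hy
    exact ⟨o, h⟩
  let l : List ℕ := (Q.image θ).toList
  let bar : Trace (Name ⊕ (LockOp Name ⊕ Unit)) := l.map fun i => (Sum.inr (Sum.inr ()), i)
  let emb : Trace (Name ⊕ LockOp Name) → Trace (Name ⊕ (LockOp Name ⊕ Unit)) :=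
    proj fun a => some (embLabel a)
  -- The postponed letters are lock operations and sync-points, so the projection to ordinary
  -- actions is that of `τ`. This leaves the projection, both disciplines and the local traces to
  -- check.
  refine ⟨proj keepOrig τ ++ (emb σ₁ ++ (bar ++ (bar ++ emb σ₂))), ?_, ⟨?_, ?_⟩, fun i => ?_⟩
  · simp only [proj_append, emb, bar]
    rw [proj_emb_eq_nil (fun _ => rfl) a3'', proj_emb_eq_nil (fun _ => rfl) b3'',
      proj_const_none rfl, proj_proj]
    simp only [List.append_nil]
    congr 1
    funext a
    rcases a with a | m | m
    · rfl
    all_goals rcases m with _ | ⟨_ | _, m⟩ <;> rfl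
  · refine lockSync_iff.2 fun m => ?_
    simp only [proj_append, emb, bar]
    rw [proj_keepFst_emb, proj_keepFst_emb, proj_const_none rfl, List.nil_append, List.nil_append]
    by_cases hm : ∃ m', m = true :: m'
    · obtain ⟨m', rfl⟩ := hm
      have h1 := fun h => lockOk_of_untouched (actsOn_true_eq_false a3' m') h
      have h2 := fun h => lockOk_of_untouched (actsOn_true_eq_false b3' m') h
      rw [lockOk_append, lockOk_append]
      exact ⟨(lockOk_keepFst_keepOrig m').2 (lockSync_iff.1 hsync _), (h1 _).1, (h2 _).1⟩
    · have h0 := lockOk_of_untouched (untouched_of_keepOrig τ hm) none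
      rw [lockOk_append, h0.2, lockOk_append]
      exact ⟨h0.1, a4 m, b4 (fun m => holder m none σ₁) a5 m⟩
  · simp only [proj_append, emb, bar]
    rw [proj_emb_eq_nil (fun _ => rfl) a3'', proj_emb_eq_nil (fun _ => rfl) b3'',
      proj_const_some (p := keepSnd) (b := (Sum.inr () : Name ⊕ Unit)) rfl, proj_proj, List.nil_append,
      List.append_nil]
    obtain ⟨N, hN⟩ := Finset.exists_nat_subset_range
      ((τ.map Prod.snd).toFinset ∪ Q.image θ)
    -- In the first phase all threads run and perform ordinary actions only. The spare thread `N`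
    -- makes the set of callers strictly smaller; then the callers alone pass the two barriers and
    -- terminate.
    refine ⟨Finset.range (N + 1), .step _ (Q.image θ) _ _ (phase_of_acts ?_) ?_ ?_⟩
    · rintro ⟨a, i⟩ hy
      rw [proj, List.mem_filterMap] at hy
      obtain ⟨⟨c, j⟩, hc, hy⟩ := hy
      simp only [Option.map_eq_some_iff, Prod.mk.injEq] at hy
      obtain ⟨b, hb, rfl, rfl⟩ := hy
      constructor
      · rcases c with c | m | m
        · exact ⟨c, (Option.some.inj hb).symm⟩
        all_goals rcases m with _ | ⟨_ | _, m⟩ <;> simp [keepOrig, keepSnd] at hb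
      · have hj : j ∈ (τ.map Prod.snd).toFinset ∪ Q.image θ :=
          Finset.mem_union_left _ (List.mem_toFinset.2 (List.mem_map.2 ⟨_, hc, rfl⟩))
        have := Finset.mem_range.1 (hN hj)
        exact Finset.mem_range.2 (by omega)
    · refine (Finset.ssubset_iff_of_subset fun i hi => ?_).2
        ⟨N, Finset.mem_range.2 (by omega), fun hi => ?_⟩
      · have := Finset.mem_range.1 (hN (Finset.mem_union_right _ hi))
        exact Finset.mem_range.2 (by omega)
      · have := Finset.mem_range.1 (hN (Finset.mem_union_right _ hi))
        omega
    -- Without callers both barriers are empty words; the case is separate because a step of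
    -- `SyncFrom` must strictly shrink the set of threads.
    · rcases (Q.image θ).eq_empty_or_nonempty with hE | hE
      · have hl : l = [] := by simp only [l, hE, Finset.toList_empty]
        rw [hl, hE]
        exact .done
      · have hb := fun τ (hτ : Phase (A := Name) (Q.image θ) τ) =>
          Phase.barrier l τ (Finset.nodup_toList _) (Finset.toList_toFinset _) hτ
        have := SyncFrom.step _ ∅ _ [] (hb _ (hb [] .nil)) (Finset.empty_ssubset.2 hE) .done
        rwa [List.append_nil, List.append_nil] at this
  · simp only [localTrace_append, emb, bar, localTrace_proj, localTrace_const]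
    have hnot : (∀ k ∈ Q, θ k ≠ i) → l.count i = 0 := fun hi => by
      rw [List.count_eq_zero]
      intro hil
      obtain ⟨k, hk, h⟩ := Finset.mem_image.1 (Finset.mem_toList.1 hil)
      exact hi k hk h
    by_cases hi : ∃ k ∈ Q, θ k = i
    · obtain ⟨k, hk, rfl⟩ := hi
      have hone : l.count (θ k) = 1 := List.count_eq_one_of_mem (Finset.nodup_toList _)
        (Finset.mem_toList.2 (Finset.mem_image_of_mem θ hk))
      obtain ⟨pre, hrun, hloc⟩ := hcall k hk
      left
      refine mem_hatCFG_traces.2 ⟨pre, some k, hrun, ?_⟩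
      rw [hloc, a1 k hk, b1 k hk, hone, List.filterMap_append, preWord_keepOrig, List.append_assoc]
      rfl
    · push Not at hi
      rw [a2 i hi, b2 i hi, hnot hi]
      simp only [List.filterMap_nil, List.replicate_zero, List.append_nil]
      rcases htr i with h1 | h1
      · obtain ⟨pre, suf, hrun, h2⟩ := mem_hatCFG_traces.1 h1
        cases suf with
        | none =>
          left
          refine mem_hatCFG_traces.2 ⟨pre, none, hrun, ?_⟩
          rw [h2, List.filterMap_append, preWord_keepOrig]
          rfl
        | some k =>
          -- A thread outside the image of `θ` cannot enter a gadget, since each gadget has at most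
          -- one caller.
          exfalso
          have hc : Caller x τ k i := ⟨pre, hrun, h2⟩
          have hk : k < x.C.length + 2 := by
            cases hrun with
            | direct _ _ h => exact h
            | call es _ ℓ h _ =>
              have := (List.getElem?_eq_some_iff.1 h).1
              omega
          have hkQ : k ∈ Q := Finset.mem_filter.2 ⟨Finset.mem_range.2 hk, i, hc⟩
          exact hi k hkQ ((hcall k hkQ).thread_unique hsync htr hc)
      · right
        rw [Set.mem_singleton_iff.1 h1]
        rfl

/-- The inclusion only forgets sync-points. Conversely, every interleaving misses a gadget and thus
already is an interleaving of the instrumented program; the empty sequence of swaps suffices, so any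
`I` is allowed. -/
theorem sound_of_not_coverable {x : CoverInstance} (hx : ¬ x.IsCoverable) (I : Set (Name × Name)) :
    SoundInstrumentation (lockProgram (hatGraph x)) (hatGraph' x) I := by
  constructor
  · rintro _ ⟨τ, rfl, ⟨hlock, -⟩, htr⟩
    refine ⟨proj keepFst τ, ?_, hlock, fun i => ?_⟩
    · rw [proj_proj]
      congr 1
      funext a
      rcases a with a | a | a <;> rfl
    · rw [localTrace_proj]
      rcases htr i with h | h
      · left
        exact (isSyncPointInstrumentation_hat x).1 ▸ ⟨_, h, rfl⟩
      · right
        rw [Set.mem_singleton_iff.1 h]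
        rfl
  · rintro _ ⟨τ, rfl, hsync, htr⟩
    refine ⟨_, mem_interleavings_of_not_caller hsync htr ?_, Relation.ReflTransGen.refl⟩
    by_contra! h
    exact hx (coverable_of_callers hsync htr fun k hk => h k (by omega))

theorem sound_iff_not_coverable (x : CoverInstance) (I : Set (Name × Name)) :
    SoundInstrumentation (lockProgram (hatGraph x)) (hatGraph' x) I ↔ ¬ x.IsCoverable :=
  ⟨fun h hx => not_sound_of_coverable hx I h, fun h => sound_of_not_coverable h I⟩

end LockPrograms

/-! ### Basic procedures of the machine and their costs. -/

open Turing

namespace LockPrograms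

open Computability (Γ')
open StackProgram

/-! ### The stacks of the machine -/

/-- The stacks: the input, a counter, two buffers, one stack for each of the four lists of locations
and edges in the output, and the output. -/
inductive Stack : Type
  | inp
  | cnt
  | buf₁
  | buf₂
  | part (i : Fin 4)
  | out
  deriving DecidableEq, Fintype

/-- The contents of the working stacks. -/
structure Work where
  inp : List Γ'
  cnt : List Γ' := []
  buf₁ : List Γ' := []
  buf₂ : List Γ' := []

/-- The contents of all stacks. -/
def mem (W : Work) (O : Fin 4 → List Γ') (out : List Γ') : Stack → List Γ'
  | Stack.inp => W.inp
  | Stack.cnt => W.cnt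
  | Stack.buf₁ => W.buf₁
  | Stack.buf₂ => W.buf₂
  | Stack.part i => O i
  | Stack.out => out

/-- A program that turns `W` into `W'` and writes `D i` on the `i`-th part of the output. -/
def Emits (p : Prog Stack Γ') (W W' : Work) (D : Fin 4 → List Γ') (t : ℕ) : Prop :=
  ∀ r O out, ∃ r', Runs p r (mem W O out) r' (mem W' (fun i => (D i).reverse ++ O i) out) t

theorem Emits.mono {p : Prog Stack Γ'} {W W' : Work} {D : Fin 4 → List Γ'} {t t' : ℕ}
    (h : Emits p W W' D t) (ht : t ≤ t') : Emits p W W' D t' := fun r O out =>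
  (h r O out).imp fun _ h => h.mono ht

theorem Emits.seq {p q : Prog Stack Γ'} {W W' W'' : Work} {D D' : Fin 4 → List Γ'} {t t' : ℕ}
    (h : Emits p W W' D t) (h' : Emits q W' W'' D' t') :
    Emits (Prog.seq p q) W W'' (fun i => D i ++ D' i) (t + t') := by
  intro r O out
  obtain ⟨r', h1⟩ := h r O out
  obtain ⟨r'', h2⟩ := h' r' _ out
  refine ⟨r'', ?_⟩
  have := h1.seq h2
  simpa only [List.reverse_append, List.append_assoc] using this

theorem _root_.StackProgram.Runs.congr_right {K Γ : Type} [DecidableEq K] {p : Prog K Γ}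
    {r r' : Option Γ} {S S' S'' : K → List Γ} {t : ℕ} (h : Runs p r S r' S' t) (hS : S'' = S') :
    Runs p r S r' S'' t := hS ▸ h

/-- The letter in the register. -/
def reg (r : Option Γ') : Γ' := r.getD Γ'.blank

/-- Emit words to parts of the output. -/
def say (is : List (Fin 4)) (fs : List (Option Γ' → Γ')) : List (Stack × (Option Γ' → Γ')) :=
  fs.flatMap fun f => is.map fun i => (Stack.part i, f)

/-- The word `w` on the parts `is`. -/
def on (is : List (Fin 4)) (w : List Γ') (i : Fin 4) : List Γ' := if i ∈ is then w else []

theorem word_append {K Γ : Type} [DecidableEq K] (l l' : List (K × (Option Γ → Γ))) (r : Option Γ)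
    (k : K) : word (l ++ l') r k = word l r k ++ word l' r k := by
  simp [word]

theorem word_say_part {is : List (Fin 4)} (his : is.Nodup) (fs : List (Option Γ' → Γ'))
    (r : Option Γ') (i : Fin 4) : word (say is fs) r (Stack.part i) = on is (fs.map fun f => f r) i := by
  have h1 : ∀ f : Option Γ' → Γ', word (is.map fun i => (Stack.part i, f)) r (Stack.part i) =
      on is [f r] i := by
    intro f
    induction is with
    | nil => rfl
    | cons j is ih =>
      rw [List.nodup_cons] at his
      have ih := ih his.2
      by_cases h : j = i
      · subst h
        simp [on, his.1] at ih
        simp [word, on] at ih ⊢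
        exact ih
      · simp [word, on, h, Ne.symm h] at ih ⊢
        exact ih
  induction fs with
  | nil => simp [say, word, on]
  | cons f fs ih =>
    rw [say, List.flatMap_cons, word_append, h1]
    rw [say] at ih
    rw [ih]
    unfold on
    split_ifs <;> simp

theorem word_say_of_ne (is : List (Fin 4)) (fs : List (Option Γ' → Γ')) (r : Option Γ') {k : Stack}
    (hk : ∀ i, Stack.part i ≠ k) : word (say is fs) r k = [] := by
  simp only [word, List.map_eq_nil_iff, List.filter_eq_nil_iff, say, List.mem_flatMap, List.mem_map]
  rintro _ ⟨f, _, i, _, rfl⟩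
  simpa using hk i

theorem length_say (is : List (Fin 4)) (fs : List (Option Γ' → Γ')) :
    (say is fs).length = fs.length * is.length := by
  induction fs with
  | nil => simp [say]
  | cons f fs ih =>
    rw [say] at ih ⊢
    rw [List.flatMap_cons, List.length_append, ih]
    simp [add_mul, add_comm]

/-- Emit a fixed word. -/
def sayConst (is : List (Fin 4)) (w : List Γ') : Prog Stack Γ' :=
  emit (say is (w.map fun s _ => s))

theorem emits_sayConst {is : List (Fin 4)} (his : is.Nodup) (w : List Γ') (W : Work) :
    Emits (sayConst is w) W W (on is w) (w.length * is.length) := by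
  intro r O out
  refine ⟨r, ?_⟩
  have h := Runs.emit (say is (w.map fun s (_ : Option Γ') => s)) r (mem W O out)
  rw [length_say, List.length_map] at h
  refine h.congr_right ?_
  funext k
  cases k <;> simp [mem, word_say_part his, word_say_of_ne, on, Function.comp_def]

/-- Push a letter on a working stack. -/
theorem emits_push_buf₁ (s : Γ') (W : Work) :
    Emits (Prog.push Stack.buf₁ fun _ => s) W { W with buf₁ := s :: W.buf₁ } (fun _ => []) 1 := by
  intro r O out
  refine ⟨r, ?_⟩
  refine (Runs.push Stack.buf₁ (fun _ => s) r (mem W O out)).congr_right ?_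
  funext k
  cases k <;> simp [mem, Function.update]

theorem emits_push_cnt (s : Γ') (W : Work) :
    Emits (Prog.push Stack.cnt fun _ => s) W { W with cnt := s :: W.cnt } (fun _ => []) 1 := by
  intro r O out
  refine ⟨r, ?_⟩
  refine (Runs.push Stack.cnt (fun _ => s) r (mem W O out)).congr_right ?_
  funext k
  cases k <;> simp [mem, Function.update]

/-- Move a letter from the second buffer to parts of the output. -/
def sayPop (is : List (Fin 4)) : Prog Stack Γ' := Prog.seq (Prog.pop Stack.buf₂) (emit (say is [reg]))

theorem emits_sayPop {is : List (Fin 4)} (his : is.Nodup) (s : Γ') (W : Work) (v : List Γ')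
    (hv : W.buf₂ = s :: v) :
    Emits (sayPop is) W { W with buf₂ := v } (on is [s]) (is.length + 1) := by
  intro r O out
  refine ⟨some s, ?_⟩
  have h := (Runs.pop Stack.buf₂ r (mem W O out)).seq (Runs.emit (say is [reg]) _ _)
  rw [length_say] at h
  refine Runs.mono (t := 1 + 1 * is.length) ?_ (by omega)
  have hs : (mem W O out Stack.buf₂).head? = some s := by simp [mem, hv]
  rw [hs] at h
  refine h.congr_right ?_
  funext k
  cases k <;> simp [mem, word_say_part his, word_say_of_ne, on, reg, hv, Function.update]

/-! ### Consuming words -/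

/-- Stop at a comma. -/
def isComma (r : Option Γ') : Bool := decide (r = some Γ'.comma)

/-- Stop at the end of the stack. -/
def isEnd (r : Option Γ') : Bool := decide (r = none)

/-- Copy a name from the input to parts of the output. -/
def readName (is : List (Fin 4)) : Prog Stack Γ' := consume Stack.inp isComma (say is [reg])

theorem isComma_bit {w : Name} : ∀ s ∈ w.map Γ'.bit, isComma (some s) = false := by
  intro s hs
  obtain ⟨b, -, rfl⟩ := List.mem_map.1 hs
  rfl

theorem flatMap_on (is : List (Fin 4)) (f : Γ' → List Γ') (w : List Γ') (i : Fin 4) :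
    (w.flatMap fun s => on is (f s) i) = on is (w.flatMap f) i := by
  unfold on
  split_ifs <;> simp

theorem emits_readName {is : List (Fin 4)} (his : is.Nodup) (w : Name) (rest : List Γ') (W : Work)
    (hW : W.inp = encName w ++ rest) :
    Emits (readName is) W { W with inp := rest } (on is (w.map Γ'.bit))
      ((w.length + 1) * (is.length + 2)) := by
  intro r O out
  have h := Runs.consume Stack.inp isComma (say is [reg])
    (fun r => word_say_of_ne is [reg] r (by simp)) (w.map Γ'.bit) (Γ'.comma :: rest) isComma_bit rfl r
    (mem W O out) (by simp [mem, hW, encName])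
  rw [length_say, List.length_map] at h
  refine ⟨some Γ'.comma, Runs.mono (t := (w.length + 1) * (1 * is.length + 2)) ?_ (by simp)⟩
  · refine h.congr_right ?_
    funext k
    cases k <;> simp [mem, word_say_part his, word_say_of_ne, flatMap_on, reg]

/-- Copy a name from the input to the first buffer and to parts of the output. -/
def saveName (is : List (Fin 4)) : Prog Stack Γ' :=
  Prog.seq (consume Stack.inp isComma (say is [reg] ++ [(Stack.buf₁, reg)]))
    (Prog.push Stack.buf₁ fun _ => Γ'.comma)

theorem emits_saveName {is : List (Fin 4)} (his : is.Nodup) (w : Name) (rest : List Γ') (W : Work)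
    (hW : W.inp = encName w ++ rest) :
    Emits (saveName is) W { W with inp := rest, buf₁ := (encName w).reverse ++ W.buf₁ }
      (on is (w.map Γ'.bit)) ((w.length + 1) * (is.length + 3) + 1) := by
  have h1 : Emits (consume Stack.inp isComma (say is [reg] ++ [(Stack.buf₁, reg)])) W
      { W with inp := rest, buf₁ := (w.map Γ'.bit).reverse ++ W.buf₁ } (on is (w.map Γ'.bit))
      ((w.length + 1) * (is.length + 3)) := by
    intro r O out
    have h := Runs.consume Stack.inp isComma (say is [reg] ++ [(Stack.buf₁, reg)])
      (fun r => by rw [word_append, word_say_of_ne is [reg] r (by simp)]; rfl) (w.map Γ'.bit)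
      (Γ'.comma :: rest) isComma_bit rfl r (mem W O out) (by simp [mem, hW, encName])
    rw [List.length_append, length_say, List.length_map] at h
    refine ⟨some Γ'.comma, Runs.mono (t := (w.length + 1) * (1 * is.length + 1 + 2)) ?_ (by simp)⟩
    · refine h.congr_right ?_
      funext k
      have hw : ∀ r k, word [(Stack.buf₁, reg)] r k = if k = Stack.buf₁ then [reg r] else [] := by
        intro r k
        by_cases hk : k = Stack.buf₁ <;> simp [word, hk, eq_comm]
      cases k <;> simp [mem, word_append, word_say_part his, word_say_of_ne, flatMap_on, hw, reg]
  have h2 := h1.seq (emits_push_buf₁ Γ'.comma _)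
  simpa [encName, saveName] using h2

/-- Copy a name from the second buffer to parts of the output. -/
def restoreName (is : List (Fin 4)) : Prog Stack Γ' := consume Stack.buf₂ isComma (say is [reg])

theorem emits_restoreName {is : List (Fin 4)} (his : is.Nodup) (w : Name) (rest : List Γ')
    (W : Work) (hW : W.buf₂ = encName w ++ rest) :
    Emits (restoreName is) W { W with buf₂ := rest } (on is (w.map Γ'.bit))
      ((w.length + 1) * (is.length + 2)) := by
  intro r O out
  have h := Runs.consume Stack.buf₂ isComma (say is [reg])
    (fun r => word_say_of_ne is [reg] r (by simp)) (w.map Γ'.bit) (Γ'.comma :: rest) isComma_bit rfl r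
    (mem W O out) (by simp [mem, hW, encName])
  rw [length_say, List.length_map] at h
  refine ⟨some Γ'.comma, Runs.mono (t := (w.length + 1) * (1 * is.length + 2)) ?_ (by simp)⟩
  · refine h.congr_right ?_
    funext k
    cases k <;> simp [mem, word_say_part his, word_say_of_ne, flatMap_on, reg]

theorem word_singleton {K Γ : Type} [DecidableEq K] (k : K) (f : Option Γ → Γ) (r : Option Γ)
    (k' : K) : word [(k, f)] r k' = if k = k' then [f r] else [] := by
  by_cases h : k = k' <;> simp [word, h]

/-- Move the first buffer to the second one. -/
def turn : Prog Stack Γ' := consume Stack.buf₁ isEnd [(Stack.buf₂, reg)]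

theorem emits_turn (W : Work) :
    Emits turn W { W with buf₁ := [], buf₂ := W.buf₁.reverse ++ W.buf₂ } (fun _ => [])
      ((W.buf₁.length + 1) * 3) := by
  intro r O out
  have h := Runs.consume Stack.buf₁ isEnd [(Stack.buf₂, reg)] (fun r => rfl) W.buf₁ []
    (fun _ _ => rfl) rfl r (mem W O out) (by simp [mem])
  refine ⟨none, ?_⟩
  · refine h.congr_right ?_
    funext k
    cases k <;> simp [mem, word_singleton, reg]

/-- The letters of the code of the letter in the register. -/
def regBits : List (Option Γ' → Γ') :=
  [fun r => Γ'.bit ((bits (reg r))[0]?.getD false), fun r => Γ'.bit ((bits (reg r))[1]?.getD false),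
    fun r => Γ'.bit ((bits (reg r))[2]?.getD false)]

theorem regBits_map (s : Γ') : (regBits.map fun f => f (some s)) = (bits s).map Γ'.bit := by
  cases s <;> rfl

/-- Write the code of the contents of the first buffer on parts of the output. -/
def replay (is : List (Fin 4)) : Prog Stack Γ' :=
  Prog.seq turn (consume Stack.buf₂ isEnd (say is regBits ++ [(Stack.buf₁, reg)]))

/-- The buffer is moved to the second one and back, which restores its order, so the same contents
can be written repeatedly. -/
theorem emits_replay {is : List (Fin 4)} (his : is.Nodup) (W : Work) (hW : W.buf₂ = []) :
    Emits (replay is) W W (on is ((W.buf₁.reverse.flatMap bits).map Γ'.bit))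
      ((W.buf₁.length + 1) * (3 * is.length + 6)) := by
  have h1 : Emits (consume Stack.buf₂ isEnd (say is regBits ++ [(Stack.buf₁, reg)]))
      { W with buf₁ := [], buf₂ := W.buf₁.reverse ++ W.buf₂ } W
      (on is ((W.buf₁.reverse.flatMap bits).map Γ'.bit))
      ((W.buf₁.length + 1) * (3 * is.length + 3)) := by
    intro r O out
    have h := Runs.consume Stack.buf₂ isEnd (say is regBits ++ [(Stack.buf₁, reg)])
      (fun r => by rw [word_append, word_say_of_ne is regBits r (by simp)]; rfl) W.buf₁.reverse []
      (fun _ _ => rfl) rfl r (mem { W with buf₁ := [], buf₂ := W.buf₁.reverse ++ W.buf₂ } O out)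
      (by simp [mem, hW])
    rw [List.length_append, length_say, List.length_reverse] at h
    refine ⟨none, ?_⟩
    · refine h.congr_right ?_
      funext k
      cases k <;> simp [mem, word_append, word_say_part his, word_say_of_ne, flatMap_on,
        word_singleton, reg, regBits_map, hW, List.map_flatMap]
  refine ((emits_turn W).seq h1).mono ?_
  rw [← mul_add]
  exact Nat.mul_le_mul_left _ (by omega)

/-- Write the contents of the counter on parts of the output. -/
def sayCount (is : List (Fin 4)) : Prog Stack Γ' :=
  Prog.seq (consume Stack.cnt isEnd [(Stack.buf₁, reg)])
    (consume Stack.buf₁ isEnd (say is [reg] ++ [(Stack.cnt, reg)]))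

theorem emits_sayCount {is : List (Fin 4)} (his : is.Nodup) (W : Work) (hW : W.buf₁ = []) :
    Emits (sayCount is) W W (on is W.cnt.reverse) ((W.cnt.length + 1) * (is.length + 6)) := by
  have h0 : Emits (consume Stack.cnt isEnd [(Stack.buf₁, reg)]) W
      { W with cnt := [], buf₁ := W.cnt.reverse } (fun _ => []) ((W.cnt.length + 1) * 3) := by
    intro r O out
    have h := Runs.consume Stack.cnt isEnd [(Stack.buf₁, reg)] (fun r => rfl) W.cnt []
      (fun _ _ => rfl) rfl r (mem W O out) (by simp [mem])
    refine ⟨none, ?_⟩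
    · refine h.congr_right ?_
      funext k
      cases k <;> simp [mem, word_singleton, reg, hW]
  have h1 : Emits (consume Stack.buf₁ isEnd (say is [reg] ++ [(Stack.cnt, reg)]))
      { W with cnt := [], buf₁ := W.cnt.reverse } W (on is W.cnt.reverse)
      ((W.cnt.length + 1) * (is.length + 3)) := by
    intro r O out
    have h := Runs.consume Stack.buf₁ isEnd (say is [reg] ++ [(Stack.cnt, reg)])
      (fun r => by rw [word_append, word_say_of_ne is [reg] r (by simp)]; rfl) W.cnt.reverse []
      (fun _ _ => rfl) rfl r (mem { W with cnt := [], buf₁ := W.cnt.reverse } O out)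
      (by simp [mem])
    rw [List.length_append, length_say, List.length_reverse] at h
    refine ⟨none, Runs.mono (t := (W.cnt.length + 1) * (1 * is.length + 1 + 2)) ?_ (by simp)⟩
    · refine h.congr_right ?_
      funext k
      cases k <;> simp [mem, word_append, word_say_part his, word_say_of_ne, flatMap_on,
        word_singleton, reg, hW]
  refine (h0.seq h1).mono ?_
  rw [← mul_add]
  exact Nat.mul_le_mul_left _ (by omega)

/-- Empty the counter. -/
def clearCount : Prog Stack Γ' := consume Stack.cnt isEnd []

theorem emits_clearCount (W : Work) :
    Emits clearCount W { W with cnt := [] } (fun _ => []) ((W.cnt.length + 1) * 2) := by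
  intro r O out
  have h := Runs.consume Stack.cnt isEnd [] (fun r => rfl) W.cnt []
    (fun _ _ => rfl) rfl r (mem W O out) (by simp [mem])
  refine ⟨none, ?_⟩
  · refine h.congr_right ?_
    funext k
    cases k <;> simp [mem, word]

/-! ### Loops over the items of a list -/

/-- Execute `body` for each item of a list in the input. -/
def forItems (body : Prog Stack Γ') : Prog Stack Γ' :=
  Prog.seq (Prog.pop Stack.inp) (Prog.loop (fun r => decide (r = some Γ'.bra))
    (Prog.seq body (Prog.pop Stack.inp)))

/-- The words written by a loop whose body writes `D k x` for the `k`-th item `x`. -/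
def itemsOut {X : Type} (D : ℕ → X → Fin 4 → List Γ') : ℕ → List X → Fin 4 → List Γ'
  | _, [], _ => []
  | k, x :: l, i => D k x i ++ itemsOut D (k + 1) l i

theorem runs_pop_inp (W : Work) (O : Fin 4 → List Γ') (out : List Γ') (s : Γ') (v : List Γ')
    (hv : W.inp = s :: v) (r : Option Γ') :
    Runs (Prog.pop Stack.inp) r (mem W O out) (some s) (mem { W with inp := v } O out) 1 := by
  have h := Runs.pop Stack.inp r (mem W O out)
  convert h using 1
  · simp [mem, hv]
  · funext k
    cases k <;> simp [mem, hv, Function.update]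

theorem encList_cons {X : Type} (e : X → List Γ') (x : X) (l : List X) :
    encList e (x :: l) = Γ'.bra :: (e x ++ encList e l) := by
  simp [encList]

/-- The function `u` gives the contents of the counter before the item with each index. The letter
popped after an item, `bra` or `ket`, decides whether the loop continues. -/
theorem emits_forItems {X : Type} (e : X → List Γ') (body : Prog Stack Γ')
    (D : ℕ → X → Fin 4 → List Γ') (u : ℕ → List Γ') (c : ℕ) (l : List X) (k : ℕ) (rest : List Γ')
    (hbody : ∀ x ∈ l, ∀ j, k ≤ j → j < k + l.length → ∀ rest,
      Emits body { inp := e x ++ rest, cnt := u j } { inp := rest, cnt := u (j + 1) } (D j x) c) :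
    Emits (forItems body) { inp := encList e l ++ rest, cnt := u k }
      { inp := rest, cnt := u (k + l.length) } (itemsOut D k l) ((l.length + 1) * (c + 2)) := by
  -- The induction concerns the loop alone: the mark `s` in front of the remaining list has already
  -- been popped into the register.
  have key : ∀ (l : List X) (k : ℕ), (∀ x ∈ l, ∀ j, k ≤ j → j < k + l.length → ∀ rest,
      Emits body { inp := e x ++ rest, cnt := u j } { inp := rest, cnt := u (j + 1) } (D j x) c) →
      ∀ O out, ∃ s v, encList e l ++ rest = s :: v ∧
      Runs (Prog.loop (fun r => decide (r = some Γ'.bra)) (Prog.seq body (Prog.pop Stack.inp)))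
        (some s) (mem { inp := v, cnt := u k } O out) (some Γ'.ket)
        (mem { inp := rest, cnt := u (k + l.length) }
          (fun i => (itemsOut D k l i).reverse ++ O i) out) (l.length * (c + 2) + 1) := by
    intro l
    induction l with
    | nil =>
      intro k _ O out
      refine ⟨Γ'.ket, rest, rfl, ?_⟩
      refine Runs.mono (t := 1) ?_ (by simp)
      exact Runs.loop_stop _ _ rfl
    | cons x l ih =>
      intro k hb O out
      refine ⟨Γ'.bra, e x ++ (encList e l ++ rest), by simp [encList_cons], ?_⟩
      obtain ⟨r', h1⟩ := hb x (by simp) k le_rfl (by simp) (encList e l ++ rest) (some Γ'.bra) O out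
      obtain ⟨s, v, hs, h2⟩ := ih (k + 1) (fun y hy j hj hj' rest => hb y (by simp [hy]) j (by omega)
        (by simp only [List.length_cons]; omega) rest)
        (fun i => (D k x i).reverse ++ O i) out
      have h3 := Runs.loop_step (c := fun r => decide (r = some Γ'.bra)) (r := some Γ'.bra) rfl
        (h1.seq (runs_pop_inp _ _ _ s v hs r')) h2
      have hk : k + (x :: l).length = k + 1 + l.length := by simp only [List.length_cons]; omega
      rw [hk]
      refine Runs.mono (t := 1 + (c + 1) + (l.length * (c + 2) + 1)) ?_ ?_
      · simpa only [itemsOut, List.reverse_append, List.append_assoc] using h3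
      · simp only [List.length_cons, add_mul]; omega
  intro r O out
  obtain ⟨s, v, hs, h⟩ := key l k hbody O out
  refine ⟨_, ((runs_pop_inp _ O out s v hs r).seq h).mono ?_⟩
  simp only [add_mul]
  omega

/-! ### Templates -/

/-- Write fixed words and the contents of the counter, alternately, on a part of the output. -/
def template (i : Fin 4) : List (Option (List Γ')) → Prog Stack Γ'
  | [] => Prog.skip
  | none :: ps => Prog.seq (sayCount [i]) (template i ps)
  | some w :: ps => Prog.seq (sayConst [i] w) (template i ps)

/-- The word written by a template. -/
def templateOut (k : ℕ) (ps : List (Option (List Γ'))) : List Γ' :=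
  ps.flatMap fun p => p.getD (List.replicate k (Γ'.bit true))

/-- A measure of the size of a template. -/
def templateSize (ps : List (Option (List Γ'))) : ℕ :=
  (ps.map fun p => (p.map List.length).getD 7).sum

theorem emits_template (i : Fin 4) (ps : List (Option (List Γ'))) (inp : List Γ') (k : ℕ) :
    Emits (template i ps) { inp := inp, cnt := List.replicate k (Γ'.bit true) }
      { inp := inp, cnt := List.replicate k (Γ'.bit true) } (on [i] (templateOut k ps))
      (templateSize ps * (k + 1)) := by
  induction ps with
  | nil =>
    intro r O out
    refine ⟨r, ?_⟩
    have := Runs.skip r (mem { inp := inp, cnt := List.replicate k (Γ'.bit true) } O out)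
    simpa [template, templateOut, templateSize, on] using this
  | cons p ps ih =>
    have hD : ∀ w, (fun j => on [i] w j ++ on [i] (templateOut k ps) j) =
        on [i] (w ++ templateOut k ps) := by
      intro w
      funext j
      unfold on
      split_ifs <;> simp
    cases p with
    | none =>
      -- Copying the counter to one part costs `(k + 1) * (1 + 6)`, whence the 7 in `templateSize`.
      have h := (emits_sayCount (is := [i]) (by simp)
        { inp := inp, cnt := List.replicate k (Γ'.bit true) } rfl).seq ih
      rw [hD] at h
      simp only [List.reverse_replicate, List.length_replicate, List.length_singleton] at h
      refine Emits.mono h ?_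
      simp only [templateSize, List.map_cons, List.sum_cons, Option.map_none, Option.getD_none,
        add_mul]
      omega
    | some w =>
      have h := (emits_sayConst (is := [i]) (by simp) w
        { inp := inp, cnt := List.replicate k (Γ'.bit true) }).seq ih
      rw [hD] at h
      refine Emits.mono h ?_
      simp only [templateSize, List.map_cons, List.sum_cons, Option.map_some, Option.getD_some,
        add_mul, List.length_singleton, mul_add]
      have : 0 ≤ w.length * k := Nat.zero_le _
      omega

end LockPrograms

/-! ### Procedures that write gadgets and split edges. -/

open Turing

namespace LockPrograms

open Computability (Γ')
open StackProgram

theorem Emits.congr {p : Prog Stack Γ'} {W W' W'' : Work} {D D' : Fin 4 → List Γ'} {t : ℕ}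
    (h : Emits p W W' D t) (hW : W'' = W') (hD : ∀ i, D' i = D i) : Emits p W W'' D' t := by
  rw [hW, funext hD]
  exact h

/-- The items of a list in an encoding, without the end mark. -/
def items {X : Type} (e : X → List Γ') (l : List X) : List Γ' := l.flatMap fun x => Γ'.bra :: e x

@[simp]
theorem items_nil {X : Type} (e : X → List Γ') : items e [] = [] := rfl

@[simp]
theorem items_cons {X : Type} (e : X → List Γ') (x : X) (l : List X) :
    items e (x :: l) = Γ'.bra :: (e x ++ items e l) := rfl

@[simp]
theorem items_append {X : Type} (e : X → List Γ') (l l' : List X) :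
    items e (l ++ l') = items e l ++ items e l' := List.flatMap_append

theorem encList_eq_items {X : Type} (e : X → List Γ') (l : List X) :
    encList e l = items e l ++ [Γ'.ket] := rfl

/-! ### Gadgets -/

section Gadgets

/-- Abbreviations for bits. -/
abbrev b0 : Γ' := Γ'.bit false

/-- Abbreviations for bits. -/
abbrev b1 : Γ' := Γ'.bit true

@[simp]
theorem templateOut_nil (k : ℕ) : templateOut k [] = [] := rfl

@[simp]
theorem templateOut_none (k : ℕ) (ps : List (Option (List Γ'))) :
    templateOut k (none :: ps) = List.replicate k b1 ++ templateOut k ps := rfl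

@[simp]
theorem templateOut_some (k : ℕ) (w : List Γ') (ps : List (Option (List Γ'))) :
    templateOut k (some w :: ps) = w ++ templateOut k ps := rfl

@[simp]
theorem templateOut_append (k : ℕ) (ps qs : List (Option (List Γ'))) :
    templateOut k (ps ++ qs) = templateOut k ps ++ templateOut k qs := List.flatMap_append

/-- The name of the node with `r` remaining operations. -/
def nodeTemplate : ℕ → List (Option (List Γ'))
  | 0 => [some [Γ'.comma]]
  | r + 1 => [some (b0 :: b0 :: (List.replicate r b1 ++ [b0])), none, some [Γ'.comma]]

@[simp]
theorem templateOut_nodeTemplate (k r : ℕ) : templateOut k (nodeTemplate r) = encName (node k r) := by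
  cases r <;> simp [nodeTemplate, node, encName]

/-- The inner locations of a gadget. -/
def locsTemplate : ℕ → List (Option (List Γ'))
  | 0 => []
  | r + 1 => some [Γ'.bra] :: (nodeTemplate (r + 1) ++ locsTemplate r)

theorem templateOut_locsTemplate {S : Type} (k : ℕ) (t : List S) :
    templateOut k (locsTemplate t.length) = items encName (tailLocs k t) := by
  induction t with
  | nil => rfl
  | cons s t ih => simp [locsTemplate, tailLocs, ih]

/-- The edges of a gadget after the first one, for given templates of the labels. -/
def edgesTemplate : List (List (Option (List Γ'))) → List (Option (List Γ'))
  | [] => []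
  | p :: ps => some [Γ'.bra] ::
    (nodeTemplate (ps.length + 1) ++ (p ++ (nodeTemplate ps.length ++ edgesTemplate ps)))

theorem templateOut_edgesTemplate {S : Type} (enc : Name ⊕ S → List Γ') (k : ℕ)
    (ps : List (List (Option (List Γ')))) (t : List S)
    (h : ps.map (templateOut k) = t.map fun s => enc (Sum.inr s)) :
    templateOut k (edgesTemplate ps) = items (encEdge enc) (tailEdges k t) := by
  induction ps generalizing t with
  | nil =>
    cases t with
    | nil => rfl
    | cons s t => simp at h
  | cons p ps ih =>
    cases t with
    | nil => simp at h
    | cons s t =>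
      simp only [List.map_cons, List.cons.injEq] at h
      have hl : ps.length = t.length := by simpa using congrArg List.length h.2
      simp [edgesTemplate, tailEdges, ih t h.2, h.1, hl, encEdge]

/-- The edges of a gadget, without the source of the first one. -/
def gadgetTemplate (ps : List (List (Option (List Γ')))) : List (Option (List Γ')) :=
  -- Two bits for the kind of the label, then the two leading bits of `callName`.
  some [b0, b0, b0, b0] :: none :: some [Γ'.comma] :: (nodeTemplate ps.length ++ edgesTemplate ps)

theorem items_gadgetEdges {S : Type} (enc : Name ⊕ S → List Γ')
    (henc : ∀ a, enc (Sum.inl a) = encLabel (Sum.inl a)) (k : ℕ)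
    (ps : List (List (Option (List Γ')))) (t : List S)
    (h : ps.map (templateOut k) = t.map fun s => enc (Sum.inr s)) (src : Name) :
    items (encEdge enc) (gadgetEdges src k t) =
      Γ'.bra :: encName src ++ templateOut k (gadgetTemplate ps) := by
  have hl : ps.length = t.length := by simpa using congrArg List.length h
  simp [gadgetTemplate, gadgetEdges, templateOut_edgesTemplate enc k ps t h, hl, encEdge, henc,
    encLabel, callName, encName]

/-- The operation with the given code on a lock with the given code of its number. -/
def opTemplate (w : List Γ') (n : List (Option (List Γ'))) : List (Option (List Γ')) :=
  some w :: (n ++ [some [Γ'.comma]])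

/-- The labels of a gadget in the first graph. -/
def lockTemplates (n : List (Option (List Γ'))) : List (List (Option (List Γ'))) :=
  -- In each code, the first two bits are the kind of operation and the last two the prefix of
  -- `onceLock` or `ringLock`.
  [opTemplate [b0, b1, b0, b1] [none], opTemplate [b0, b1, b0, b0] [none],
    opTemplate [b0, b1, b0, b0] n, opTemplate [b1, b0, b0, b0] n, opTemplate [b1, b0, b0, b0] [none]]

/-- The labels of a gadget in the second graph. -/
def syncTemplates (n : List (Option (List Γ'))) : List (List (Option (List Γ'))) :=
  [opTemplate [b0, b1, b0, b1] [none], opTemplate [b0, b1, b0, b0] [none], [some [b1, b1]],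
    [some [b1, b1]], opTemplate [b0, b1, b0, b0] n, opTemplate [b1, b0, b0, b0] n,
    opTemplate [b1, b0, b0, b0] [none]]

theorem lockTemplates_map {k j : ℕ} {n : List (Option (List Γ'))}
    (hn : templateOut k n = List.replicate j b1) :
    (lockTemplates n).map (templateOut k) =
      (lockTail k j).map fun s => encLabel (Sum.inr s) := by
  simp [lockTemplates, opTemplate, lockTail, encLabel, encName, hn, onceLock, ringLock]

theorem syncTemplates_map {k j : ℕ} {n : List (Option (List Γ'))}
    (hn : templateOut k n = List.replicate j b1) :
    (syncTemplates n).map (templateOut k) =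
      (syncTail k j).map fun s => encLabel' (Sum.inr s) := by
  simp [syncTemplates, opTemplate, syncTail, encLabel', encLabel, encName, hn, onceLock, ringLock]

/-- The contribution of a gadget to the output. -/
def gadgetOut (k j : ℕ) (src : Name) : Fin 4 → List Γ' :=
  ![items encName (tailLocs k (lockTail k j)),
    items (encEdge encLabel) (gadgetEdges src k (lockTail k j)),
    items encName (tailLocs k (syncTail k j)),
    items (encEdge encLabel') (gadgetEdges src k (syncTail k j))]

/-- Write a gadget, except for its source. -/
def gadget (n : List (Option (List Γ'))) : Prog Stack Γ' :=
  Prog.seq (template 0 (locsTemplate 5)) (Prog.seq (template 1 (gadgetTemplate (lockTemplates n)))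
    (Prog.seq (template 2 (locsTemplate 7)) (template 3 (gadgetTemplate (syncTemplates n)))))

/-- The cost of a gadget is linear, with this factor. -/
def gadgetCost (n : List (Option (List Γ'))) : ℕ :=
  templateSize (locsTemplate 5) + (templateSize (gadgetTemplate (lockTemplates n)) +
    (templateSize (locsTemplate 7) + templateSize (gadgetTemplate (syncTemplates n))))

theorem emits_gadget (n : List (Option (List Γ'))) (inp : List Γ') (k : ℕ) :
    Emits (gadget n) { inp := inp, cnt := List.replicate k b1 }
      { inp := inp, cnt := List.replicate k b1 }
      ![templateOut k (locsTemplate 5), templateOut k (gadgetTemplate (lockTemplates n)),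
        templateOut k (locsTemplate 7), templateOut k (gadgetTemplate (syncTemplates n))]
      (gadgetCost n * (k + 1)) := by
  have h := (emits_template 0 (locsTemplate 5) inp k).seq
    ((emits_template 1 (gadgetTemplate (lockTemplates n)) inp k).seq
      ((emits_template 2 (locsTemplate 7) inp k).seq
        (emits_template 3 (gadgetTemplate (syncTemplates n)) inp k)))
  refine (h.congr rfl ?_).mono (le_of_eq ?_)
  · intro i
    fin_cases i <;> simp [on]
  · simp only [gadgetCost, add_mul]

/-- Separates the source, which is copied from the input or fixed, from the remainder, which depends
on the counter only. The template `n` writes the number `j` of the neighbour. -/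
theorem gadgetOut_eq {k j : ℕ} {n : List (Option (List Γ'))}
    (hn : templateOut k n = List.replicate j b1) (src : Name) (i : Fin 4) :
    gadgetOut k j src i = on [1, 3] (Γ'.bra :: encName src) i ++
      (![templateOut k (locsTemplate 5), templateOut k (gadgetTemplate (lockTemplates n)),
        templateOut k (locsTemplate 7), templateOut k (gadgetTemplate (syncTemplates n))] :
        Fin 4 → List Γ') i := by
  have h1 := templateOut_locsTemplate k (lockTail k j)
  have h2 := templateOut_locsTemplate k (syncTail k j)
  have h3 := items_gadgetEdges encLabel (fun _ => rfl) k _ _ (lockTemplates_map hn) src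
  have h4 := items_gadgetEdges encLabel' (fun _ => rfl) k _ _ (syncTemplates_map hn) src
  have h5 : (lockTail k j).length = 5 := rfl
  have h6 : (syncTail k j).length = 7 := rfl
  rw [h5] at h1
  rw [h6] at h2
  fin_cases i <;> simp [gadgetOut, on, h1, h2, h3, h4]

end Gadgets

/-! ### The items of the input -/

/-- Copy a location. -/
def locBody : Prog Stack Γ' :=
  Prog.seq (sayConst [0, 2] [Γ'.bra, b1]) (Prog.seq (readName [0, 2]) (sayConst [0, 2] [Γ'.comma]))

theorem emits_locBody (ℓ : Name) (rest cnt : List Γ') :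
    Emits locBody { inp := encName ℓ ++ rest, cnt := cnt } { inp := rest, cnt := cnt }
      ![items encName [origName ℓ], [], items encName [origName ℓ], []]
      (4 * (ℓ.length + 1) + 6) := by
  have h := (emits_sayConst (is := [0, 2]) (by decide) [Γ'.bra, b1]
      { inp := encName ℓ ++ rest, cnt := cnt }).seq
    ((emits_readName (is := [0, 2]) (by decide) ℓ rest _ rfl).seq
      (emits_sayConst (is := [0, 2]) (by decide) [Γ'.comma] _))
  refine (h.congr rfl ?_).mono ?_
  · intro i
    fin_cases i <;> simp [on, encName, origName]
  · simp
    omega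

/-- The name of a label, preceded by the code of its kind. -/
def labelName : Name ⊕ LockOp Name → Name
  | Sum.inl a => false :: false :: a
  | Sum.inr (LockOp.acq m) => false :: true :: m
  | Sum.inr (LockOp.rel m) => true :: false :: m

theorem encLabel_eq (s : Name ⊕ LockOp Name) : encLabel s = encName (labelName s) := by
  rcases s with a | m | m <;> rfl

theorem labelName_inl (a : Name) : labelName (Sum.inl a) = false :: false :: a := rfl

/-- Whatever the kind of the label, lifting inserts one bit `true` after the two bits of the kind;
so the machine need not distinguish the kinds. -/
theorem encLabel_lift (s : Name ⊕ LockOp Name) : ∃ c d w, labelName s = c :: d :: w ∧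
    encLabel (liftLabel id s) = Γ'.bit c :: Γ'.bit d :: encName (true :: w) ∧
    encLabel' (liftLabel Sum.inl s) = Γ'.bit c :: Γ'.bit d :: encName (true :: w) := by
  rcases s with a | m | m
  · exact ⟨_, _, _, rfl, rfl, rfl⟩
  · exact ⟨_, _, _, rfl, rfl, rfl⟩
  · exact ⟨_, _, _, rfl, rfl, rfl⟩

/-- Read an edge and write its first half. -/
def edgeRead : Prog Stack Γ' :=
  Prog.seq (sayConst [1, 3] [Γ'.bra, b1]) <| Prog.seq (saveName [1, 3]) <|
  Prog.seq (sayConst [1, 3] [Γ'.comma, b0, b0, b0, b1]) <| Prog.seq (saveName []) <|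
  Prog.seq (saveName []) <| Prog.seq (sayConst [0, 2] [Γ'.bra, b0, b1]) <|
  Prog.seq (replay [0, 1, 2, 3]) <| Prog.seq (sayConst [0, 1, 2, 3] [Γ'.comma]) <|
  Prog.seq (sayConst [1, 3] [b0, b1]) <| Prog.seq (replay [1, 3]) (sayConst [1, 3] [Γ'.comma])

/-- The edge is saved while it is read, because its code names both the new action and the new
location and so has to be written several times. -/
theorem emits_edgeRead (e : LockEdge) (rest cnt : List Γ') :
    Emits edgeRead { inp := encEdge encLabel e ++ rest, cnt := cnt }
      { inp := rest, cnt := cnt, buf₁ := (encEdge encLabel e).reverse }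
      ![items encName [edgeName e],
        Γ'.bra :: encName (origName e.1) ++ encLabel (Sum.inl (edgeName e)) ++ encName (edgeName e),
        items encName [edgeName e],
        Γ'.bra :: encName (origName e.1) ++ encLabel (Sum.inl (edgeName e)) ++ encName (edgeName e)]
      (45 * ((encEdge encLabel e).length + 1) + 50) := by
  obtain ⟨src, s, tgt⟩ := e
  have h := (emits_sayConst (is := [1, 3]) (by decide) [Γ'.bra, b1]
      { inp := encName src ++ (encName (labelName s) ++ (encName tgt ++ rest)), cnt := cnt }).seq <|
    (emits_saveName (is := [1, 3]) (by decide) src _ _ rfl).seq <|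
    (emits_sayConst (is := [1, 3]) (by decide) [Γ'.comma, b0, b0, b0, b1] _).seq <|
    (emits_saveName (is := []) (by decide) (labelName s) _ _ rfl).seq <|
    (emits_saveName (is := []) (by decide) tgt _ _ rfl).seq <|
    (emits_sayConst (is := [0, 2]) (by decide) [Γ'.bra, b0, b1] _).seq <|
    (emits_replay (is := [0, 1, 2, 3]) (by decide) _ rfl).seq <|
    (emits_sayConst (is := [0, 1, 2, 3]) (by decide) [Γ'.comma] _).seq <|
    (emits_sayConst (is := [1, 3]) (by decide) [b0, b1] _).seq <|
    (emits_replay (is := [1, 3]) (by decide) _ rfl).seq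
    (emits_sayConst (is := [1, 3]) (by decide) [Γ'.comma] _)
  have he : encEdge encLabel (src, s, tgt) =
      encName src ++ (encName (labelName s) ++ encName tgt) := by
    simp [encEdge, encLabel_eq]
  have hin : encEdge encLabel (src, s, tgt) ++ rest =
      encName src ++ (encName (labelName s) ++ (encName tgt ++ rest)) := by
    simp [he]
  rw [hin]
  refine (h.congr ?_ ?_).mono ?_
  · simp [he]
  · intro i
    fin_cases i <;> simp [on, encName, origName, edgeName, encEdge, encLabel_eq, labelName_inl]
  · simp [he, encName]
    omega

/-- Write the second half of an edge. -/
def edgeWrite : Prog Stack Γ' :=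
  Prog.seq (sayConst [1, 3] [Γ'.bra, b0, b1]) <| Prog.seq (replay [1, 3]) <|
  Prog.seq (sayConst [1, 3] [Γ'.comma]) <| Prog.seq turn <| Prog.seq (restoreName []) <|
  Prog.seq (sayPop [1, 3]) <| Prog.seq (sayPop [1, 3]) <| Prog.seq (sayConst [1, 3] [b1]) <|
  Prog.seq (restoreName [1, 3]) <| Prog.seq (sayConst [1, 3] [Γ'.comma, b1]) <|
  Prog.seq (restoreName [1, 3]) (sayConst [1, 3] [Γ'.comma])

/-- After a last replay the saved edge is turned around and consumed: its source is skipped, the two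
bits of the kind are copied, and the rest of the label and the target are copied with an additional
bit each. -/
theorem emits_edgeWrite (e : LockEdge) (inp cnt : List Γ') :
    Emits edgeWrite { inp := inp, cnt := cnt, buf₁ := (encEdge encLabel e).reverse }
      { inp := inp, cnt := cnt }
      ![[], items (encEdge encLabel) [(edgeName e, liftLabel id e.2.1, origName e.2.2)], [],
        items (encEdge encLabel') [(edgeName e, liftLabel Sum.inl e.2.1, origName e.2.2)]]
      (30 * ((encEdge encLabel e).length + 1) + 40) := by
  obtain ⟨src, s, tgt⟩ := e
  obtain ⟨c, d, w, hs, hs1, hs2⟩ := encLabel_lift s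
  have he : encEdge encLabel (src, s, tgt) =
      encName src ++ (Γ'.bit c :: Γ'.bit d :: (encName w ++ encName tgt)) := by
    simp [encEdge, encLabel_eq, hs, encName]
  have h := (emits_sayConst (is := [1, 3]) (by decide) [Γ'.bra, b0, b1]
      { inp := inp, cnt := cnt, buf₁ := (encEdge encLabel (src, s, tgt)).reverse }).seq <|
    (emits_replay (is := [1, 3]) (by decide) _ rfl).seq <|
    (emits_sayConst (is := [1, 3]) (by decide) [Γ'.comma] _).seq <|
    (emits_turn _).seq <|
    (emits_restoreName (is := []) (by decide) src _ _ (by simp [he]; rfl)).seq <|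
    (emits_sayPop (is := [1, 3]) (by decide) (Γ'.bit c) _ _ rfl).seq <|
    (emits_sayPop (is := [1, 3]) (by decide) (Γ'.bit d) _ _ rfl).seq <|
    (emits_sayConst (is := [1, 3]) (by decide) [b1] _).seq <|
    (emits_restoreName (is := [1, 3]) (by decide) w _ _ rfl).seq <|
    (emits_sayConst (is := [1, 3]) (by decide) [Γ'.comma, b1] _).seq <|
    (emits_restoreName (is := [1, 3]) (by decide) tgt [] _ (by simp)).seq
    (emits_sayConst (is := [1, 3]) (by decide) [Γ'.comma] _)
  refine (h.congr rfl ?_).mono ?_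
  · intro i
    fin_cases i <;> simp [on, encName, origName, edgeName, encEdge, hs1, hs2, encLabel_eq, hs]
  · simp [he, encName]
    omega

/-- Split an edge. -/
def edgeBody : Prog Stack Γ' := Prog.seq edgeRead edgeWrite

theorem emits_edgeBody (e : LockEdge) (rest cnt : List Γ') :
    Emits edgeBody { inp := encEdge encLabel e ++ rest, cnt := cnt } { inp := rest, cnt := cnt }
      ![items encName [edgeName e], items (encEdge encLabel) (splitEdge id e),
        items encName [edgeName e], items (encEdge encLabel') (splitEdge Sum.inl e)]
      (75 * ((encEdge encLabel e).length + 1) + 90) := by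
  refine (((emits_edgeRead e rest cnt).seq (emits_edgeWrite e rest cnt)).congr rfl ?_).mono
    (by omega)
  intro i
  fin_cases i <;> simp [splitEdge, encEdge, encLabel']

/-- The template of the number of the next lock in the ring. -/
def nextTemplate : List (Option (List Γ')) := [none, some [b1]]

theorem templateOut_nextTemplate (k : ℕ) :
    templateOut k nextTemplate = List.replicate (k + 1) b1 := by
  simp [nextTemplate, List.replicate_succ']

/-- Write the gadget of a location. -/
def callBody : Prog Stack Γ' :=
  Prog.seq (sayConst [1, 3] [Γ'.bra, b1]) <| Prog.seq (readName [1, 3]) <|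
  Prog.seq (sayConst [1, 3] [Γ'.comma]) <|
  Prog.seq (gadget nextTemplate) (Prog.push Stack.cnt fun _ => b1)

theorem emits_callBody (ℓ : Name) (rest : List Γ') (k : ℕ) :
    Emits callBody { inp := encName ℓ ++ rest, cnt := List.replicate k b1 }
      { inp := rest, cnt := List.replicate (k + 1) b1 } (gadgetOut k (k + 1) (origName ℓ))
      (4 * (ℓ.length + 1) + gadgetCost nextTemplate * (k + 1) + 7) := by
  have h := (emits_sayConst (is := [1, 3]) (by decide) [Γ'.bra, b1]
      { inp := encName ℓ ++ rest, cnt := List.replicate k b1 }).seq <|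
    (emits_readName (is := [1, 3]) (by decide) ℓ rest _ rfl).seq <|
    (emits_sayConst (is := [1, 3]) (by decide) [Γ'.comma] _).seq <|
    (emits_gadget nextTemplate rest k).seq (emits_push_cnt b1 _)
  refine (h.congr ?_ ?_).mono ?_
  · simp [List.replicate_succ]
  · intro i
    rw [gadgetOut_eq (templateOut_nextTemplate k)]
    fin_cases i <;> simp [on, encName, origName]
  · simp
    omega

/-- Write the two gadgets that start at the new initial location. -/
def specials : Prog Stack Γ' :=
  Prog.seq (sayConst [1, 3] (Γ'.bra :: encName startLoc)) <| Prog.seq (gadget nextTemplate) <|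
  Prog.seq (Prog.push Stack.cnt fun _ => b1) <|
  Prog.seq (sayConst [1, 3] (Γ'.bra :: encName startLoc)) <| Prog.seq (gadget []) clearCount

/-- The empty template writes the number 0, which closes the ring at the last gadget. -/
theorem emits_specials (inp : List Γ') (k : ℕ) :
    Emits specials { inp := inp, cnt := List.replicate k b1 } { inp := inp }
      (fun i => gadgetOut k (k + 1) startLoc i ++ gadgetOut (k + 1) 0 startLoc i)
      ((gadgetCost nextTemplate + gadgetCost [] + 8) * (k + 2) + 13) := by
  have h := (emits_sayConst (is := [1, 3]) (by decide) (Γ'.bra :: encName startLoc)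
      { inp := inp, cnt := List.replicate k b1 }).seq <|
    (emits_gadget nextTemplate inp k).seq <| (emits_push_cnt b1 _).seq <|
    (emits_sayConst (is := [1, 3]) (by decide) (Γ'.bra :: encName startLoc)
      { inp := inp, cnt := List.replicate (k + 1) b1 }).seq <|
    (emits_gadget [] inp (k + 1)).seq (emits_clearCount _)
  refine (h.congr rfl ?_).mono ?_
  · intro i
    rw [gadgetOut_eq (templateOut_nextTemplate k), gadgetOut_eq (n := []) (k := k + 1) (j := 0) rfl]
    simp only [List.append_assoc, List.append_nil, List.nil_append]
  · simp [encName, startLoc, add_mul, mul_add]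
    omega

end LockPrograms

/-! ### The complete machine and its quadratic running time. -/

open Turing

namespace LockPrograms

open Computability (Γ')
open StackProgram

/-! ### The whole machine -/

theorem itemsOut_locs (k : ℕ) (l : List Name) (i : Fin 4) :
    itemsOut (fun _ ℓ => ![items encName [origName ℓ], [], items encName [origName ℓ], []]) k l i =
      (![items encName (l.map origName), [], items encName (l.map origName), []] :
        Fin 4 → List Γ') i := by
  induction l generalizing k with
  | nil => fin_cases i <;> rfl
  | cons ℓ l ih =>
    rw [itemsOut, ih]
    fin_cases i <;> simp

theorem itemsOut_edges (k : ℕ) (l : List LockEdge) (i : Fin 4) :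
    itemsOut (fun _ e => ![items encName [edgeName e], items (encEdge encLabel) (splitEdge id e),
      items encName [edgeName e], items (encEdge encLabel') (splitEdge Sum.inl e)]) k l i =
      (![items encName (l.map edgeName), items (encEdge encLabel) (l.flatMap (splitEdge id)),
        items encName (l.map edgeName), items (encEdge encLabel') (l.flatMap (splitEdge Sum.inl))] :
        Fin 4 → List Γ') i := by
  induction l generalizing k with
  | nil => fin_cases i <;> rfl
  | cons e l ih =>
    rw [itemsOut, ih]
    fin_cases i <;> simp

theorem itemsOut_calls (k : ℕ) (C : List Name) (i : Fin 4) :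
    itemsOut (fun j ℓ => gadgetOut j (j + 1) (origName ℓ)) k C i ++
      (gadgetOut (k + C.length) (k + C.length + 1) startLoc i ++
        gadgetOut (k + C.length + 1) 0 startLoc i) =
      (![items encName (callLocs lockTail k C), items (encEdge encLabel) (callEdges lockTail k C),
        items encName (callLocs syncTail k C), items (encEdge encLabel') (callEdges syncTail k C)] :
        Fin 4 → List Γ') i := by
  induction C generalizing k with
  | nil => fin_cases i <;> simp [itemsOut, gadgetOut, callLocs, callEdges]
  | cons ℓ C ih =>
    have h := ih (k + 1)
    rw [itemsOut, List.length_cons, ← add_assoc, add_right_comm k C.length 1, List.append_assoc, h]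
    fin_cases i <;> simp [gadgetOut, callLocs, callEdges]

/-- Write the initial and exit locations and the edges that lead from and to them. -/
def prelude : Prog Stack Γ' :=
  Prog.seq (sayConst [0, 2]
    (encName startLoc ++ (encName [] ++ items encName [startLoc, []]))) <|
  Prog.seq (sayConst [1, 3]
    (Γ'.bra :: (encName startLoc ++ (encLabel (Sum.inl startName) ++ [b1])))) <|
  Prog.seq (readName [1, 3]) <| Prog.seq (sayConst [1, 3] [Γ'.comma, Γ'.bra, b1]) <|
  Prog.seq (readName [1, 3])
    (sayConst [1, 3] (Γ'.comma :: (encLabel (Sum.inl stopName) ++ encName [])))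

theorem emits_prelude (u v : Name) (rest : List Γ') :
    Emits prelude { inp := encName u ++ (encName v ++ rest) } { inp := rest }
      ![encName startLoc ++ (encName [] ++ items encName [startLoc, []]),
        items (encEdge encLabel) [(startLoc, Sum.inl startName, origName u),
          (origName v, Sum.inl stopName, [])],
        encName startLoc ++ (encName [] ++ items encName [startLoc, []]),
        items (encEdge encLabel') [(startLoc, Sum.inl startName, origName u),
          (origName v, Sum.inl stopName, [])]]
      (4 * (u.length + v.length + 2) + 60) := by
  have h := (emits_sayConst (is := [0, 2]) (by decide)
      (encName startLoc ++ (encName [] ++ items encName [startLoc, []]))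
      { inp := encName u ++ (encName v ++ rest) }).seq <|
    (emits_sayConst (is := [1, 3]) (by decide)
      (Γ'.bra :: (encName startLoc ++ (encLabel (Sum.inl startName) ++ [b1]))) _).seq <|
    (emits_readName (is := [1, 3]) (by decide) u _ _ rfl).seq <|
    (emits_sayConst (is := [1, 3]) (by decide) [Γ'.comma, Γ'.bra, b1] _).seq <|
    (emits_readName (is := [1, 3]) (by decide) v _ _ rfl).seq
    (emits_sayConst (is := [1, 3]) (by decide)
      (Γ'.comma :: (encLabel (Sum.inl stopName) ++ encName [])) _)
  refine (h.congr rfl ?_).mono ?_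
  · intro i
    fin_cases i <;> simp [on, encEdge, encName, origName, encLabel', encLabel]
  · simp [encName, encLabel, startLoc, startName, stopName]
    omega

/-- Write the four lists. -/
def writeParts : Prog Stack Γ' :=
  Prog.seq prelude <| Prog.seq (forItems locBody) <| Prog.seq (forItems edgeBody) <|
  Prog.seq (forItems callBody) <| Prog.seq specials (sayConst [0, 1, 2, 3] [Γ'.ket])

theorem length_le_of_mem_items {X : Type} {e : X → List Γ'} {x : X} {l : List X} (hx : x ∈ l) :
    (e x).length + 1 ≤ (encList e l).length := by
  obtain ⟨l₁, l₂, rfl⟩ := List.append_of_mem hx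
  simp [encList]
  omega

theorem length_le_length_encList {X : Type} (e : X → List Γ') (l : List X) :
    l.length ≤ (encList e l).length := by
  induction l with
  | nil => simp
  | cons x l ih => simp [encList_cons]; omega

/-- The four parts of the output. -/
def partsOut (x : CoverInstance) : Fin 4 → List Γ' :=
  ![encName startLoc ++ (encName [] ++ encList encName (hatLocs x lockTail)),
    encList (encEdge encLabel) (hatEdges x id lockTail),
    encName startLoc ++ (encName [] ++ encList encName (hatLocs x syncTail)),
    encList (encEdge encLabel') (hatEdges x Sum.inl syncTail)]

/-- A constant factor of the cost of the machine. -/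
def costFactor : ℕ := gadgetCost nextTemplate + gadgetCost [] + 200

/-- There are at most as many items as input letters, and each costs linear time, since the length
of an item and the unary counter are bounded by the length of the input. -/
theorem emits_writeParts (x : CoverInstance) :
    Emits writeParts { inp := x.encode } { inp := [] } (partsOut x)
      (10 * costFactor * (x.encode.length + 1) ^ 2) := by
  obtain ⟨G, C, hC⟩ := x
  set L := (CoverInstance.encode ⟨G, C, hC⟩).length with hL
  have henc : CoverInstance.encode ⟨G, C, hC⟩ = encName G.init ++ (encName G.exit ++
      (encList encName G.locs ++ (encList (encEdge encLabel) G.edges ++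
        (encList encName C ++ [])))) := by
    simp [CoverInstance.encode, encCFG]
  have hlen : L = (encName G.init).length + ((encName G.exit).length +
      ((encList encName G.locs).length + ((encList (encEdge encLabel) G.edges).length +
        (encList encName C).length))) := by
    rw [hL, henc]
    simp
  have hlocs := length_le_length_encList encName G.locs
  have hedges := length_le_length_encList (encEdge encLabel) G.edges
  have hCs := length_le_length_encList encName C
  have hname : ∀ w, (encName w).length = w.length + 1 := fun w => by simp [encName]
  have hc : gadgetCost nextTemplate + gadgetCost [] + 200 = costFactor := rfl
  have hmul : ∀ a ≤ L + 1, gadgetCost nextTemplate * a ≤ gadgetCost nextTemplate * (L + 1) :=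
    fun a ha => Nat.mul_le_mul_left _ ha
  have h1 := emits_forItems encName locBody
    (fun _ ℓ => ![items encName [origName ℓ], [], items encName [origName ℓ], []]) (fun _ => [])
    (costFactor * (L + 1)) G.locs 0
    (encList (encEdge encLabel) G.edges ++ (encList encName C ++ [])) fun ℓ hℓ _ _ _ rest =>
      (emits_locBody ℓ rest []).mono (by
        have := length_le_of_mem_items (e := encName) hℓ
        rw [hname] at this
        rw [← hc]
        nlinarith)
  have h2 := emits_forItems (encEdge encLabel) edgeBody
    (fun _ e => ![items encName [edgeName e], items (encEdge encLabel) (splitEdge id e),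
      items encName [edgeName e], items (encEdge encLabel') (splitEdge Sum.inl e)]) (fun _ => [])
    (costFactor * (L + 1)) G.edges 0
    (encList encName C ++ []) fun e he _ _ _ rest =>
      (emits_edgeBody e rest []).mono (by
        have := length_le_of_mem_items (e := encEdge encLabel) he
        rw [← hc]
        nlinarith)
  have h3 := emits_forItems encName callBody (fun j ℓ => gadgetOut j (j + 1) (origName ℓ))
    (fun k => List.replicate k b1) (costFactor * (L + 1)) C 0 [] fun ℓ hℓ k _ hk rest =>
      (emits_callBody ℓ rest k).mono (by
        have := length_le_of_mem_items (e := encName) hℓ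
        rw [hname] at this
        have := hmul (k + 1) (by omega)
        rw [← hc]
        nlinarith)
  have h := (emits_prelude G.init G.exit _).seq <| h1.seq <| h2.seq <| h3.seq <|
    (emits_specials [] (0 + C.length)).seq
    (emits_sayConst (is := [0, 1, 2, 3]) (by decide) [Γ'.ket] _)
  rw [henc]
  refine (h.congr rfl ?_).mono ?_
  · intro i
    have h3' := itemsOut_calls 0 C i
    rw [itemsOut_locs, itemsOut_edges, ← List.append_assoc (itemsOut _ _ _ _), h3']
    fin_cases i <;> simp [partsOut, encList_eq_items, hatLocs, hatEdges, on]
  -- A uniform bound for the three loops; the summand 200 in `costFactor` absorbs the additive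
  -- constants.
  · have hq : ∀ n ≤ L, (n + 1) * (costFactor * (L + 1) + 2) ≤
        2 * costFactor * (L + 1) ^ 2 := by
      intro n hn
      have : (n + 1) * (costFactor * (L + 1) + 2) ≤ (L + 1) * (costFactor * (L + 1) + 2) :=
        Nat.mul_le_mul_right _ (by omega)
      have h200 : 200 ≤ costFactor := by omega
      nlinarith
    have e1 := hq G.locs.length (by omega)
    have e2 := hq G.edges.length (by omega)
    have e3 := hq C.length (by omega)
    have e4 : (gadgetCost nextTemplate + gadgetCost [] + 8) * (0 + C.length + 2) + 13 ≤
        2 * costFactor * (L + 1) := by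
      rw [← hc]
      have : (gadgetCost nextTemplate + gadgetCost [] + 8) * (0 + C.length + 2) ≤
        (gadgetCost nextTemplate + gadgetCost [] + 8) * (2 * (L + 1)) :=
        Nat.mul_le_mul_left _ (by omega)
      nlinarith
    have e5 : 4 * (G.init.length + G.exit.length + 2) + 60 + 4 ≤ costFactor * (L + 1) := by
      have := hname G.init
      have := hname G.exit
      rw [← hc]
      nlinarith
    have e6 : costFactor * (L + 1) ≤ costFactor * (L + 1) ^ 2 :=
      Nat.mul_le_mul_left _ (Nat.le_self_pow (by omega) _)
    simp only [List.length_cons, List.length_nil]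
    linarith

/-- Copy a part to the output. -/
def flush (i : Fin 4) : Prog Stack Γ' := consume (Stack.part i) isEnd [(Stack.out, reg)]

theorem runs_flush (i : Fin 4) (r : Option Γ') (O : Fin 4 → List Γ') (out : List Γ') :
    Runs (flush i) r (mem { inp := [] } O out) none
      (mem { inp := [] } (Function.update O i []) ((O i).reverse ++ out))
      (((O i).length + 1) * 3) := by
  have h := Runs.consume (Stack.part i) isEnd [(Stack.out, reg)] (fun r => rfl) (O i) []
    (fun _ _ => rfl) rfl r (mem { inp := [] } O out) (by simp [mem])
  refine h.congr_right ?_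
  funext k
  cases k with
  | part j =>
    by_cases hj : j = i
    · subst hj; simp [mem]
    · simp [mem, hj, word_singleton]
  | _ => simp [mem, word_singleton, reg]

/-- The program that computes the reduction. -/
def reduction : Prog Stack Γ' :=
  Prog.seq writeParts <| Prog.seq (Prog.push Stack.out fun _ => Γ'.ket) <|
  Prog.seq (flush 3) <| Prog.seq (flush 2) <| Prog.seq (flush 1) (flush 0)

/-- The parts lie reversed on their stacks, and flushing reverses them again. As the output is a
stack too, the last part is flushed first, on top of the `ket` that encodes the empty commutativity
relation. -/
theorem runs_reduction (x : CoverInstance) :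
    Runs reduction none (mem { inp := x.encode } (fun _ => []) []) none
      (mem { inp := [] } (fun _ => []) (hatInstance x).encode)
      (150 * costFactor * (x.encode.length + 1) ^ 2) := by
  obtain ⟨r, h⟩ := emits_writeParts x none (fun _ => []) []
  -- The cost also bounds the growth of the stacks, hence the lengths of the parts.
  have hlen : ∀ i, (partsOut x i).length ≤ 10 * costFactor * (x.encode.length + 1) ^ 2 := by
    intro i
    simpa [mem] using h.1 (Stack.part i)
  have h1 : Runs (Prog.push Stack.out fun _ => Γ'.ket) r
      (mem { inp := [] } (fun i => (partsOut x i).reverse ++ []) []) r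
      (mem { inp := [] } (fun i => (partsOut x i).reverse ++ []) [Γ'.ket]) 1 := by
    refine (Runs.push Stack.out (fun _ => Γ'.ket) r _).congr_right ?_
    funext k
    cases k <;> simp [mem, Function.update]
  have h2 := h.seq <| h1.seq <| (runs_flush 3 r _ _).seq <| (runs_flush 2 none _ _).seq <|
    (runs_flush 1 none _ _).seq (runs_flush 0 none _ _)
  refine (h2.congr_right ?_).mono ?_
  · congr 1
    · funext i
      fin_cases i <;> simp [Function.update]
    · simp [Function.update, SoundnessInstance.encode, hatInstance, hatGraph, hatGraph', hatCFG,
        encCFG, partsOut, encList]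
  -- Writing the parts accounts for 10 of the factor 150, and the four flushes, at three units per
  -- letter, for 120; the remainder absorbs constants.
  · have k0 := hlen 0
    have k1 := hlen 1
    have k2 := hlen 2
    have k3 := hlen 3
    have hp : 1 ≤ costFactor * (x.encode.length + 1) ^ 2 :=
      Nat.one_le_iff_ne_zero.2 (by unfold costFactor; positivity)
    simp [Function.update]
    nlinarith

/-- The machine that computes the reduction. -/
def machine : FinTM2 where
  K := Stack
  k₀ := Stack.inp
  k₁ := Stack.out
  Γ _ := Γ'
  Λ := Option reduction.Lab
  main := none
  ΛFin := @instFintypeOption _ reduction.labFintype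
  σ := Option Γ'
  initialState := none
  m
  | none => reduction.entry some TM2.Stmt.halt
  | some l => reduction.code some TM2.Stmt.halt l

/-- The additional step leaves the main label `none`, which is not a label of the program itself. -/
theorem machine_outputs (x : CoverInstance) :
    Nonempty (TM2OutputsInTime machine x.encode (some (hatInstance x).encode)
      (150 * costFactor * (x.encode.length + 1) ^ 2 + 1)) := by
  obtain ⟨n, hn, h⟩ := (runs_reduction x).2 (Option reduction.Lab) machine.m some TM2.Stmt.halt
    fun _ => rfl
  have h1 := (StepsTo.label machine.m none none (mem { inp := x.encode } (fun _ => []) [])).trans h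
  have hi : initList machine x.encode =
      (⟨some none, none, mem { inp := x.encode } (fun _ => []) []⟩ :
        TM2.Cfg (fun _ : Stack => Γ') (Option reduction.Lab) (Option Γ')) := by
    unfold initList
    congr 1
    funext k
    cases k <;> rfl
  have ho : haltList machine (hatInstance x).encode =
      (⟨none, none, mem { inp := [] } (fun _ => []) (hatInstance x).encode⟩ :
        TM2.Cfg (fun _ : Stack => Γ') (Option reduction.Lab) (Option Γ')) := by
    unfold haltList
    congr 1
    funext k
    cases k <;> rfl
  refine ⟨⟨⟨1 + n, ?_⟩, (by omega : 1 + n ≤ _)⟩⟩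
  rw [hi]
  exact Eq.trans h1 (congrArg some ho.symm)

theorem nonempty_computable :
    Nonempty (TM2ComputableInPolyTime CoverInstance.encode SoundnessInstance.encode
      hatInstance) := by
  refine ⟨⟨⟨machine, Equiv.refl _, Equiv.refl _⟩,
    Polynomial.C (150 * costFactor) * (Polynomial.X + 1) ^ 2 + 1, fun x => ?_⟩⟩
  have h := Classical.choice (machine_outputs x)
  have hmap : ∀ l : List Γ', l.map (Equiv.refl Γ').invFun = l := List.map_id
  have ht : (Polynomial.C (150 * costFactor) * (Polynomial.X + 1) ^ 2 + 1).eval x.encode.length =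
      150 * costFactor * (x.encode.length + 1) ^ 2 + 1 := by simp
  rw [← ht, ← hmap x.encode, ← hmap (hatInstance x).encode, List.length_map] at h
  exact h

end LockPrograms


/-- Coverability of programs with locks reduces in polynomial time to the (complement of the)
sync-point soundness problem of programs with locks, and the commutativity relation plays no role in
the reduction. -/
theorem mainTheorem9 :
    ∃ f : LockPrograms.CoverInstance → LockPrograms.SoundnessInstance,
      Nonempty (Turing.TM2ComputableInPolyTime
        LockPrograms.CoverInstance.encode LockPrograms.SoundnessInstance.encode f) ∧
      ∀ x : LockPrograms.CoverInstance,
        ((f x).IsSound ↔ ¬ x.IsCoverable) ∧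
        ∀ I : Set (LockPrograms.Name × LockPrograms.Name),
          (∀ p ∈ I, p.1 ∈ (f x).G.actions ∧ p.2 ∈ (f x).G.actions) →
            (LockPrograms.SoundInstrumentation (LockPrograms.lockProgram (f x).G) (f x).G' I ↔
              ¬ x.IsCoverable) :=
  ⟨LockPrograms.hatInstance, LockPrograms.nonempty_computable,
    fun x => ⟨LockPrograms.sound_iff_not_coverable x _,
      fun I _ => LockPrograms.sound_iff_not_coverable x I⟩⟩
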